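/- **Setting.** Let $\mathsf X$ be a Polish space with its Borel $\sigma$-field, $\nu$ a $\sigma$-finite measure on $\mathsf X$, $\chi$ a probability measure, $Q(x,dx')=q(x,x')\,\nu(dx')$ a Markov kernel with measurable transition density $q$, and $g_0,g_1,\dots\ge 0$ measurable functions ($g_t(x)=g(x,y_t)$ is the likelihood of the fixed observation $y_t$). Write $dx=\nu(dx)$. Let $0\le s\le T$. The joint smoothing distribution is $$\phi_{s:T|T}(h)=\frac{\int\!\cdots\!\int \chi(dx_0)g_0(x_0)\prod_{u=1}^{T}Q(x_{u-1},dx_u)g_u(x_u)\,h(x_{s:T})}{\int\!\cdots\!\int \chi(dx_0)g_0(x_0)\prod_{u=1}^{T}Q(x_{u-1},dx_u)g_u(x_u)},$$ where the denominator is assumed to be positive. Similarly $\phi_{s:t|t}$ is defined with horizon $t\le T$; $\phi_t=\phi_{t:t|t}$ is the filter; $\phi_{t|t-1}=\phi_{t-1}Q$ for $t\ge1$ and $\phi_{0|-1}=\chi$. **Algorithms.** Let $\rho_0$ be a probability measure with $\chi\ll\rho_0$ and, for $t\ge 1$, let $\vartheta_t\ge0$ be a measurable function and $p_t$ a measurable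 Markov transition density with respect to $\nu$. Put $$\omega_0(x)=\frac{d\chi}{d\rho_0}(x)g_0(x),\qquad \omega_t(x,x')=\frac{q(x,x')g_t(x')}{\vartheta_t(x)p_t(x,x')}\quad(t\ge1),$$ with $0/0=0$ and $a/0=\infty$ for $a>0$. The auxiliary particle filter with $N$ particles draws $\xi_0^1,\dots,\xi_0^N$ i.i.d. from $\rho_0$ and sets $\omega_0^i=\omega_0(\xi_0^i)$. For $1\le t\le T$, conditionally on $\mathcal F_{t-1}=\sigma(\xi_u^i,\omega_u^i;\,u\le t-1,\,i\le N)$, it draws i.i.d. pairs $(I_t^i,\xi_t^i)$, $i=1,\dots,N$, from the distribution on $\{1,\dots,N\}\times\mathsf X$ proportional to $\omega_{t-1}^{j}\vartheta_t(\xi_{t-1}^{j})p_t(\xi_{t-1}^{j},x)\,dx$ and sets $\omega_t^i=\omega_t(\xi_{t-1}^{I_t^i},\xi_t^i)$. If $\sum_j\omega_{t-1}^j\vartheta_t(\xi_{t-1}^j)=0$ for some $t\le T$, the run may be continued arbitrarily. For an index path $i_{s:T}\in\{1,\dots,N\}^{T-s+1}$ let $$W(i_{s:T})=\frac{\omega_T^{i_T}}{\sum_\ell\omega_T^\ell}\prod_{u=s}^{T-1}\frac{\omega_u^{i_u}q(\xi_u^{i_u},\xi_{u+1}^{i_{u+1}})}{\sum_\ell\omega_u^\ell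 q(\xi_u^\ell,\xi_{u+1}^{i_{u+1}})}\qquad(\text{with }a/0=0).$$ The FFBSm estimator is $\hat\phi_{s:T|T}(h)=\sum_{i_{s:T}}W(i_{s:T})\,h(\xi_s^{i_s},\dots,\xi_T^{i_T})$. The FFBSi estimator is $\tilde\phi_{s:T|T}(h)=N^{-1}\sum_{\ell=1}^N h(\xi_s^{J_s^\ell},\dots,\xi_T^{J_T^\ell})$, where, conditionally on $\mathcal F_T$, the index paths $J_{s:T}^1,\dots,J_{s:T}^N$ are i.i.d. with distribution $W$ (arbitrary if the filter has degenerated at some step or $\sum_\ell\omega_T^\ell=0$). **Variances.** For $s\le t\le T$ let $L_{s,t,T}(x_{s:t},h)=\int\!\cdots\!\int\prod_{u=t}^{T-1}Q(x_u,dx_{u+1})g_{u+1}(x_{u+1})\,h(x_{s:T})$, and for $r\le s$ and a function $f$ on $\mathsf X$ let $L_{r,s}(x_r,f)=\int\!\cdots\!\int\prod_{u=r}^{s-1}Q(x_u,dx_{u+1})g_{u+1}(x_{u+1})\,f(x_s)$. Let $\Gamma_{s|s}[f]=\sum_{r=0}^sV_{r,s}[f]$ with $$V_{0,s}[f]=\frac{\rho_0(\omega_0^2L_{0,s}^2(\cdot,f))}{\chi(g_0L_{0,s}(\cdot,\mathbf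 1))^2},\qquad V_{r,s}[f]=\frac{\phi_{r-1}\big[\vartheta_r(\cdot)\int p_r(\cdot,x)\omega_r^2(\cdot,x)L_{r,s}^2(x,f)\,dx\big]\,\phi_{r-1}(\vartheta_r)}{\phi_{r|r-1}(g_rL_{r,s}(\cdot,\mathbf 1))^2}\quad(r\ge1).$$ For $s<t\le T$ let $$g_{s,t,T}(x,h)=\frac{\phi_{s:t-1|t-1}\big(q(x_{t-1},x)\,L_{s,t,T}([x_{s:t-1},x],h)\big)}{\phi_{t-1}(q(\cdot,x))},\qquad \upsilon_{s,t,T}(x,h)=\vartheta_t(x)\int p_t(x,x')\,\omega_t^2(x,x')\,g_{s,t,T}^2(x',h)\,dx',$$ where in the first formula $\phi_{s:t-1|t-1}$ integrates over $x_{s:t-1}$. Let $$\Gamma_{s:T|T}[h]=\frac{\Gamma_{s|s}[L_{s,s,T}(\cdot,h)]}{\phi_s(L_{s,s,T}(\cdot,\mathbf 1))^2}+\sum_{t=s+1}^T\frac{\phi_{t-1}(\upsilon_{s,t,T}(\cdot,h))\,\phi_{t-1}(\vartheta_t)}{\phi_{t|t-1}(g_tL_{t,t,T}(\cdot,\mathbf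 1))^2}.$$ **Theorem.** Assume $\sup_{0\le t\le T}\|g_t\|_\infty<\infty$, $\sup_{1\le t\le T}\|\vartheta_t\|_\infty<\infty$ and $\sup_{0\le t\le T}\|\omega_t\|_\infty<\infty$ (for $\omega_0$ the $\rho_0$-essential supremum). Then for every bounded measurable $h:\mathsf X^{T-s+1}\to\mathbb R$, as $N\to\infty$, $$\sqrt N\big(\hat\phi_{s:T|T}(h)-\phi_{s:T|T}(h)\big)\xrightarrow{\mathcal D}\mathcal N\big(0,\ \Gamma_{s:T|T}[h-\phi_{s:T|T}(h)]\big),$$ $$\sqrt N\big(\tilde\phi_{s:T|T}(h)-\phi_{s:T|T}(h)\big)\xrightarrow{\mathcal D}\mathcal N\big(0,\ \phi_{s:T|T}\big[(h-\phi_{s:T|T}(h))^2\big]+\Gamma_{s:T|T}[h-\phi_{s:T|T}(h)]\big).$$ -/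

import Mathlib

open MeasureTheory ProbabilityTheory Filter
open scoped NNReal ENNReal

noncomputable section

namespace ParticleSmoothing

/-- A fully dominated state space model with frozen observations: a `σ`-finite dominating measure
`ν`, an initial distribution `χ`, a Markov transition density `q` with respect to `ν`, and the
likelihoods `g t x = g (x, y_t)` of the fixed observations. -/
structure StateSpaceModel (X : Type*) [MeasurableSpace X] where
  ν : Measure X
  sigmaFinite_ν : SigmaFinite ν
  χ : Measure X
  isProbabilityMeasure_χ : IsProbabilityMeasure χ
  q : X → X → ℝ≥0
  measurable_q : Measurable (Function.uncurry q)
  lintegral_q : ∀ x, ∫⁻ x', (q x x' : ℝ≥0∞) ∂ν = 1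
  g : ℕ → X → ℝ≥0
  measurable_g : ∀ t, Measurable (g t)

/-- The design parameters of the auxiliary particle filter: the initial instrumental distribution
`ρ₀` (dominating `χ`), the adjustment multipliers `ϑ t` and the proposal densities `p t` with
respect to `ν`. Only `ϑ t`, `p t` with `t ≥ 1` are used. -/
structure AuxiliaryProposal {X : Type*} [MeasurableSpace X] (M : StateSpaceModel X) where
  ρ₀ : Measure X
  isProbabilityMeasure_ρ₀ : IsProbabilityMeasure ρ₀
  absolutelyContinuous : M.χ ≪ ρ₀
  ϑ : ℕ → X → ℝ≥0
  measurable_ϑ : ∀ t, Measurable (ϑ t)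
  p : ℕ → X → X → ℝ≥0
  measurable_p : ∀ t, Measurable (Function.uncurry (p t))
  lintegral_p : ∀ t x, ∫⁻ x', (p t x x' : ℝ≥0∞) ∂M.ν = 1

namespace StateSpaceModel

variable {X : Type*} [MeasurableSpace X] (M : StateSpaceModel X)

/-- `m` steps of the recursion
`L_t(x_{0:t}, f) = ∫ q(x_t, x') g_{t+1}(x') L_{t+1}([x_{0:t}, x'], f) ν(dx')`.
A path is a sequence `x : ℕ → X` whose entries after time `t` are irrelevant, since they are
overwritten. -/
def Laux : ℕ → ℕ → (ℕ → X) → ((ℕ → X) → ℝ) → ℝ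
  | 0, _, x, f => f x
  | m + 1, t, x, f =>
      ∫ x', (M.q (x t) x' : ℝ) * (M.g (t + 1) x' : ℝ) *
        Laux m (t + 1) (Function.update x (t + 1) x') f ∂M.ν

/-- For `t ≤ T` and a function `f` of `x_{s:T}`, the kernel `L_{s,t,T}(x_{s:t}, f)`, that is
`∫⋯∫ ∏_{u=t}^{T-1} q(x_u, x_{u+1}) g_{u+1}(x_{u+1}) f(x_{s:T}) ν(dx_{t+1}) ⋯ ν(dx_T)`. -/
def L (T t : ℕ) (x : ℕ → X) (f : (ℕ → X) → ℝ) : ℝ := M.Laux (T - t) t x f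

/-- The unnormalized smoothing functional
`∫⋯∫ χ(dx_0) g_0(x_0) ∏_{u=1}^{T} Q(x_{u-1}, dx_u) g_u(x_u) f(x_{0:T})`. -/
def unnormalized (T : ℕ) (f : (ℕ → X) → ℝ) : ℝ :=
  ∫ x₀, (M.g 0 x₀ : ℝ) * M.L T 0 (fun _ => x₀) f ∂M.χ

/-- The joint smoothing distribution `φ_{0:T|T}`, evaluated at a function `f` of `x_{0:T}`. If `f`
depends on `x_{s:T}` only, this is `φ_{s:T|T}(f)`. -/
def smoothing (T : ℕ) (f : (ℕ → X) → ℝ) : ℝ :=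
  M.unnormalized T f / M.unnormalized T (fun _ => 1)

/-- The filtering distribution `φ_{t|t}(f)`. -/
def filtering (t : ℕ) (f : X → ℝ) : ℝ := M.smoothing t (fun x => f (x t))

/-- The predictive distribution `φ_{t|t-1}(f)`, with `φ_{0|-1} = χ`. -/
def predictive : ℕ → (X → ℝ) → ℝ
  | 0, f => ∫ x, f x ∂M.χ
  | t + 1, f => M.filtering t (fun x => ∫ x', (M.q x x' : ℝ) * f x' ∂M.ν)

/-- `L_{r,s}(x, f)`: the integral of `f(x_s)` against
`∏_{u=r}^{s-1} q(x_u, x_{u+1}) g_{u+1}(x_{u+1})`, started from `x_r = x`. -/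
def Lmarg (r s : ℕ) (x : X) (f : X → ℝ) : ℝ := M.L s r (fun _ => x) (fun y => f (y s))

/-- `g_{s,t,T}(x, f)` at `t = r + 1`, for a function `f` of `x_{s:T}`. -/
def gSmooth (T r : ℕ) (x : X) (f : (ℕ → X) → ℝ) : ℝ :=
  M.smoothing r (fun y => (M.q (y r) x : ℝ) * M.L T (r + 1) (Function.update y (r + 1) x) f) /
    M.filtering r (fun y => (M.q y x : ℝ))

end StateSpaceModel

/-- The function `h` on `X^{n+1}` as a function of the segment `x_{s:s+n}` of a path. -/
def onSegment {X : Type*} (s n : ℕ) (h : (Fin (n + 1) → X) → ℝ) (x : ℕ → X) : ℝ :=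
  h (fun k => x (s + (k : ℕ)))

namespace AuxiliaryProposal

variable {X : Type*} [MeasurableSpace X] {M : StateSpaceModel X} (A : AuxiliaryProposal M)

/-- The importance weight function `ω_0 = (dχ/dρ₀) g_0`. -/
def w₀ (x : X) : ℝ≥0∞ := M.χ.rnDeriv A.ρ₀ x * M.g 0 x

/-- The importance weight function `ω_t(x, x') = q(x, x') g_t(x') / (ϑ_t(x) p_t(x, x'))`, `t ≥ 1`,
with `0 / 0 = 0` and `a / 0 = ∞` for `a > 0`. -/
def w (t : ℕ) (x x' : X) : ℝ≥0∞ :=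
  ((M.q x x' * M.g t x' : ℝ≥0) : ℝ≥0∞) / ((A.ϑ t x * A.p t x x' : ℝ≥0) : ℝ≥0∞)

/-- The adjustment multipliers and the importance weight functions are bounded up to time `T`. (The
density `dχ/dρ₀`, hence `ω_0`, is only defined up to `ρ₀`-null sets.) -/
def BoundedWeights (T : ℕ) : Prop :=
  ∃ C : ℝ≥0, (∀ t, 1 ≤ t → t ≤ T → ∀ x, A.ϑ t x ≤ C) ∧
    (∀ᵐ x ∂A.ρ₀, A.w₀ x ≤ C) ∧
    ∀ t, 1 ≤ t → t ≤ T → ∀ x x', A.w t x x' ≤ C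

/-! ### Asymptotic variances -/

/-- The term `V_{r,s}[f]` of the asymptotic variance of the auxiliary particle filter. -/
def V : ℕ → ℕ → (X → ℝ) → ℝ
  | 0, s, f =>
      (∫ x, (A.w₀ x).toReal ^ 2 * M.Lmarg 0 s x f ^ 2 ∂A.ρ₀) /
        M.predictive 0 (fun x => (M.g 0 x : ℝ) * M.Lmarg 0 s x (fun _ => 1)) ^ 2
  | r + 1, s, f =>
      M.filtering r (fun x => (A.ϑ (r + 1) x : ℝ) *
          ∫ x', (A.p (r + 1) x x' : ℝ) * (A.w (r + 1) x x').toReal ^ 2 *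
            M.Lmarg (r + 1) s x' f ^ 2 ∂M.ν) *
        M.filtering r (fun x => (A.ϑ (r + 1) x : ℝ)) /
        M.predictive (r + 1)
          (fun x => (M.g (r + 1) x : ℝ) * M.Lmarg (r + 1) s x (fun _ => 1)) ^ 2

/-- `Γ_{s|s}[f] = ∑_{r=0}^{s} V_{r,s}[f]`. -/
def filterVariance (s : ℕ) (f : X → ℝ) : ℝ := ∑ r ∈ Finset.range (s + 1), A.V r s f

/-- `υ_{s,t,T}(x, f)` at `t = r + 1`, for a function `f` of `x_{s:T}`. -/
def upsilon (T r : ℕ) (x : X) (f : (ℕ → X) → ℝ) : ℝ :=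
  (A.ϑ (r + 1) x : ℝ) *
    ∫ x', (A.p (r + 1) x x' : ℝ) * (A.w (r + 1) x x').toReal ^ 2 * M.gSmooth T r x' f ^ 2 ∂M.ν

/-- `Γ_{s:T|T}[f]` for a function `f` of `x_{s:T}`; the sum is indexed by `r = t - 1`. -/
def smoothingVariance (s T : ℕ) (f : (ℕ → X) → ℝ) : ℝ :=
  A.filterVariance s (fun x => M.L T s (fun _ => x) f) /
      M.filtering s (fun x => M.L T s (fun _ => x) (fun _ => 1)) ^ 2 +
    ∑ r ∈ Finset.Ico s T,
      M.filtering r (fun x => A.upsilon T r x f) *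
        M.filtering r (fun x => (A.ϑ (r + 1) x : ℝ)) /
        M.predictive (r + 1)
          (fun x => (M.g (r + 1) x : ℝ) * M.L T (r + 1) (fun _ => x) (fun _ => 1)) ^ 2

/-! ### The auxiliary particle filter

`ξ t i` is the `i`-th particle at time `t`, and for `t ≥ 1`, `I t i` is the index of its ancestor
among the particles at time `t - 1`. -/

variable {Ω : Type*} {N : ℕ}

/-- The importance weight `ω_t^i` of the particle `ξ_t^i`. -/
def weight (ξ : ℕ → Fin N → Ω → X) (I : ℕ → Fin N → Ω → Fin N) : ℕ → Fin N → Ω → ℝ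
  | 0, i, ω => (A.w₀ (ξ 0 i ω)).toReal
  | t + 1, i, ω => (A.w (t + 1) (ξ t (I (t + 1) i ω) ω) (ξ (t + 1) i ω)).toReal

/-- The `σ`-field `F_t` generated by the particles and the weights up to time `t`. -/
abbrev history (ξ : ℕ → Fin N → Ω → X) (I : ℕ → Fin N → Ω → Fin N) (t : ℕ) : MeasurableSpace Ω :=
  ⨆ (u : ℕ) (_ : u ≤ t) (i : Fin N),
    MeasurableSpace.comap (fun ω => (ξ u i ω, A.weight ξ I u i ω)) inferInstance

/-- The event that the instrumental distributions of the steps `1, …, t` are well defined, that is,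
that their normalizing constants `∑_i ω_u^i ϑ_{u+1}(ξ_u^i)`, `u < t`, are positive. -/
def alive (ξ : ℕ → Fin N → Ω → X) (I : ℕ → Fin N → Ω → Fin N) (t : ℕ) : Set Ω :=
  {ω | ∀ u < t, 0 < ∑ i, A.weight ξ I u i ω * (A.ϑ (u + 1) (ξ u i ω) : ℝ)}

/-- The instrumental distribution of one pair (ancestor index, new particle) in step `t`, given the
particles `x` and the weights `v` at time `t - 1`: it is proportional to
`v_i ϑ_t(x_i) p_t(x_i, x') ν(dx')`. -/
def instrumental (t : ℕ) (x : Fin N → X) (v : Fin N → ℝ) : Measure (Fin N × X) :=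
  ∑ i, ENNReal.ofReal (v i * (A.ϑ t (x i) : ℝ) / ∑ ℓ, v ℓ * (A.ϑ t (x ℓ) : ℝ)) •
    (Measure.dirac i).prod (M.ν.withDensity (fun x' => (A.p t (x i) x' : ℝ≥0∞)))

/-- `(ξ, I)` is a run of the auxiliary particle filter with `N` particles up to time `T`: the initial
particles are i.i.d. from `ρ₀`, and given the past `F_t` the `N` pairs (ancestor index, new particle)
of step `t + 1` are i.i.d. from the instrumental distribution. Nothing is required of a run after its
instrumental distribution has degenerated. -/
structure IsParticleFilter [MeasurableSpace Ω] (P : Measure Ω) (T : ℕ)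
    (ξ : ℕ → Fin N → Ω → X) (I : ℕ → Fin N → Ω → Fin N) : Prop where
  measurable_particle : ∀ t i, Measurable (ξ t i)
  measurable_ancestor : ∀ t i, Measurable (I t i)
  law_zero : P.map (fun ω i => ξ 0 i ω) = Measure.pi (fun _ => A.ρ₀)
  law_succ : ∀ t < T, ∀ B : Set Ω, MeasurableSet[A.history ξ I t] B →
    ∀ S : Set (Fin N → Fin N × X), MeasurableSet S →
      P (B ∩ A.alive ξ I (t + 1) ∩ {ω | (fun i => (I (t + 1) i ω, ξ (t + 1) i ω)) ∈ S}) =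
        ∫⁻ ω in B ∩ A.alive ξ I (t + 1),
          Measure.pi (fun _ : Fin N =>
            A.instrumental (t + 1) (fun i => ξ t i ω) (fun i => A.weight ξ I t i ω)) S ∂P

/-! ### The FFBSm and FFBSi estimators -/

/-- The probability of the index path `j = i_{s:T}`, `T = s + n`, under the backward Markov chain
started from `ω_T^i / ∑_ℓ ω_T^ℓ` which moves from the index `i'` at time `u + 1` to the index `i` at
time `u` with probability `ω_u^i q(ξ_u^i, ξ_{u+1}^{i'}) / ∑_ℓ ω_u^ℓ q(ξ_u^ℓ, ξ_{u+1}^{i'})`. -/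
def pathWeight (ξ : ℕ → Fin N → Ω → X) (I : ℕ → Fin N → Ω → Fin N) (s n : ℕ)
    (j : Fin (n + 1) → Fin N) (ω : Ω) : ℝ :=
  A.weight ξ I (s + n) (j (Fin.last n)) ω / (∑ ℓ, A.weight ξ I (s + n) ℓ ω) *
    ∏ k : Fin n,
      A.weight ξ I (s + k) (j k.castSucc) ω *
          (M.q (ξ (s + k) (j k.castSucc) ω) (ξ (s + k + 1) (j k.succ) ω) : ℝ) /
        ∑ ℓ, A.weight ξ I (s + k) ℓ ω *
          (M.q (ξ (s + k) ℓ ω) (ξ (s + k + 1) (j k.succ) ω) : ℝ)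

/-- The FFBSm estimator of `φ_{s:T|T}(h)`, `T = s + n`. -/
def ffbsm (ξ : ℕ → Fin N → Ω → X) (I : ℕ → Fin N → Ω → Fin N) (s n : ℕ)
    (h : (Fin (n + 1) → X) → ℝ) (ω : Ω) : ℝ :=
  ∑ j : Fin (n + 1) → Fin N, A.pathWeight ξ I s n j ω * h (fun k => ξ (s + k) (j k) ω)

/-- `J 1, …, J N` are the index paths drawn by the FFBSi sampler: given `F_T`, `T = s + n`, they are
i.i.d. trajectories of the backward Markov chain on the particle indices. Nothing is required if the
particle filter has degenerated. -/
structure IsBackwardSample [MeasurableSpace Ω] (P : Measure Ω)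
    (ξ : ℕ → Fin N → Ω → X) (I : ℕ → Fin N → Ω → Fin N) (s n : ℕ)
    (J : Fin N → Ω → Fin (n + 1) → Fin N) : Prop where
  measurable : ∀ ℓ, Measurable (J ℓ)
  law : ∀ B : Set Ω, MeasurableSet[A.history ξ I (s + n)] B →
    B ⊆ A.alive ξ I (s + n) ∩ {ω | 0 < ∑ i, A.weight ξ I (s + n) i ω} →
    ∀ j : Fin N → Fin (n + 1) → Fin N,
      P (B ∩ {ω | ∀ ℓ, J ℓ ω = j ℓ}) =
        ∫⁻ ω in B, ENNReal.ofReal (∏ ℓ, A.pathWeight ξ I s n (j ℓ) ω) ∂P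

end AuxiliaryProposal

/-- The FFBSi estimator: the average of `h` over the `N` sampled particle trajectories. -/
def ffbsi {X Ω : Type*} {N : ℕ} (ξ : ℕ → Fin N → Ω → X) (s n : ℕ)
    (J : Fin N → Ω → Fin (n + 1) → Fin N) (h : (Fin (n + 1) → X) → ℝ) (ω : Ω) : ℝ :=
  (N : ℝ)⁻¹ * ∑ ℓ, h (fun k => ξ (s + k) (J ℓ ω k) ω)

end ParticleSmoothing

end

open MeasureTheory ProbabilityTheory Filter
open scoped NNReal ENNReal

noncomputable section

namespace ParticleSmoothing

open Topology

/-! ### Quantitative central limit and moment bounds for i.i.d. bounded variables. -/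

section GaussianApproximation

/-! The estimators are self-normalized, but a quotient of unnormalized quantities is easier to
handle. To a particle system `d` belongs the finite measure `est t d` on paths: the product `scale t
d` of the averaged adjusted weights before time `t`, times the average over `i` of `ω_t^i` times the
law `back t d i` of the backward trajectory ending in particle `i`. It is an unbiased estimator of
the unnormalized smoothing measure `pathMeasure t` (`IsRun.lintegral_est_eq`). Almost surely, the
error of FFBSm multiplied by the total mass `estMass` is the `est`-integral of the centred function
`f = h - φ(h)`; since `estMass` converges in probability to `mass T > 0`, Slutsky's theorem
(`TendstoInDistribution.gaussian_of_mul`) reduces the claim to a central limit theorem for `√N ∫ f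
d(est T)`, where `f` is bounded and has `pathMeasure T`-integral zero.

Including `scale` turns the estimator into a martingale. Given the particles up to time `t`, the
conditional expectation of the next estimate of `f` is the current estimate of `predict t f`
(`scale_mul_integral_incr`), and `predict` sends `L_{t+1} f` to `L_t f` (`predict_L`). Hence the
current estimates of `L_t f` form a martingale in `t` that ends in the estimate of `f`. Given the
past, each increment is an average of `N` i.i.d. bounded variables, so its conditional
characteristic function is within `O(1/√N)` of a Gaussian one with variance `condVar`
(`norm_charFun_pi_sub_exp_le`). If `condVar` tends in `L¹` to a constant `stepVar`, every step
multiplies the limiting characteristic function by a Gaussian factor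
(`IsCondLawOn.enorm_charFun_sub_le`, `tendsto_charFun_est`). Degeneration of the filter needs no
separate estimate: when `scale` vanishes, so do `est`, the increments and the conditional variances.

The main difficulty is the convergence of `condVar`. The conditional second moment is an integral
over the new state `x` of `sqDensity` times the square of a backward mean, and that mean is the
quotient `jointDensity / predDensity`, all three being `est`-integrals of functions with parameter
`x`. No lower bound on the denominator is available, but the map `(a, b, c) ↦ b (c / a) ^ 2` is
Lipschitz under the bounds `|c| ≤ K a` and `b ≤ C a` (`abs_mul_sq_sub_le`), which follow from the
boundedness of `f`, `g` and the weights. So it is enough that the three densities converge in `L¹(P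
⊗ ν)`. As `q` may be unbounded and `ν` infinite, this is done by truncation
(`tendsto_lintegral_lintegral_enorm`): unbiasedness controls the truncation error uniformly in `N`,
and the `O(1/√N)` law of large numbers controls the truncated part.

The resulting variance is identified with `Γ` in `smoothingVariance_eq`; for the steps up to time
`s` the Markov property collapses the conditional mean to a function of the current state. FFBSi
adds one more conditionally i.i.d. step after time `T`, which contributes the term `φ((h -
φ(h))^2)`. The convention `0/0 = 0` in `W` and the uniform default in `back` agree almost surely
where it matters, because particles of positive weight have ancestors of positive weight
(`IsRun.ae_isReachable`). -/

lemma norm_pow_sub_pow_le_of_norm_le_one {a b : ℂ} (ha : ‖a‖ ≤ 1) (hb : ‖b‖ ≤ 1) (n : ℕ) :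
    ‖a ^ n - b ^ n‖ ≤ n * ‖a - b‖ := by
  induction n with
  | zero => simp
  | succ n ih =>
    have h1 : a ^ (n + 1) - b ^ (n + 1) = a * (a ^ n - b ^ n) + (a - b) * b ^ n := by ring
    rw [h1]
    refine (norm_add_le _ _).trans ?_
    rw [norm_mul, norm_mul, norm_pow]
    have h2 : ‖a‖ * ‖a ^ n - b ^ n‖ ≤ 1 * (n * ‖a - b‖) := by gcongr
    have h3 : ‖a - b‖ * ‖b‖ ^ n ≤ ‖a - b‖ * 1 := by
      gcongr; exact pow_le_one₀ (norm_nonneg _) hb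
    push_cast
    linarith

lemma norm_exp_I_sub_le (x : ℝ) :
    ‖Complex.exp (x * Complex.I) - (1 + x * Complex.I - x ^ 2 / 2)‖ ≤ |x| ^ 3 * Real.exp |x| := by
  have h := Complex.norm_exp_sub_sum_le_norm_mul_exp (x * Complex.I) 3
  have h2 : ∑ m ∈ Finset.range 3, ((x : ℂ) * Complex.I) ^ m / (m.factorial : ℂ)
      = 1 + x * Complex.I - x ^ 2 / 2 := by
    simp [Finset.sum_range_succ, mul_pow, Complex.I_sq, Nat.factorial]
    ring
  rw [h2] at h
  simpa using h

lemma norm_exp_neg_sub_le (x : ℝ) :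
    ‖Complex.exp (-x : ℂ) - (1 - x)‖ ≤ |x| ^ 2 * Real.exp |x| := by
  have h := Complex.norm_exp_sub_sum_le_norm_mul_exp (-x : ℂ) 2
  simpa [Finset.sum_range_succ, ← sub_eq_add_neg] using h

variable {E : Type*} [MeasurableSpace E]

lemma Integrable_of_abs_le {μ : Measure E} [IsFiniteMeasure μ] {f : E → ℝ}
    (hf : AEStronglyMeasurable f μ) {c : ℝ} (hc : ∀ᵐ x ∂μ, |f x| ≤ c) : Integrable f μ :=
  Integrable.of_bound hf c hc

/-- The error constant in the characteristic function bound for i.i.d. bounded summands. -/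
def iidConst (x : ℝ) : ℝ := x ^ 3 * Real.exp x + x ^ 4 * Real.exp (x ^ 2)

/-- Both terms are compared with their common expansion `1 - a² v / 2`, where `v ≤ c²`. The error
depends on `ρ` and `φ` only through the bound `c`, which matters because the result is later applied
to random laws `ρ`. -/
lemma norm_charFun_sub_exp_le (ρ : Measure E) [IsProbabilityMeasure ρ] {φ : E → ℝ}
    (hφ : Measurable φ) {c : ℝ} (hc : ∀ᵐ x ∂ρ, |φ x| ≤ c) (h0 : ∫ x, φ x ∂ρ = 0) (a : ℝ) :
    ‖(∫ x, Complex.exp ((a * φ x : ℝ) * Complex.I) ∂ρ)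
      - Complex.exp (-(a ^ 2 * (∫ x, φ x ^ 2 ∂ρ) / 2 : ℝ))‖
      ≤ |a * c| ^ 3 * Real.exp |a * c| + (a * c) ^ 4 * Real.exp ((a * c) ^ 2) := by
  have hint : Integrable φ ρ := Integrable_of_abs_le hφ.aestronglyMeasurable hc
  have hc2 : ∀ᵐ x ∂ρ, |φ x ^ 2| ≤ c ^ 2 := by
    filter_upwards [hc] with x hx
    rw [abs_of_nonneg (sq_nonneg _), ← sq_abs]
    exact pow_le_pow_left₀ (abs_nonneg _) hx 2
  have hint2 : Integrable (fun x => φ x ^ 2) ρ :=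
    Integrable_of_abs_le (hφ.pow_const 2).aestronglyMeasurable hc2
  set v := ∫ x, φ x ^ 2 ∂ρ with hv
  have hv0 : 0 ≤ v := integral_nonneg fun x => sq_nonneg _
  have hvc : v ≤ c ^ 2 := by
    have := integral_mono_ae hint2 (integrable_const (c ^ 2))
      (hc2.mono fun x hx => (le_abs_self _).trans hx)
    simpa using this
  have hmain : ∫ x, ((1 : ℂ) + (a * φ x : ℝ) * Complex.I - ((a * φ x : ℝ) : ℂ) ^ 2 / 2) ∂ρ
      = 1 - ((a ^ 2 * v / 2 : ℝ) : ℂ) := by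
    have e : ∀ x, ((1 : ℂ) + (a * φ x : ℝ) * Complex.I - ((a * φ x : ℝ) : ℂ) ^ 2 / 2)
        = 1 + (φ x : ℂ) * (a * Complex.I) - ((φ x ^ 2 : ℝ) : ℂ) * (a ^ 2 / 2) := by
      intro x; push_cast; ring
    simp_rw [e]
    rw [integral_sub, integral_add, integral_mul_const, integral_mul_const,
      integral_complex_ofReal, integral_complex_ofReal, h0, ← hv]
    · simp; ring
    · exact integrable_const _
    · exact (hint.ofReal (𝕜 := ℂ)).mul_const _
    · exact (integrable_const _).add ((hint.ofReal (𝕜 := ℂ)).mul_const _)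
    · exact (hint2.ofReal (𝕜 := ℂ)).mul_const _
  have hexpm : Measurable fun x => Complex.exp ((a * φ x : ℝ) * Complex.I) := by fun_prop
  have hexpi : Integrable (fun x => Complex.exp ((a * φ x : ℝ) * Complex.I)) ρ :=
    Integrable.of_bound hexpm.aestronglyMeasurable 1
      (ae_of_all _ fun x => (Complex.norm_exp_ofReal_mul_I _).le)
  have hpoly : Integrable
      (fun x => (1 : ℂ) + (a * φ x : ℝ) * Complex.I - ((a * φ x : ℝ) : ℂ) ^ 2 / 2) ρ := by
    refine Integrable.sub ((integrable_const _).add ?_) ?_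
    · exact ((hint.const_mul a).ofReal (𝕜 := ℂ)).mul_const _
    · have := ((hint2.const_mul (a ^ 2 / 2)).ofReal (𝕜 := ℂ))
      refine this.congr (ae_of_all _ fun x => ?_)
      simp only [RCLike.ofReal_mul]; push_cast; simp; ring
  have h1 : ‖(∫ x, Complex.exp ((a * φ x : ℝ) * Complex.I) ∂ρ) - (1 - ((a ^ 2 * v / 2 : ℝ) : ℂ))‖
      ≤ |a * c| ^ 3 * Real.exp |a * c| := by
    rw [← hmain, ← integral_sub hexpi hpoly]
    refine (norm_integral_le_of_norm_le_const (C := |a * c| ^ 3 * Real.exp |a * c|) ?_).trans ?_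
    · filter_upwards [hc] with x hx
      refine (norm_exp_I_sub_le _).trans ?_
      have : |a * φ x| ≤ |a * c| := by
        rw [abs_mul, abs_mul]
        exact mul_le_mul_of_nonneg_left (hx.trans (le_abs_self _)) (abs_nonneg _)
      gcongr
    · simp
  have h2 := norm_exp_neg_sub_le (a ^ 2 * v / 2)
  have h3 : |a ^ 2 * v / 2| ≤ (a * c) ^ 2 := by
    rw [abs_of_nonneg (by positivity), mul_pow]
    nlinarith [mul_le_mul_of_nonneg_left hvc (sq_nonneg a), sq_nonneg a, sq_nonneg (a*c),
      mul_nonneg (sq_nonneg a) hv0]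
  have h4 : |a ^ 2 * v / 2| ^ 2 * Real.exp |a ^ 2 * v / 2| ≤ (a * c) ^ 4 * Real.exp ((a * c) ^ 2) := by
    calc _ ≤ ((a * c) ^ 2) ^ 2 * Real.exp ((a * c) ^ 2) := by gcongr
      _ = _ := by ring
  have h5 := norm_sub_le_norm_sub_add_norm_sub (∫ x, Complex.exp ((a * φ x : ℝ) * Complex.I) ∂ρ)
    (1 - ((a ^ 2 * v / 2 : ℝ) : ℂ)) (Complex.exp (-(a ^ 2 * v / 2 : ℝ)))
  rw [norm_sub_rev (1 - ((a ^ 2 * v / 2 : ℝ) : ℂ))] at h5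
  have : ((-(a ^ 2 * v / 2) : ℝ) : ℂ) = -((a ^ 2 * v / 2 : ℝ) : ℂ) := by push_cast; ring
  push_cast at *
  linarith

/-- A quantitative central limit theorem for i.i.d. bounded centred variables: the characteristic
function of the normalized sum is within `O(1/√N)` of the Gaussian one. -/
lemma norm_charFun_pi_sub_exp_le {N : ℕ} (hN : 0 < N) (ρ : Measure E) [IsProbabilityMeasure ρ]
    {φ : E → ℝ} (hφ : Measurable φ) {c : ℝ} (hc : ∀ᵐ x ∂ρ, |φ x| ≤ c) (h0 : ∫ x, φ x ∂ρ = 0)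
    (u : ℝ) :
    ‖(∫ z, Complex.exp ((u * ((√N)⁻¹ * ∑ i, φ (z i)) : ℝ) * Complex.I)
        ∂(Measure.pi fun _ : Fin N => ρ))
      - Complex.exp (-(u ^ 2 * (∫ x, φ x ^ 2 ∂ρ) / 2 : ℝ))‖ ≤ iidConst |u * c| / √N := by
  set a : ℝ := u * (√N)⁻¹ with ha
  have hsN : 1 ≤ √(N : ℝ) := by
    rw [Real.one_le_sqrt]; exact_mod_cast hN
  have hsN0 : 0 < √(N : ℝ) := by linarith
  have hNs : (N : ℝ) = √N * √N := (Real.mul_self_sqrt (by positivity)).symm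
  have e1 : ∀ z : Fin N → E, Complex.exp ((u * ((√N)⁻¹ * ∑ i, φ (z i)) : ℝ) * Complex.I)
      = ∏ i, Complex.exp ((a * φ (z i) : ℝ) * Complex.I) := by
    intro z
    rw [← Complex.exp_sum, ← Finset.sum_mul]
    congr 2
    rw [← mul_assoc, Finset.mul_sum]
    rw [ha]
    push_cast
    rfl
  simp_rw [e1]
  rw [integral_fintype_prod_eq_prod (𝕜 := ℂ)
    (f := fun (_ : Fin N) x => Complex.exp ((a * φ x : ℝ) * Complex.I))]
  rw [Finset.prod_const, Finset.card_univ, Fintype.card_fin]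
  have e2 : Complex.exp (-(u ^ 2 * (∫ x, φ x ^ 2 ∂ρ) / 2 : ℝ))
      = Complex.exp (-(a ^ 2 * (∫ x, φ x ^ 2 ∂ρ) / 2 : ℝ)) ^ N := by
    rw [← Complex.exp_nat_mul]
    congr 1
    have : (u ^ 2 * (∫ x, φ x ^ 2 ∂ρ) / 2 : ℝ) = N * (a ^ 2 * (∫ x, φ x ^ 2 ∂ρ) / 2) := by
      rw [ha, mul_pow, inv_pow, Real.sq_sqrt (by positivity)]
      field_simp
    rw [this]; push_cast; ring
  rw [e2]
  -- Both bases lie in the closed unit disc, so passing to `N`-th powers costs a factor `N`. With `a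
  -- = u / √N` the cubic error becomes `N · N^{-3/2}`; the quartic one is of order `1/N` and is
  -- weakened to `1/√N`.
  refine (norm_pow_sub_pow_le_of_norm_le_one ?_ ?_ N).trans ?_
  · refine (norm_integral_le_of_norm_le_const (C := 1) (ae_of_all _ fun x => ?_)).trans (by simp)
    exact (Complex.norm_exp_ofReal_mul_I _).le
  · rw [← Complex.ofReal_neg, Complex.norm_exp_ofReal, Real.exp_le_one_iff]
    have : 0 ≤ ∫ x, φ x ^ 2 ∂ρ := integral_nonneg fun x => sq_nonneg _
    have := mul_nonneg (sq_nonneg a) this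
    linarith
  refine (mul_le_mul_of_nonneg_left (norm_charFun_sub_exp_le ρ hφ hc h0 a)
    (Nat.cast_nonneg N)).trans ?_
  have hac : a * c = (u * c) / √N := by rw [ha]; field_simp
  have habs : |a * c| = |u * c| / √N := by rw [hac, abs_div, abs_of_pos hsN0]
  have hsq : (a * c) ^ 2 = |a * c| ^ 2 := (sq_abs _).symm
  have h4 : (a * c) ^ 4 = |a * c| ^ 4 := by
    rw [show (4 : ℕ) = 2 * 2 from rfl, pow_mul, pow_mul, hsq]
  rw [hsq, h4, habs]
  set x := |u * c| with hx
  have hx0 : 0 ≤ x := abs_nonneg _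
  have hle : x / √N ≤ x := div_le_self hx0 hsN
  have hx0' : 0 ≤ x / √N := by positivity
  have hx4 : x ^ 4 / (N : ℝ) ≤ x ^ 4 / √N := by
    gcongr
    nlinarith
  calc (N : ℝ) * ((x / √N) ^ 3 * Real.exp (x / √N) + (x / √N) ^ 4 * Real.exp ((x / √N) ^ 2))
      = x ^ 3 / √N * Real.exp (x / √N) + x ^ 4 / N * Real.exp ((x / √N) ^ 2) := by
        have : √(N : ℝ) ≠ 0 := hsN0.ne'
        rw [div_pow, div_pow]
        have h2 : √(N : ℝ) ^ 3 = N * √N := by rw [pow_succ, Real.sq_sqrt (by positivity)]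
        have h3 : √(N : ℝ) ^ 4 = N * N := by
          rw [show (4 : ℕ) = 2 * 2 from rfl, pow_mul, Real.sq_sqrt (by positivity), sq]
        have hN' : (N : ℝ) ≠ 0 := by positivity
        rw [h2, h3]
        field_simp
    _ ≤ x ^ 3 / √N * Real.exp x + x ^ 4 / √N * Real.exp (x ^ 2) := by gcongr
    _ = iidConst x / √N := by rw [iidConst]; ring

/-- The mean absolute deviation of an average of i.i.d. bounded variables. -/
lemma integral_abs_average_sub_le {N : ℕ} (hN : 0 < N) (ρ : Measure E) [IsProbabilityMeasure ρ]
    {φ : E → ℝ} (hφ : Measurable φ) {c : ℝ} (hc0 : 0 ≤ c) (hc : ∀ᵐ x ∂ρ, |φ x| ≤ c) :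
    ∫ z, |(N : ℝ)⁻¹ * ∑ i, φ (z i) - ∫ x, φ x ∂ρ| ∂(Measure.pi fun _ : Fin N => ρ)
      ≤ c / √N := by
  set π := Measure.pi fun _ : Fin N => ρ
  have hN' : (0 : ℝ) < N := by exact_mod_cast hN
  have hsN0 : 0 < √(N : ℝ) := by positivity
  have hmem : MemLp φ 2 ρ := MemLp.of_bound hφ.aestronglyMeasurable c hc
  have hmemi : ∀ i : Fin N, MemLp (fun z : Fin N → E => φ (z i)) 2 π := fun i =>
    hmem.comp_measurePreserving (measurePreserving_eval (fun _ : Fin N => ρ) i)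
  set S : (Fin N → E) → ℝ := ∑ i, fun z => φ (z i) with hS
  have hSmem : MemLp S 2 π := memLp_finsetSum' _ fun i _ => hmemi i
  have hmean : ∫ z, S z ∂π = N * ∫ x, φ x ∂ρ := by
    simp only [hS, Finset.sum_apply]
    rw [integral_finsetSum _ fun i _ => (hmemi i).integrable (by norm_num)]
    have : ∀ i : Fin N, ∫ z, φ (z i) ∂π = ∫ x, φ x ∂ρ := fun i => by
      rw [← (measurePreserving_eval (fun _ : Fin N => ρ) i).map_eq,
        integral_map (measurable_pi_apply i).aemeasurable hφ.aestronglyMeasurable]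
    simp [this]
  have hvar : Var[S; π] ≤ N * c ^ 2 := by
    rw [hS, variance_sum_pi (X := fun _ => φ) fun _ => hmem]
    have : Var[φ; ρ] ≤ c ^ 2 := by
      refine (variance_le_expectation_sq hφ.aestronglyMeasurable).trans ?_
      have : ∫ x, (φ ^ 2) x ∂ρ ≤ ∫ _, c ^ 2 ∂ρ := by
        refine integral_mono_ae hmem.integrable_sq (integrable_const _) ?_
        filter_upwards [hc] with x hx
        rw [Pi.pow_apply, ← sq_abs]
        exact pow_le_pow_left₀ (abs_nonneg _) hx 2
      simpa using this
    simp only [Finset.sum_const, Finset.card_univ, Fintype.card_fin, nsmul_eq_mul]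
    gcongr
  set Y : (Fin N → E) → ℝ := fun z => (N : ℝ)⁻¹ * ∑ i, φ (z i) - ∫ x, φ x ∂ρ with hY
  have hYS : ∀ z, Y z = (N : ℝ)⁻¹ * (S z - ∫ z, S z ∂π) := by
    intro z; rw [hmean, hY, hS]; simp only [Finset.sum_apply]; field_simp
  have hYmem : MemLp Y 2 π := by
    have : Y = fun z => (N : ℝ)⁻¹ * (S z - ∫ z, S z ∂π) := funext hYS
    rw [this]
    exact (hSmem.sub (memLp_const _)).const_mul _
  have hYsq : ∫ z, Y z ^ 2 ∂π ≤ (c / √N) ^ 2 := by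
    have : ∀ z, Y z ^ 2 = ((N : ℝ)⁻¹) ^ 2 * (S z - ∫ z, S z ∂π) ^ 2 := fun z => by
      rw [hYS, mul_pow]
    simp_rw [this]
    rw [integral_const_mul, ← variance_eq_integral hSmem.aestronglyMeasurable.aemeasurable, div_pow,
      Real.sq_sqrt hN'.le]
    calc ((N : ℝ)⁻¹) ^ 2 * Var[S; π] ≤ ((N : ℝ)⁻¹) ^ 2 * (N * c ^ 2) := by gcongr
      _ = c ^ 2 / N := by field_simp
  -- Nonnegativity of the variance of `|Y|` is the inequality `(E|Y|)² ≤ E Y²`.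
  have hv := variance_nonneg (fun z => |Y z|) π
  have habs : MemLp (fun z => |Y z|) 2 π := hYmem.abs
  rw [variance_eq_sub habs] at hv
  have : (∫ z, |Y z| ∂π) ^ 2 ≤ (c / √N) ^ 2 := by
    refine le_trans ?_ hYsq
    simpa using hv
  exact abs_le_of_sq_le_sq' this (by positivity) |>.2

end GaussianApproximation

/-! ### Conditional laws as kernels, measurability in the parameter, and Slutsky's theorem. -/

section ConditionalLaws

/-- The law of `n` independent draws depends measurably on the common law. -/
lemma measurable_pi_const {D E : Type*} [MeasurableSpace D] [MeasurableSpace E] {n : ℕ}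
    {ρ : D → Measure E} [∀ d, IsFiniteMeasure (ρ d)] (hρ : Measurable ρ) :
    Measurable fun d => Measure.pi fun _ : Fin n => ρ d := by
  refine Measurable.measure_of_isPiSystem generateFrom_pi.symm isPiSystem_pi ?_ ?_
  · rintro _ ⟨s, hs, rfl⟩
    simp_rw [Measure.pi_pi]
    exact Finset.measurable_prod _ fun i _ =>
      (Measure.measurable_coe (hs i (Set.mem_univ i))).comp hρ
  · simp_rw [Measure.pi_univ]
    exact Finset.measurable_prod _ fun i _ => (Measure.measurable_coe MeasurableSet.univ).comp hρ

section MeasureValued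

variable {D Y : Type*} [MeasurableSpace D] [MeasurableSpace Y] {κ : D → Measure Y}
  [∀ d, IsFiniteMeasure (κ d)]

/-- The normalization of a measurable family of finite measures. -/
def normalizedKernel (hκ : Measurable κ) : Kernel D Y :=
  ⟨fun d => (κ d Set.univ)⁻¹ • κ d, by
    refine Measure.measurable_of_measurable_coe _ fun s hs => ?_
    simp only [Measure.smul_apply, smul_eq_mul]
    exact ((Measure.measurable_coe MeasurableSet.univ).comp hκ).inv.mul
      ((Measure.measurable_coe hs).comp hκ)⟩

instance (hκ : Measurable κ) : IsFiniteKernel (normalizedKernel hκ) :=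
  ⟨⟨1, ENNReal.one_lt_top, fun d => by
    simp only [normalizedKernel, Kernel.coe_mk, Measure.smul_apply, smul_eq_mul]
    exact ENNReal.inv_mul_le_one _⟩⟩

/-- The masses of `κ d` need not be bounded in `d`. Splitting them off leaves a finite kernel, to
which the measurability theorems for kernel integrals apply. -/
lemma smul_normalizedKernel (hκ : Measurable κ) (d : D) :
    κ d Set.univ • normalizedKernel hκ d = κ d := by
  simp only [normalizedKernel, Kernel.coe_mk, smul_smul]
  rcases eq_or_ne (κ d Set.univ) 0 with h | h
  · rw [Measure.measure_univ_eq_zero.1 h]; simp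
  · rw [ENNReal.mul_inv_cancel h (measure_ne_top _ _), one_smul]

lemma measurable_lintegral_of_measurable (hκ : Measurable κ) {F : D × Y → ℝ≥0∞}
    (hF : Measurable F) : Measurable fun d => ∫⁻ y, F (d, y) ∂(κ d) := by
  have e : ∀ d, ∫⁻ y, F (d, y) ∂(κ d) =
      κ d Set.univ * ∫⁻ y, F (d, y) ∂(normalizedKernel hκ d) := fun d => by
    conv_lhs => rw [← smul_normalizedKernel hκ d]
    rw [lintegral_smul_measure, smul_eq_mul]
  simp_rw [e]
  exact ((Measure.measurable_coe MeasurableSet.univ).comp hκ).mul hF.lintegral_kernel_prod_right'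

lemma measurable_integral_of_measurable (hκ : Measurable κ) {F : D × Y → ℝ}
    (hF : Measurable F) : Measurable fun d => ∫ y, F (d, y) ∂(κ d) := by
  have e : ∀ d, ∫ y, F (d, y) ∂(κ d) =
      (κ d Set.univ).toReal * ∫ y, F (d, y) ∂(normalizedKernel hκ d) := fun d => by
    conv_lhs => rw [← smul_normalizedKernel hκ d]
    rw [integral_smul_measure, smul_eq_mul]
  simp_rw [e]
  exact ((Measure.measurable_coe MeasurableSet.univ).comp hκ).ennreal_toReal.mul
    (hF.stronglyMeasurable.integral_kernel_prod_right' (κ := normalizedKernel hκ)).measurable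

end MeasureValued

section Disintegration

variable {Ω D E : Type*} [MeasurableSpace Ω] [MeasurableSpace D] [MeasurableSpace E]
  {P : Measure Ω} [IsFiniteMeasure P] {H : Ω → D} {Z : Ω → E} {κ : Kernel D E} [IsFiniteKernel κ]
  {G : Set D}

/-- `κ` is the conditional law of `Z` given `H`, on the event `H ∈ G`. -/
def IsCondLawOn (P : Measure Ω) (H : Ω → D) (Z : Ω → E) (κ : Kernel D E) (G : Set D) : Prop :=
  (P.restrict (H ⁻¹' G)).map (fun ω => (H ω, Z ω)) = ((P.restrict (H ⁻¹' G)).map H) ⊗ₘ κ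

/-- Finite measures on a product are determined by their values on rectangles, and the hypothesis is
exactly the comparison on the rectangle `B × S`. -/
lemma IsCondLawOn.of_forall (hH : Measurable H) (hZ : Measurable Z)
    (h : ∀ B, MeasurableSet B → ∀ S, MeasurableSet S →
      P (H ⁻¹' B ∩ H ⁻¹' G ∩ Z ⁻¹' S) = ∫⁻ ω in H ⁻¹' B ∩ H ⁻¹' G, κ (H ω) S ∂P) :
    IsCondLawOn P H Z κ G := by
  refine Measure.ext_prod fun {s t} hs ht => ?_
  rw [Measure.map_apply (hH.prodMk hZ) (hs.prod ht), Measure.compProd_apply_prod hs ht,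
    Measure.restrict_apply ((hH.prodMk hZ) (hs.prod ht)),
    setLIntegral_map hs (κ.measurable_coe ht) hH, Measure.restrict_restrict (hH hs), ← h s hs t ht]
  congr 1
  ext ω
  simp only [Set.mem_inter_iff, Set.mem_preimage, Set.mem_prod]
  tauto

lemma IsCondLawOn.lintegral (h : IsCondLawOn P H Z κ G) (hH : Measurable H) (hZ : Measurable Z)
    {F : D × E → ℝ≥0∞} (hF : Measurable F) :
    ∫⁻ ω in H ⁻¹' G, F (H ω, Z ω) ∂P = ∫⁻ ω in H ⁻¹' G, ∫⁻ z, F (H ω, z) ∂κ (H ω) ∂P := by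
  rw [← lintegral_map (μ := P.restrict (H ⁻¹' G)) (f := F) (g := fun ω => (H ω, Z ω)) hF
    (hH.prodMk hZ), h, Measure.lintegral_compProd hF, lintegral_map _ hH]
  exact hF.lintegral_kernel_prod_right'

lemma IsCondLawOn.integral (h : IsCondLawOn P H Z κ G) (hH : Measurable H) (hZ : Measurable Z)
    {F : D × E → ℂ} (hF : Measurable F) {C : ℝ} (hC : ∀ x, ‖F x‖ ≤ C) :
    ∫ ω in H ⁻¹' G, F (H ω, Z ω) ∂P = ∫ ω in H ⁻¹' G, ∫ z, F (H ω, z) ∂κ (H ω) ∂P := by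
  rw [← integral_map (μ := P.restrict (H ⁻¹' G)) (f := F) (φ := fun ω => (H ω, Z ω))
    (hH.prodMk hZ).aemeasurable hF.aestronglyMeasurable, h, Measure.integral_compProd,
    integral_map hH.aemeasurable]
  · exact (hF.stronglyMeasurable.integral_kernel_prod_right' (κ := κ)).aestronglyMeasurable
  · exact Integrable.of_bound hF.aestronglyMeasurable C (ae_of_all _ hC)

end Disintegration

/-- Convergence of characteristic functions to a Gaussian one gives convergence in distribution. -/
lemma tendstoInDistribution_gaussian {Ω : Type*} [MeasurableSpace Ω] {P : Measure Ω}
    [IsProbabilityMeasure P] {X : ℕ → Ω → ℝ} (hX : ∀ n, AEMeasurable (X n) P) {v : ℝ} (hv : 0 ≤ v)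
    (h : ∀ u : ℝ, Tendsto (fun n => ∫ ω, Complex.exp ((u * X n ω : ℝ) * Complex.I) ∂P) atTop
      (𝓝 (Complex.exp (-(u ^ 2 * v / 2 : ℝ))))) :
    TendstoInDistribution X atTop id (fun _ => P) (gaussianReal 0 v.toNNReal) where
  forall_aemeasurable := hX
  tendsto := by
    refine ProbabilityMeasure.tendsto_iff_tendsto_charFun.2 fun t => ?_
    simp only [ProbabilityMeasure.coe_mk, Measure.map_id]
    rw [charFun_gaussianReal]
    convert h t using 2 with n
    · rw [charFun_apply_real, integral_map (hX n) (by fun_prop)]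
      simp
    · congr 1
      simp only [Real.coe_toNNReal v hv]
      push_cast
      ring

/-- Multiplying by a sequence converging in probability to a nonzero constant, and modifying on
events of vanishing probability, Slutsky's theorem for quotients. -/
lemma TendstoInDistribution.gaussian_of_mul {Ω : Type*} [MeasurableSpace Ω] {P : Measure Ω}
    [IsProbabilityMeasure P] {X W Y : ℕ → Ω → ℝ} {v c : ℝ} (hv : 0 ≤ v) (hc : 0 < c)
    (hX : TendstoInDistribution X atTop id (fun _ => P) (gaussianReal 0 v.toNNReal))
    (hY : TendstoInMeasure P Y atTop (fun _ => c)) (hYm : ∀ n, AEMeasurable (Y n) P)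
    (hW : ∀ n, AEMeasurable (W n) P)
    (hWX : Tendsto (fun n => P {ω | Y n ω * W n ω ≠ X n ω}) atTop (𝓝 0)) :
    TendstoInDistribution W atTop id (fun _ => P) (gaussianReal 0 (v / c ^ 2).toNNReal) := by
  have hXm := hX.forall_aemeasurable
  have hYinv : TendstoInMeasure P (fun n ω => (Y n ω)⁻¹) atTop (fun _ => c⁻¹) := by
    rw [tendstoInMeasure_iff_dist] at hY ⊢
    intro ε hε
    obtain ⟨δ, hδ, h⟩ := Metric.continuousAt_iff.1 (continuousAt_inv₀ hc.ne') ε hε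
    refine tendsto_of_tendsto_of_tendsto_of_le_of_le tendsto_const_nhds (hY δ hδ)
      (fun _ => zero_le) fun n => measure_mono fun ω hω => ?_
    simp only [Set.mem_ofPred_eq] at hω ⊢
    by_contra! hlt
    exact absurd (h hlt) (not_lt.2 hω)
  have h1 := hX.continuous_comp_prodMk_of_tendstoInMeasure_const
    (g := fun p : ℝ × ℝ => p.1 * p.2) (by fun_prop) hYinv (fun n => (hYm n).inv)
  have h2 : TendstoInDistribution (fun n ω => X n ω * (Y n ω)⁻¹) atTop id (fun _ => P)
      (gaussianReal 0 (v / c ^ 2).toNNReal) := by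
    refine ⟨h1.forall_aemeasurable, by fun_prop, ?_⟩
    convert! h1.tendsto using 2
    refine congrArg _ (Subtype.ext ?_)
    simp only [Measure.map_id, id]
    rw [show (fun ω : ℝ => ω * c⁻¹) = (· * c⁻¹) from rfl, gaussianReal_map_mul_const]
    congr 1
    · simp
    · ext
      simp [Real.coe_toNNReal v hv,
        div_eq_inv_mul]
      positivity
  refine tendstoInDistribution_of_tendstoInMeasure_sub W id h2 ?_ hW
  rw [tendstoInMeasure_iff_norm]
  intro ε hε
  -- Where `|Y - c| < c` the factor `Y` is nonzero, so `Y W = X` forces `W = X / Y`. Outside this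
  -- event and outside `{Y W ≠ X}` nothing changes, and both exceptional probabilities vanish in the
  -- limit.
  have hY0 : Tendsto (fun n => P {ω | c ≤ dist (Y n ω) c}) atTop (𝓝 0) := by
    rw [tendstoInMeasure_iff_dist] at hY
    exact hY c hc
  have hsum := hWX.add hY0
  rw [add_zero] at hsum
  refine tendsto_of_tendsto_of_tendsto_of_le_of_le tendsto_const_nhds hsum
    (fun _ => zero_le) fun n => (measure_mono fun ω hω => ?_).trans (measure_union_le _ _)
  simp only [Set.mem_ofPred_eq, Set.mem_union] at hω ⊢
  by_contra! hcon
  have hne : Y n ω ≠ 0 := by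
    intro h0
    have := hcon.2
    rw [h0, Real.dist_eq, zero_sub, abs_neg, abs_of_pos hc] at this
    exact lt_irrefl _ this
  have : W n ω = X n ω * (Y n ω)⁻¹ := by rw [← hcon.1]; field_simp
  simp [this] at hω
  linarith

/-- The ratio map `(a, b, c) ↦ b (c / a) ^ 2` is Lipschitz on the cone `|c| ≤ K a`, `0 ≤ b ≤ C a`. -/
lemma abs_mul_sq_sub_le {a a' b b' c c' G G' K C : ℝ} (hb' : 0 ≤ b') (hK : 0 ≤ K) (hC : 0 ≤ C)
    (hG : |G| ≤ K) (hG' : |G'| ≤ K) (hba : b' ≤ C * a') (hc : a * G = c) (hc' : a' * G' = c')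
    (ha' : 0 ≤ a') :
    |b' * G' ^ 2 - b * G ^ 2| ≤
      K ^ 2 * |b' - b| + 2 * K ^ 2 * C * |a' - a| + 2 * K * C * |c' - c| := by
  have e : b' * G' ^ 2 - b * G ^ 2 = (b' - b) * G ^ 2 + b' * (G' - G) * (G' + G) := by ring
  have h1 : |(b' - b) * G ^ 2| ≤ K ^ 2 * |b' - b| := by
    rw [abs_mul, mul_comm, abs_of_nonneg (sq_nonneg G), ← sq_abs]
    gcongr
  have h2 : |G' + G| ≤ 2 * K := (abs_add_le _ _).trans (by linarith)
  -- Only the product `a' (G' - G)` is estimated, never `G' - G` itself: the bound `b' ≤ C a'`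
  -- supplies the factor `a'`, so small denominators do no harm.
  have h3 : a' * |G' - G| ≤ |c' - c| + |a' - a| * K := by
    rw [← abs_of_nonneg ha', ← abs_mul, abs_of_nonneg ha']
    have : a' * (G' - G) = (c' - c) - (a' - a) * G := by rw [← hc, ← hc']; ring
    rw [this]
    refine (abs_sub _ _).trans ?_
    rw [abs_mul]; gcongr
  have h4 : |b' * (G' - G) * (G' + G)| ≤ C * (|c' - c| + |a' - a| * K) * (2 * K) := by
    rw [abs_mul, abs_mul, abs_of_nonneg hb']
    have : b' * |G' - G| ≤ C * (|c' - c| + |a' - a| * K) := by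
      calc b' * |G' - G| ≤ (C * a') * |G' - G| := by gcongr
        _ = C * (a' * |G' - G|) := by ring
        _ ≤ _ := by gcongr
    gcongr
  rw [e]
  refine (abs_add_le _ _).trans ?_
  linarith

end ConditionalLaws

/-! ### Unnormalized smoothing measures on path space and their adjoint kernels. -/

section PathMeasures

variable {X : Type*} [MeasurableSpace X]

/-- Overwrite the entry at time `t + 1` of a path. -/
def extend (t : ℕ) (p : (ℕ → X) × X) : ℕ → X := Function.update p.1 (t + 1) p.2

@[fun_prop]
lemma measurable_extend (t : ℕ) : Measurable (extend (X := X) t) := by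
  refine measurable_pi_iff.2 fun u => ?_
  by_cases h : u = t + 1
  · subst h; simpa [extend] using measurable_snd
  · have : Measurable fun p : (ℕ → X) × X => p.1 u := by fun_prop
    simpa [extend, h] using this

omit [MeasurableSpace X] in
@[simp] lemma extend_self (t : ℕ) (p : (ℕ → X) × X) : extend t p (t + 1) = p.2 := by simp [extend]

omit [MeasurableSpace X] in
lemma extend_of_le {t u : ℕ} (h : u ≤ t) (p : (ℕ → X) × X) : extend t p u = p.1 u := by
  simp [extend, show u ≠ t + 1 by omega]

namespace StateSpaceModel

variable (M : StateSpaceModel X)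

instance : SigmaFinite M.ν := M.sigmaFinite_ν
instance : IsProbabilityMeasure M.χ := M.isProbabilityMeasure_χ

lemma measurable_q_comp {α : Type*} [MeasurableSpace α] {a b : α → X} (ha : Measurable a)
    (hb : Measurable b) : Measurable fun z => M.q (a z) (b z) :=
  M.measurable_q.comp (ha.prodMk hb)

/-- The unnormalized transition density `q(x_t, x') g_{t+1}(x')`. -/
def potential (t : ℕ) (p : (ℕ → X) × X) : ℝ≥0 := M.q (p.1 t) p.2 * M.g (t + 1) p.2

@[fun_prop]
lemma measurable_potential (t : ℕ) : Measurable (M.potential t) := by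
  have h1 : Measurable fun p : (ℕ → X) × X => M.q (p.1 t) p.2 :=
    M.measurable_q_comp (by fun_prop) measurable_snd
  exact h1.mul ((M.measurable_g (t + 1)).comp measurable_snd)

/-- One unnormalized smoothing step applied to a measure on paths. -/
def step (t : ℕ) (μ : Measure (ℕ → X)) : Measure (ℕ → X) :=
  ((μ.prod M.ν).withDensity fun p => (M.potential t p : ℝ≥0∞)).map (extend t)

/-- The unnormalized joint smoothing measures. -/
def pathMeasure : ℕ → Measure (ℕ → X)
  | 0 => (M.χ.withDensity fun x => (M.g 0 x : ℝ≥0∞)).map fun x _ => x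
  | t + 1 => M.step t (pathMeasure t)

lemma measurable_q_apply (x : X) : Measurable (M.q x) :=
  M.measurable_q.comp measurable_prodMk_left

lemma lintegral_step (t : ℕ) (μ : Measure (ℕ → X)) {f : (ℕ → X) → ℝ≥0∞}
    (hf : Measurable f) :
    ∫⁻ y, f y ∂(M.step t μ) =
      ∫⁻ y, ∫⁻ x, (M.potential t (y, x) : ℝ≥0∞) * f (extend t (y, x)) ∂M.ν ∂μ := by
  have hm : Measurable fun p : (ℕ → X) × X => (M.potential t p : ℝ≥0∞) := by fun_prop
  rw [step, lintegral_map hf (measurable_extend t),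
    lintegral_withDensity_eq_lintegral_mul (g := fun p => f (extend t p)) _ hm
      (hf.comp (measurable_extend t)), lintegral_prod]
  · rfl
  · exact (hm.mul (hf.comp (measurable_extend t))).aemeasurable

lemma integrable_step_iff (t : ℕ) (μ : Measure (ℕ → X)) {f : (ℕ → X) → ℝ} (hf : Measurable f) :
    Integrable f (M.step t μ) ↔
      Integrable (fun p => (M.potential t p : ℝ) * f (extend t p)) (μ.prod M.ν) := by
  rw [step, integrable_map_measure hf.aestronglyMeasurable (measurable_extend t).aemeasurable,
    integrable_withDensity_iff_integrable_smul (M.measurable_potential t)]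
  rfl

lemma integral_step (t : ℕ) (μ : Measure (ℕ → X)) [SFinite μ] {f : (ℕ → X) → ℝ}
    (hf : Measurable f) (hi : Integrable f (M.step t μ)) :
    ∫ y, f y ∂(M.step t μ) =
      ∫ y, ∫ x, (M.potential t (y, x) : ℝ) * f (extend t (y, x)) ∂M.ν ∂μ := by
  have h2 := (M.integrable_step_iff t μ hf).1 hi
  rw [step, integral_map (measurable_extend t).aemeasurable hf.aestronglyMeasurable,
    integral_withDensity_eq_integral_smul (M.measurable_potential t), ← integral_prod _ h2]
  rfl

lemma lintegral_potential_le {t : ℕ} {C : ℝ≥0} (hC : ∀ x, M.g (t + 1) x ≤ C) (y : ℕ → X) :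
    ∫⁻ x, (M.potential t (y, x) : ℝ≥0∞) ∂M.ν ≤ C := by
  calc ∫⁻ x, (M.potential t (y, x) : ℝ≥0∞) ∂M.ν ≤ ∫⁻ x, (M.q (y t) x : ℝ≥0∞) * C ∂M.ν := by
        refine lintegral_mono fun x => ?_
        simp only [potential, ENNReal.coe_mul]
        gcongr
        exact hC x
    _ = C := by
        rw [lintegral_mul_const _ (M.measurable_q_apply (y t)).coe_nnreal_ennreal, M.lintegral_q,
          one_mul]

lemma step_univ_le {t : ℕ} {C : ℝ≥0} (hC : ∀ x, M.g (t + 1) x ≤ C) (μ : Measure (ℕ → X)) :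
    M.step t μ Set.univ ≤ C * μ Set.univ := by
  rw [← lintegral_one, M.lintegral_step t μ measurable_const]
  simp only [mul_one]
  refine (lintegral_mono fun y => M.lintegral_potential_le hC y).trans ?_
  simp

lemma isFiniteMeasure_step {t : ℕ} {C : ℝ≥0} (hC : ∀ x, M.g (t + 1) x ≤ C) (μ : Measure (ℕ → X))
    [IsFiniteMeasure μ] : IsFiniteMeasure (M.step t μ) :=
  ⟨(M.step_univ_le hC μ).trans_lt (ENNReal.mul_lt_top ENNReal.coe_lt_top (measure_lt_top _ _))⟩

lemma isFiniteMeasure_pathMeasure {T : ℕ} {C : ℝ≥0} (hC : ∀ t ≤ T, ∀ x, M.g t x ≤ C) {t : ℕ}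
    (ht : t ≤ T) : IsFiniteMeasure (M.pathMeasure t) := by
  induction t with
  | zero =>
    have : IsFiniteMeasure (M.χ.withDensity fun x => (M.g 0 x : ℝ≥0∞)) := by
      refine isFiniteMeasure_withDensity (ne_of_lt ?_)
      calc ∫⁻ x, (M.g 0 x : ℝ≥0∞) ∂M.χ ≤ ∫⁻ _, C ∂M.χ := by
            refine lintegral_mono fun x => ?_
            exact ENNReal.coe_le_coe.2 (hC 0 ht x)
        _ < ⊤ := by simp
    rw [pathMeasure]
    infer_instance
  | succ t ih =>
    have := ih (by omega)
    exact M.isFiniteMeasure_step (hC (t + 1) ht) _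

lemma Laux_succ (m t : ℕ) (y : ℕ → X) (f : (ℕ → X) → ℝ) :
    M.Laux (m + 1) t y f =
      ∫ x, (M.potential t (y, x) : ℝ) * M.Laux m (t + 1) (extend t (y, x)) f ∂M.ν := by
  simp [Laux, potential, extend]

lemma measurable_Laux (m : ℕ) {f : (ℕ → X) → ℝ} (hf : Measurable f) (t : ℕ) :
    Measurable fun y => M.Laux m t y f := by
  induction m generalizing t with
  | zero => simpa [Laux] using hf
  | succ m ih =>
    simp_rw [Laux_succ]
    have : Measurable fun p : (ℕ → X) × X =>
        (M.potential t p : ℝ) * M.Laux m (t + 1) (extend t p) f :=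
      (M.measurable_potential t).coe_nnreal_real.mul ((ih (t + 1)).comp (measurable_extend t))
    exact (this.stronglyMeasurable.integral_prod_right' (ν := M.ν)).measurable

lemma integrable_potential {t : ℕ} {C : ℝ≥0} (hC : ∀ x, M.g (t + 1) x ≤ C) (y : ℕ → X) :
    Integrable (fun x => (M.potential t (y, x) : ℝ)) M.ν := by
  refine ⟨((M.measurable_potential t).comp
    measurable_prodMk_left).coe_nnreal_real.aestronglyMeasurable, ?_⟩
  rw [hasFiniteIntegral_iff_enorm]
  simp only [Real.enorm_eq_ofReal_abs, NNReal.abs_eq, ENNReal.ofReal_coe_nnreal]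
  exact (M.lintegral_potential_le hC y).trans_lt ENNReal.coe_lt_top

lemma integral_potential_le {t : ℕ} {C : ℝ≥0} (hC : ∀ x, M.g (t + 1) x ≤ C) (y : ℕ → X) :
    ∫ x, (M.potential t (y, x) : ℝ) ∂M.ν ≤ C := by
  rw [integral_eq_lintegral_of_nonneg_ae (ae_of_all _ fun _ => NNReal.coe_nonneg _)
    (M.integrable_potential hC y).aestronglyMeasurable]
  refine ENNReal.toReal_le_coe_of_le_coe ?_
  simpa using M.lintegral_potential_le hC y

/-- Each of the `m` integrations is against `q g dν`, which has mass at most `C` because `q` is a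
Markov density. -/
lemma abs_Laux_le {T : ℕ} {C : ℝ≥0} (hC : ∀ t ≤ T, ∀ x, M.g t x ≤ C) {f : (ℕ → X) → ℝ} {K : ℝ}
    (hK : ∀ y, |f y| ≤ K) {m t : ℕ} (ht : t + m ≤ T) (y : ℕ → X) :
    |M.Laux m t y f| ≤ C ^ m * K := by
  have hK0 : 0 ≤ K := (abs_nonneg _).trans (hK y)
  induction m generalizing t y with
  | zero => simpa [Laux] using hK y
  | succ m ih =>
    rw [Laux_succ]
    have hC' := hC (t + 1) (by omega)
    rw [← Real.norm_eq_abs]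
    refine (norm_integral_le_of_norm_le
      ((M.integrable_potential hC' y).mul_const ((C : ℝ) ^ m * K))
      (ae_of_all _ fun x => ?_)).trans ?_
    · rw [norm_mul, Real.norm_of_nonneg (NNReal.coe_nonneg _), Real.norm_eq_abs]
      gcongr
      exact ih (by omega) _
    · rw [integral_mul_const, pow_succ, mul_comm (_ ^ m) (C : ℝ), mul_assoc]
      gcongr
      exact M.integral_potential_le hC' y

/-- `Laux` is the adjoint of iterated `step`: integrating out the last `m` states of the integrand
amounts to pushing the measure forward `m` times. Integrability is inherited backwards from time `t
+ m` through Fubini, so it is proved in the same induction. -/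
lemma integrable_Laux {T : ℕ} {C : ℝ≥0} (hC : ∀ t ≤ T, ∀ x, M.g t x ≤ C) {f : (ℕ → X) → ℝ}
    (hf : Measurable f) {m t : ℕ} (ht : t + m ≤ T) (hi : Integrable f (M.pathMeasure (t + m))) :
    Integrable (fun y => M.Laux m t y f) (M.pathMeasure t) ∧
      ∫ y, M.Laux m t y f ∂(M.pathMeasure t) = ∫ y, f y ∂(M.pathMeasure (t + m)) := by
  induction m generalizing t with
  | zero => simpa [Laux] using hi
  | succ m ih =>
    have := M.isFiniteMeasure_pathMeasure hC (t := t) (by omega)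
    obtain ⟨h1, h2⟩ := ih (t := t + 1) (by omega) (by convert! hi using 2; omega)
    simp_rw [Laux_succ]
    have h3 := (M.integrable_step_iff t (M.pathMeasure t) (M.measurable_Laux m hf (t + 1))).1 h1
    refine ⟨h3.integral_prod_left, ?_⟩
    rw [← M.integral_step t _ (M.measurable_Laux m hf (t + 1)) h1]
    rw [show M.step t (M.pathMeasure t) = M.pathMeasure (t + 1) from rfl, h2]
    congr 2; omega

lemma integral_pathMeasure_zero {f : (ℕ → X) → ℝ} (hf : Measurable f) :
    ∫ y, f y ∂(M.pathMeasure 0) = ∫ x, (M.g 0 x : ℝ) * f (fun _ => x) ∂M.χ := by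
  have hc : Measurable fun (x : X) (_ : ℕ) => x := by fun_prop
  rw [pathMeasure, integral_map hc.aemeasurable hf.aestronglyMeasurable,
    integral_withDensity_eq_integral_smul (M.measurable_g 0)]
  rfl

lemma unnormalized_eq_integral {T : ℕ} {C : ℝ≥0} (hC : ∀ t ≤ T, ∀ x, M.g t x ≤ C)
    {f : (ℕ → X) → ℝ} (hf : Measurable f) (hi : Integrable f (M.pathMeasure T)) :
    M.unnormalized T f = ∫ y, f y ∂(M.pathMeasure T) := by
  have h := (M.integrable_Laux hC hf (m := T) (t := 0) (by omega) (by simpa using hi)).2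
  rw [M.integral_pathMeasure_zero (M.measurable_Laux T hf 0), zero_add] at h
  rw [← h]
  rfl

lemma integral_Laux_eq {T t r : ℕ} {C : ℝ≥0} (hC : ∀ t ≤ T, ∀ x, M.g t x ≤ C) {f : (ℕ → X) → ℝ}
    (hf : Measurable f) (htr : t ≤ r) (hr : r ≤ T) (hi : Integrable f (M.pathMeasure r)) :
    ∫ y, M.L r t y f ∂(M.pathMeasure t) = ∫ y, f y ∂(M.pathMeasure r) := by
  obtain ⟨m, rfl⟩ := Nat.exists_eq_add_of_le htr
  rw [← (M.integrable_Laux hC hf (m := m) (t := t) hr hi).2]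
  simp [L]

/-- The Markov property of the kernels `L`: they only see the part of a path on which the
integrand depends. -/
lemma Laux_congr {s m t : ℕ} {f : (ℕ → X) → ℝ}
    (hf : ∀ y y' : ℕ → X, (∀ u, s ≤ u → u ≤ t + m → y u = y' u) → f y = f y')
    {y y' : ℕ → X} (hyt : y t = y' t) (hy : ∀ u, s ≤ u → u ≤ t → y u = y' u) :
    M.Laux m t y f = M.Laux m t y' f := by
  induction m generalizing t y y' with
  | zero => exact hf _ _ hy
  | succ m ih =>
    simp_rw [Laux_succ]
    congr 1
    ext x
    rw [ih (t := t + 1) (y := extend t (y, x)) (y' := extend t (y', x))]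
    · simp [potential, hyt]
    · intro z z' h; exact hf z z' fun u h1 h2 => h u h1 (by omega)
    · simp
    · intro u h1 h2
      rcases Nat.lt_or_ge t u with h3 | h3
      · obtain rfl : u = t + 1 := by omega
        simp
      · rw [extend_of_le h3, extend_of_le h3]; exact hy u h1 h3

/-- The semigroup property. With `m = 1` it gives the martingale recursion `predict_L`; split at
time `s` it separates the marginal kernel from the functional of the remaining path in `L_eq_Lmarg`.
-/
lemma Laux_add (m m' t : ℕ) (y : ℕ → X) (f : (ℕ → X) → ℝ) :
    M.Laux (m + m') t y f = M.Laux m t y (fun z => M.Laux m' (t + m) z f) := by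
  induction m generalizing t y with
  | zero => simp [Laux]
  | succ m ih =>
    rw [show m + 1 + m' = (m + m') + 1 by omega, Laux_succ, Laux_succ]
    congr 1
    ext x
    rw [ih, show t + 1 + m = t + (m + 1) by omega]

end StateSpaceModel

end PathMeasures

/-! ### Deterministic particle systems and the backward Markov chain on them. -/

section Swarms

/-- A weighted particle system: `d t i` is the `i`-th particle at time `t` with its weight. -/
abbrev Swarm (N : ℕ) (X : Type*) := ℕ → Fin N → X × ℝ≥0

variable {X : Type*} [MeasurableSpace X] {N : ℕ}

@[fun_prop]
lemma Swarm.measurable_particle {N : ℕ} (t : ℕ) (i : Fin N) :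
    Measurable fun d : Swarm N X => (d t i).1 := by fun_prop

@[fun_prop]
lemma Swarm.measurable_weight {N : ℕ} (t : ℕ) (i : Fin N) :
    Measurable fun d : Swarm N X => (d t i).2 := by fun_prop

namespace StateSpaceModel

variable (M : StateSpaceModel X)

/-- The total backward weight `∑_ℓ ω_t^ℓ q(ξ_t^ℓ, x)`. -/
def backTotal (t : ℕ) (d : Swarm N X) (x : X) : ℝ≥0 := ∑ ℓ, (d t ℓ).2 * M.q (d t ℓ).1 x

/-- The backward transition probability from the state `x` at time `t + 1` to the index `j`, uniform
if the total backward weight vanishes. -/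
def backCoef (t : ℕ) (d : Swarm N X) (x : X) (j : Fin N) : ℝ≥0 :=
  if M.backTotal t d x = 0 then (N : ℝ≥0)⁻¹
  else (d t j).2 * M.q (d t j).1 x / M.backTotal t d x

/-- The law of the trajectory ending in the `i`-th particle at time `t` under the backward Markov
chain on the particles. -/
def back : ℕ → Swarm N X → Fin N → Measure (ℕ → X)
  | 0, d, i => Measure.dirac fun _ => (d 0 i).1
  | t + 1, d, i => ∑ j, M.backCoef t d (d (t + 1) i).1 j •
      (back t d j).map fun y => extend t (y, (d (t + 1) i).1)

/-- The law of the trajectory ending in the state `x` at time `t + 1` under the backward Markov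
chain on the particles up to time `t`. -/
def backNext (t : ℕ) (d : Swarm N X) (x : X) : Measure (ℕ → X) :=
  ∑ j, M.backCoef t d x j • (M.back t d j).map fun y => extend t (y, x)

lemma back_succ (t : ℕ) (d : Swarm N X) (i : Fin N) :
    M.back (t + 1) d i = M.backNext t d (d (t + 1) i).1 := rfl

lemma measurable_extend_right (t : ℕ) (x : X) : Measurable fun y : ℕ → X => extend t (y, x) :=
  (measurable_extend t).comp (measurable_id.prodMk measurable_const)

lemma lintegral_backNext (t : ℕ) (d : Swarm N X) (x : X) {f : (ℕ → X) → ℝ≥0∞}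
    (hf : Measurable f) :
    ∫⁻ y, f y ∂(M.backNext t d x) =
      ∑ j, (M.backCoef t d x j : ℝ≥0∞) * ∫⁻ y, f (extend t (y, x)) ∂(M.back t d j) := by
  rw [backNext, lintegral_finsetSum_measure]
  refine Finset.sum_congr rfl fun j _ => ?_
  rw [lintegral_smul_measure, lintegral_map hf (measurable_extend_right t x)]
  rfl

/-- The uniform default makes this true for every `d` and `x`, so `back` is a probability measure
without any positivity assumption. The comparison with the convention `0/0 = 0` is postponed to
`indexWeight_eq`. -/
lemma sum_backCoef (hN : N ≠ 0) (t : ℕ) (d : Swarm N X) (x : X) :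
    ∑ j, M.backCoef t d x j = 1 := by
  unfold backCoef
  split_ifs with h
  · simp [hN]
  · rw [← Finset.sum_div]
    exact div_self h

lemma sum_coe_backCoef (hN : N ≠ 0) (t : ℕ) (d : Swarm N X) (x : X) :
    ∑ j, (M.backCoef t d x j : ℝ≥0∞) = 1 := by
  exact_mod_cast M.sum_backCoef hN t d x

instance isProbabilityMeasure_back (t : ℕ) (d : Swarm N X) (i : Fin N) :
    IsProbabilityMeasure (M.back t d i) := by
  induction t generalizing i with
  | zero => rw [back]; infer_instance
  | succ t ih =>
    refine ⟨?_⟩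
    rw [back_succ, ← lintegral_one, lintegral_backNext _ _ _ _ measurable_const]
    simp only [lintegral_one, measure_univ, mul_one]
    exact M.sum_coe_backCoef i.pos.ne' t d _

lemma backNext_univ (hN : N ≠ 0) (t : ℕ) (d : Swarm N X) (x : X) :
    M.backNext t d x Set.univ = 1 := by
  rw [← lintegral_one, lintegral_backNext _ _ _ _ measurable_const]
  simp only [lintegral_one, measure_univ, mul_one]
  exact M.sum_coe_backCoef hN t d x

lemma backNext_univ_le (t : ℕ) (d : Swarm N X) (x : X) : M.backNext t d x Set.univ ≤ 1 := by
  rcases eq_or_ne N 0 with rfl | hN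
  · simp [backNext]
  · exact (M.backNext_univ hN t d x).le

instance (t : ℕ) (d : Swarm N X) (x : X) : IsFiniteMeasure (M.backNext t d x) :=
  ⟨(M.backNext_univ_le t d x).trans_lt ENNReal.one_lt_top⟩

@[fun_prop]
lemma measurable_backTotal (t : ℕ) : Measurable fun p : Swarm N X × X => M.backTotal t p.1 p.2 := by
  refine Finset.measurable_sum _ fun ℓ _ => Measurable.mul (by fun_prop) ?_
  exact M.measurable_q_comp (by fun_prop) (by fun_prop)

@[fun_prop]
lemma measurable_backCoef (t : ℕ) (j : Fin N) :
    Measurable fun p : Swarm N X × X => M.backCoef t p.1 p.2 j := by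
  refine Measurable.ite (M.measurable_backTotal t (measurableSet_singleton 0)) measurable_const
    (Measurable.div (Measurable.mul (by fun_prop) ?_) (M.measurable_backTotal t))
  exact M.measurable_q_comp (by fun_prop) (by fun_prop)

/-- Stated with the measurability of `back t` as a hypothesis because the two facts are proved
together: `back (t + 1)` is `backNext t` evaluated at a particle, and `backNext t` is built from
`back t`. -/
lemma measurable_backNext_of (t : ℕ) (h : ∀ j : Fin N, Measurable fun d => M.back t d j) :
    Measurable fun p : Swarm N X × X => M.backNext t p.1 p.2 := by
  refine Measure.measurable_of_measurable_coe _ fun s hs => ?_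
  have e : ∀ p : Swarm N X × X, M.backNext t p.1 p.2 s = ∑ j, (M.backCoef t p.1 p.2 j : ℝ≥0∞) *
      ∫⁻ y, s.indicator 1 (extend t (y, p.2)) ∂(M.back t p.1 j) := fun p => by
    rw [← lintegral_backNext _ _ _ _ (measurable_one.indicator hs), lintegral_indicator_one hs]
  simp_rw [e]
  refine Finset.measurable_sum _ fun j _ => Measurable.mul (by fun_prop) ?_
  refine measurable_lintegral_of_measurable (κ := fun p : Swarm N X × X => M.back t p.1 j)
    ((h j).comp measurable_fst)
    (F := fun q : (Swarm N X × X) × (ℕ → X) => s.indicator 1 (extend t (q.2, q.1.2))) ?_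
  exact (measurable_one.indicator hs).comp
    ((measurable_extend t).comp (measurable_snd.prodMk (measurable_snd.comp measurable_fst)))

lemma measurable_back (t : ℕ) (i : Fin N) : Measurable fun d : Swarm N X => M.back t d i := by
  induction t generalizing i with
  | zero =>
    simp only [back]
    exact Measure.measurable_dirac.comp (by fun_prop)
  | succ t ih =>
    have h2 : Measurable fun d : Swarm N X => (d, (d (t + 1) i).1) :=
      measurable_id.prodMk (Swarm.measurable_particle (t + 1) i)
    have h3 := Measurable.comp (g := fun p : Swarm N X × X => M.backNext t p.1 p.2)
      (f := fun d : Swarm N X => (d, (d (t + 1) i).1)) (M.measurable_backNext_of t ih) h2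
    have e : (fun d : Swarm N X => M.back (t + 1) d i) =
      (fun p : Swarm N X × X => M.backNext t p.1 p.2) ∘ fun d => (d, (d (t + 1) i).1) :=
      funext fun d => M.back_succ t d i
    rw [e]
    exact h3

lemma measurable_backNext (t : ℕ) :
    Measurable fun p : Swarm N X × X => M.backNext t p.1 p.2 :=
  M.measurable_backNext_of t fun j => M.measurable_back t j

lemma measurable_backNext_comp (t : ℕ) {α : Type*} [MeasurableSpace α] {a : α → Swarm N X}
    {b : α → X} (ha : Measurable a) (hb : Measurable b) :
    Measurable fun z => M.backNext t (a z) (b z) :=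
  Measurable.comp (g := fun p : Swarm N X × X => M.backNext t p.1 p.2)
    (f := fun z => (a z, b z)) (M.measurable_backNext t) (ha.prodMk hb)

lemma backCoef_congr {t : ℕ} {d d' : Swarm N X} (h : d t = d' t) (x : X) (j : Fin N) :
    M.backCoef t d x j = M.backCoef t d' x j := by
  have h1 : M.backTotal t d x = M.backTotal t d' x := by simp only [backTotal, h]
  unfold backCoef
  rw [h1, h]

lemma back_congr {t : ℕ} {d d' : Swarm N X} (h : ∀ u ≤ t, d u = d' u) (i : Fin N) :
    M.back t d i = M.back t d' i := by
  induction t generalizing i with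
  | zero => simp [back, h 0 le_rfl]
  | succ t ih =>
    have h1 : ∀ j, M.back t d j = M.back t d' j := ih fun u hu => h u (by omega)
    simp only [back, M.backCoef_congr (h t (by omega)), h1, h (t + 1) le_rfl]

lemma backNext_congr {t : ℕ} {d d' : Swarm N X} (h : ∀ u ≤ t, d u = d' u) (x : X) :
    M.backNext t d x = M.backNext t d' x := by
  simp only [backNext, M.backCoef_congr (h t le_rfl), fun j => M.back_congr h j]

/-- Allows any function of the terminal state to be replaced by a constant under `back t d i`.
Measurable singletons make the event measurable. -/
lemma ae_back [MeasurableSingletonClass X] (t : ℕ) (d : Swarm N X) (i : Fin N) :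
    ∀ᵐ y ∂(M.back t d i), y t = (d t i).1 := by
  have hm : ∀ (t : ℕ) (x : X), MeasurableSet {y : ℕ → X | y t = x} := fun t x =>
    (measurableSet_singleton x).preimage (measurable_pi_apply t)
  cases t with
  | zero =>
    rw [back, ae_dirac_iff (hm _ _)]
  | succ t =>
    have hm' := (hm (t + 1) (d (t + 1) i).1).compl
    rw [back_succ]
    change M.backNext t d _ {y | y (t + 1) = (d (t + 1) i).1}ᶜ = 0
    rw [← lintegral_indicator_one hm',
      lintegral_backNext _ _ _ _ (measurable_one.indicator hm')]
    refine Finset.sum_eq_zero fun j _ => ?_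
    simp

end StateSpaceModel

end Swarms

/-! ### The unnormalized estimator and its one-step conditional moments. -/

section Estimators

variable {X : Type*} [MeasurableSpace X] {N : ℕ}

namespace AuxiliaryProposal

variable {M : StateSpaceModel X} (A : AuxiliaryProposal M)

instance : IsProbabilityMeasure A.ρ₀ := A.isProbabilityMeasure_ρ₀

/-- The importance weight function as a function with values in `ℝ≥0`. -/
def wt (t : ℕ) (x x' : X) : ℝ≥0 := (A.w t x x').toNNReal

lemma measurable_w (t : ℕ) : Measurable fun p : X × X => A.w t p.1 p.2 := by
  have h1 : Measurable fun p : X × X => M.q p.1 p.2 := M.measurable_q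
  have h2 : Measurable fun p : X × X => A.p t p.1 p.2 := A.measurable_p t
  have h3 := M.measurable_g t
  have h4 := A.measurable_ϑ t
  unfold w
  fun_prop

lemma measurable_wt (t : ℕ) : Measurable fun p : X × X => A.wt t p.1 p.2 :=
  (A.measurable_w t).ennreal_toNNReal

lemma measurable_wt_comp (t : ℕ) {α : Type*} [MeasurableSpace α] {a b : α → X} (ha : Measurable a)
    (hb : Measurable b) : Measurable fun z => A.wt t (a z) (b z) :=
  (A.measurable_wt t).comp (ha.prodMk hb)

/-- Finiteness of the weight excludes `ϑ p = 0` with `q g > 0`, so the proposal covers the whole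
target and importance weighting loses no mass. -/
lemma wt_mul_eq {t : ℕ} {x x' : X} {C : ℝ≥0} (h : A.w t x x' ≤ C) :
    A.ϑ t x * A.p t x x' * A.wt t x x' = M.q x x' * M.g t x' := by
  have hne : A.w t x x' ≠ ⊤ := ne_top_of_le_ne_top ENNReal.coe_ne_top h
  have : (((A.ϑ t x * A.p t x x' : ℝ≥0) : ℝ≥0∞)) * A.w t x x' = ((M.q x x' * M.g t x' : ℝ≥0) : ℝ≥0∞) := by
    by_cases h0 : A.ϑ t x * A.p t x x' = 0
    · rw [w, h0] at hne
      by_cases h1 : M.q x x' * M.g t x' = 0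
      · simp [h0, h1]
      · exact absurd (ENNReal.div_zero (ENNReal.coe_ne_zero.2 h1)) hne
    · rw [w]
      exact ENNReal.mul_div_cancel (by exact_mod_cast h0) ENNReal.coe_ne_top
  rw [← ENNReal.coe_toNNReal hne] at this
  exact_mod_cast this

lemma wt_le {t : ℕ} {x x' : X} {C : ℝ≥0} (h : A.w t x x' ≤ C) : A.wt t x x' ≤ C :=
  ENNReal.toNNReal_mono ENNReal.coe_ne_top h

/-- The normalizing constant `∑_i ω_t^i ϑ_{t+1}(ξ_t^i)`. -/
def multTotal (t : ℕ) (d : Swarm N X) : ℝ≥0 := ∑ i, (d t i).2 * A.ϑ (t + 1) (d t i).1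

@[fun_prop]
lemma measurable_multTotal (t : ℕ) : Measurable fun d : Swarm N X => A.multTotal t d := by
  have := A.measurable_ϑ (t + 1)
  unfold multTotal
  fun_prop

/-- The product of the average adjusted weights before time `t`. -/
def scale (t : ℕ) (d : Swarm N X) : ℝ≥0 := ∏ u ∈ Finset.range t, (N : ℝ≥0)⁻¹ * A.multTotal u d

@[fun_prop]
lemma measurable_scale (t : ℕ) : Measurable fun d : Swarm N X => A.scale t d := by
  unfold scale
  fun_prop

lemma scale_succ (t : ℕ) (d : Swarm N X) :
    A.scale (t + 1) d = A.scale t d * ((N : ℝ≥0)⁻¹ * A.multTotal t d) := by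
  simp [scale, Finset.prod_range_succ]

/-- The unnormalized particle estimator of the joint smoothing measure. -/
def est (t : ℕ) (d : Swarm N X) : Measure (ℕ → X) :=
  (A.scale t d * (N : ℝ≥0)⁻¹) • ∑ i, (d t i).2 • M.back t d i

instance (t : ℕ) (d : Swarm N X) : IsFiniteMeasure (A.est t d) := by unfold est; infer_instance

lemma lintegral_est (t : ℕ) (d : Swarm N X) (f : (ℕ → X) → ℝ≥0∞) :
    ∫⁻ y, f y ∂(A.est t d) = ((A.scale t d * (N : ℝ≥0)⁻¹ : ℝ≥0) : ℝ≥0∞) *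
      ∑ i, ((d t i).2 : ℝ≥0∞) * ∫⁻ y, f y ∂(M.back t d i) := by
  rw [est, lintegral_smul_measure, lintegral_finsetSum_measure]
  simp_rw [lintegral_smul_measure]
  rfl

lemma measurable_est (t : ℕ) : Measurable fun d : Swarm N X => A.est t d := by
  refine Measure.measurable_of_measurable_coe _ fun s hs => ?_
  simp_rw [← lintegral_indicator_one hs, lintegral_est, lintegral_indicator_one hs]
  refine Measurable.mul (by fun_prop) (Finset.measurable_sum _ fun i _ => ?_)
  exact Measurable.mul (by fun_prop) ((Measure.measurable_coe hs).comp (M.measurable_back t i))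

/-- The one-step instrumental distribution as a function of the particle system. -/
def inst (t : ℕ) (d : Swarm N X) : Measure (Fin N × X) :=
  A.instrumental (t + 1) (fun i => (d t i).1) (fun i => ((d t i).2 : ℝ))

lemma inst_eq (t : ℕ) (d : Swarm N X) :
    A.inst t d = ∑ i, ((d t i).2 * A.ϑ (t + 1) (d t i).1 / A.multTotal t d) •
      (M.ν.withDensity fun x' => (A.p (t + 1) (d t i).1 x' : ℝ≥0∞)).map (Prod.mk i) := by
  unfold inst instrumental multTotal
  refine Finset.sum_congr rfl fun i _ => ?_
  rw [Measure.dirac_prod]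
  have : ((d t i).2 : ℝ) * (A.ϑ (t + 1) (d t i).1 : ℝ) /
      ∑ ℓ, ((d t ℓ).2 : ℝ) * (A.ϑ (t + 1) (d t ℓ).1 : ℝ) =
      (((d t i).2 * A.ϑ (t + 1) (d t i).1 / ∑ ℓ, (d t ℓ).2 * A.ϑ (t + 1) (d t ℓ).1 : ℝ≥0) : ℝ) := by
    push_cast; rfl
  rw [this, ENNReal.ofReal_coe_nnreal]
  rfl

lemma measurable_p_apply (t : ℕ) (x : X) : Measurable (A.p t x) :=
  (A.measurable_p t).comp measurable_prodMk_left

lemma lintegral_inst (t : ℕ) (d : Swarm N X) {F : Fin N × X → ℝ≥0∞} (hF : Measurable F) :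
    ∫⁻ z, F z ∂(A.inst t d) =
      ∑ i, (((d t i).2 * A.ϑ (t + 1) (d t i).1 / A.multTotal t d : ℝ≥0) : ℝ≥0∞) *
        ∫⁻ x, (A.p (t + 1) (d t i).1 x : ℝ≥0∞) * F (i, x) ∂M.ν := by
  rw [inst_eq, lintegral_finsetSum_measure]
  refine Finset.sum_congr rfl fun i _ => ?_
  rw [lintegral_smul_measure, lintegral_map hF measurable_prodMk_left,
    lintegral_withDensity_eq_lintegral_mul (g := fun x => F (i, x)) _
      (A.measurable_p_apply (t + 1) (d t i).1).coe_nnreal_ennreal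
      (hF.comp measurable_prodMk_left)]
  rfl

/-- The quotient `a / a` treats both cases at once: the mass is one, or zero if the normalizing
constant vanishes. -/
lemma inst_univ (t : ℕ) (d : Swarm N X) :
    A.inst t d Set.univ = ((A.multTotal t d / A.multTotal t d : ℝ≥0) : ℝ≥0∞) := by
  rw [← lintegral_one, lintegral_inst _ _ _ measurable_const]
  simp only [mul_one, A.lintegral_p]
  rw [← ENNReal.ofNNReal_finsetSum]
  congr 1
  rw [← Finset.sum_div]
  rfl

lemma inst_univ_le (t : ℕ) (d : Swarm N X) : A.inst t d Set.univ ≤ 1 := by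
  rw [inst_univ]
  exact_mod_cast div_self_le_one _

instance (t : ℕ) (d : Swarm N X) : IsFiniteMeasure (A.inst t d) :=
  ⟨(A.inst_univ_le t d).trans_lt ENNReal.one_lt_top⟩

lemma isProbabilityMeasure_inst {t : ℕ} {d : Swarm N X} (h : A.multTotal t d ≠ 0) :
    IsProbabilityMeasure (A.inst t d) := ⟨by rw [inst_univ, div_self h, ENNReal.coe_one]⟩

lemma measurable_inst (t : ℕ) : Measurable fun d : Swarm N X => A.inst t d := by
  refine Measure.measurable_of_measurable_coe _ fun s hs => ?_
  simp_rw [← lintegral_indicator_one hs, lintegral_inst _ _ _ (measurable_one.indicator hs)]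
  have hϑ := A.measurable_ϑ (t + 1)
  refine Finset.measurable_sum _ fun i _ => Measurable.mul ?_ ?_
  · have := A.measurable_multTotal t (N := N)
    fun_prop
  · refine Measurable.lintegral_prod_right' (f := fun q : Swarm N X × X =>
      (A.p (t + 1) (q.1 t i).1 q.2 : ℝ≥0∞) * s.indicator 1 (i, q.2)) ?_
    refine Measurable.mul ?_ ((measurable_one.indicator hs).comp (by fun_prop))
    exact ((A.measurable_p (t + 1)).comp (f := fun q : Swarm N X × X => ((q.1 t i).1, q.2))
      (by fun_prop)).coe_nnreal_ennreal

/-- The transition kernel of the auxiliary particle filter: `N` independent draws from the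
instrumental distribution. -/
def instKernel (t : ℕ) : Kernel (Swarm N X) (Fin N → Fin N × X) :=
  ⟨fun d => Measure.pi fun _ => A.inst t d, measurable_pi_const (A.measurable_inst t)⟩

instance (t : ℕ) : IsFiniteKernel (A.instKernel (N := N) t) :=
  ⟨⟨1, ENNReal.one_lt_top, fun d => by
    simp only [instKernel, Kernel.coe_mk, Measure.pi_univ]
    exact Finset.prod_le_one' fun _ _ => A.inst_univ_le t d⟩⟩

/-- Change of measure in the instrumental distribution. -/
lemma multTotal_mul_lintegral_inst {t : ℕ} {C : ℝ≥0} (hw : ∀ x x', A.w (t + 1) x x' ≤ C)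
    (d : Swarm N X) {H : Fin N × X → ℝ≥0∞} (hH : Measurable H) :
    (A.multTotal t d : ℝ≥0∞) * ∫⁻ z, (A.wt (t + 1) (d t z.1).1 z.2 : ℝ≥0∞) * H z ∂(A.inst t d) =
      ∑ i, ((d t i).2 : ℝ≥0∞) *
        ∫⁻ x, ((M.q (d t i).1 x * M.g (t + 1) x : ℝ≥0) : ℝ≥0∞) * H (i, x) ∂M.ν := by
  have hwm : Measurable fun z : Fin N × X => A.wt (t + 1) (d t z.1).1 z.2 := by
    refine A.measurable_wt_comp (t + 1) ?_ measurable_snd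
    exact (Measurable.of_discrete (f := fun i : Fin N => (d t i).1)).comp measurable_fst
  rw [lintegral_inst _ _ _ (by fun_prop), Finset.mul_sum]
  refine Finset.sum_congr rfl fun i _ => ?_
  -- The normalizing constant cancels without a positivity assumption, because each nonnegative
  -- summand vanishes when the sum does.
  rw [← mul_assoc, ← ENNReal.coe_mul, mul_div_cancel_of_imp', ENNReal.coe_mul, mul_assoc]
  · congr 1
    rw [← lintegral_const_mul]
    · refine lintegral_congr fun x => ?_
      rw [← A.wt_mul_eq (hw (d t i).1 x)]
      push_cast
      ring
    · have h1 := A.measurable_p_apply (t + 1) (d t i).1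
      have h2 : Measurable fun x => A.wt (t + 1) (d t i).1 x :=
        A.measurable_wt_comp (t + 1) measurable_const measurable_id
      have h3 : Measurable fun x => H (i, x) := hH.comp measurable_prodMk_left
      exact h1.coe_nnreal_ennreal.mul (h2.coe_nnreal_ennreal.mul h3)
  · intro h
    exact (Finset.sum_eq_zero_iff.1 h) i (Finset.mem_univ i)

/-- The new factor `N⁻¹ · multTotal t` of `scale (t + 1)` cancels the random normalizing constant of
the instrumental distribution. This is the reason for carrying `scale` in `est`: conditional
expectations become exactly linear in the previous estimator. -/
lemma scale_mul_lintegral_inst {t : ℕ} {C : ℝ≥0} (hw : ∀ x x', A.w (t + 1) x x' ≤ C)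
    (d : Swarm N X) {H : Fin N × X → ℝ≥0∞} (hH : Measurable H) :
    (A.scale (t + 1) d : ℝ≥0∞) *
        ∫⁻ z, (A.wt (t + 1) (d t z.1).1 z.2 : ℝ≥0∞) * H z ∂(A.inst t d) =
      ((A.scale t d * (N : ℝ≥0)⁻¹ : ℝ≥0) : ℝ≥0∞) * ∑ i, ((d t i).2 : ℝ≥0∞) *
        ∫⁻ x, ((M.q (d t i).1 x * M.g (t + 1) x : ℝ≥0) : ℝ≥0∞) * H (i, x) ∂M.ν := by
  rw [← A.multTotal_mul_lintegral_inst hw d hH, scale_succ, ← mul_assoc, ← mul_assoc,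
    ENNReal.coe_mul, mul_assoc]

end AuxiliaryProposal

namespace StateSpaceModel
variable (M : StateSpaceModel X)

/-- A vanishing total forces every summand to vanish, so the uniform default becomes invisible once
multiplied by `backTotal`. -/
lemma backTotal_mul_backCoef (t : ℕ) (d : Swarm N X) (x : X) (j : Fin N) :
    M.backTotal t d x * M.backCoef t d x j = (d t j).2 * M.q (d t j).1 x := by
  unfold backCoef
  split_ifs with h
  · rw [h, zero_mul]
    exact ((Finset.sum_eq_zero_iff.1 h) j (Finset.mem_univ j)).symm
  · rw [mul_div_cancel₀ _ h]

lemma backTotal_mul_lintegral (t : ℕ) (d : Swarm N X) (x : X) {f : (ℕ → X) → ℝ≥0∞}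
    (hf : Measurable f) :
    (M.backTotal t d x : ℝ≥0∞) * ∫⁻ y, f y ∂(M.backNext t d x) =
      ∑ j, ((d t j).2 : ℝ≥0∞) * (M.q (d t j).1 x *
        ∫⁻ y, f (extend t (y, x)) ∂(M.back t d j)) := by
  rw [lintegral_backNext _ _ _ _ hf, Finset.mul_sum]
  refine Finset.sum_congr rfl fun j _ => ?_
  rw [← mul_assoc, ← ENNReal.coe_mul, backTotal_mul_backCoef, ENNReal.coe_mul, mul_assoc]

end StateSpaceModel

namespace AuxiliaryProposal

variable {M : StateSpaceModel X} (A : AuxiliaryProposal M) [MeasurableSingletonClass X]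

/-- The conditional expectation of the estimator after one step. -/
lemma scale_mul_lintegral_backNext {t : ℕ} {C : ℝ≥0} (hw : ∀ x x', A.w (t + 1) x x' ≤ C)
    (d : Swarm N X) {f : (ℕ → X) → ℝ≥0∞} (hf : Measurable f) :
    (A.scale (t + 1) d : ℝ≥0∞) *
        ∫⁻ z, (A.wt (t + 1) (d t z.1).1 z.2 : ℝ≥0∞) * ∫⁻ y, f y ∂(M.backNext t d z.2)
          ∂(A.inst t d) =
      ∫⁻ y, f y ∂(M.step t (A.est t d)) := by
  have hB : Measurable fun x => ∫⁻ y, f y ∂(M.backNext t d x) :=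
    measurable_lintegral_of_measurable (κ := fun x => M.backNext t d x)
      (M.measurable_backNext_comp t measurable_const measurable_id) (F := fun p => f p.2) (by fun_prop)
  have hpot : Measurable fun p : (ℕ → X) × X => (M.potential t p : ℝ≥0∞) * f (extend t p) := by
    fun_prop
  have hBj : ∀ j, Measurable fun x => ∫⁻ y, f (extend t (y, x)) ∂(M.back t d j) := fun j =>
    (hf.comp (measurable_extend t)).lintegral_prod_left'
  have hq := fun x => M.measurable_q_apply x
  have hg := M.measurable_g (t + 1)
  rw [A.scale_mul_lintegral_inst hw d (H := fun z => ∫⁻ y, f y ∂(M.backNext t d z.2))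
    (hB.comp measurable_snd), M.lintegral_step _ _ hf, lintegral_est]
  congr 1
  have e1 : ∀ i : Fin N, ((d t i).2 : ℝ≥0∞) * ∫⁻ x, ((M.q (d t i).1 x * M.g (t + 1) x : ℝ≥0) : ℝ≥0∞) *
      ∫⁻ y, f y ∂(M.backNext t d x) ∂M.ν = ∫⁻ x, ((d t i).2 : ℝ≥0∞) *
        (((M.q (d t i).1 x * M.g (t + 1) x : ℝ≥0) : ℝ≥0∞) * ∫⁻ y, f y ∂(M.backNext t d x)) ∂M.ν :=
    fun i => (lintegral_const_mul _ (by fun_prop)).symm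
  have e2 : ∀ i : Fin N, ((d t i).2 : ℝ≥0∞) * ∫⁻ y, ∫⁻ x, (M.potential t (y, x) : ℝ≥0∞) *
        f (extend t (y, x)) ∂M.ν ∂(M.back t d i) =
      ∫⁻ x, ((d t i).2 : ℝ≥0∞) * (((M.q (d t i).1 x * M.g (t + 1) x : ℝ≥0) : ℝ≥0∞) *
        ∫⁻ y, f (extend t (y, x)) ∂(M.back t d i)) ∂M.ν := fun i => by
    have hBi := hBj i
    rw [lintegral_const_mul _ (by fun_prop), lintegral_lintegral_swap (by fun_prop)]
    congr 1
    refine lintegral_congr fun x => ?_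
    rw [← lintegral_const_mul _ (by
      exact hf.comp (StateSpaceModel.measurable_extend_right t x))]
    refine lintegral_congr_ae ?_
    filter_upwards [M.ae_back t d i] with y hy
    simp [StateSpaceModel.potential, hy]
  simp_rw [e1, e2]
  rw [← lintegral_finsetSum _ fun i _ => by fun_prop,
    ← lintegral_finsetSum _ fun i _ => by have := hBj i; fun_prop]
  refine lintegral_congr fun x => ?_
  -- Summing over the ancestors puts the total backward weight in front of the backward mean at `x`
  -- and cancels its denominator. Averaged over the ancestor, redrawing it backwards from the new
  -- state `x` does not change the conditional mean.
  have := M.backTotal_mul_lintegral t d x hf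
  calc _ = (M.g (t + 1) x : ℝ≥0∞) * ((M.backTotal t d x : ℝ≥0∞) *
        ∫⁻ y, f y ∂(M.backNext t d x)) := by
        rw [StateSpaceModel.backTotal, ENNReal.ofNNReal_finsetSum, Finset.sum_mul, Finset.mul_sum]
        refine Finset.sum_congr rfl fun i _ => ?_
        push_cast; ring
    _ = _ := by
        rw [this, Finset.mul_sum]
        refine Finset.sum_congr rfl fun i _ => ?_
        push_cast; ring

/-- The conditional second moment of the weighted particles after one step. -/
lemma scale_mul_lintegral_sq {t : ℕ} {C : ℝ≥0} (hw : ∀ x x', A.w (t + 1) x x' ≤ C)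
    (d : Swarm N X) {H : X → ℝ≥0∞} (hH : Measurable H) :
    (A.scale (t + 1) d : ℝ≥0∞) *
        ∫⁻ z, (A.wt (t + 1) (d t z.1).1 z.2 : ℝ≥0∞) * (A.wt (t + 1) (d t z.1).1 z.2 * H z.2)
          ∂(A.inst t d) =
      ∫⁻ x, (∫⁻ y, (M.potential t (y, x) * A.wt (t + 1) (y t) x : ℝ≥0) ∂(A.est t d)) * H x ∂M.ν := by
  have hwm : Measurable fun z : Fin N × X => A.wt (t + 1) (d t z.1).1 z.2 := by
    refine A.measurable_wt_comp (t + 1) ?_ measurable_snd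
    exact (Measurable.of_discrete (f := fun i : Fin N => (d t i).1)).comp measurable_fst
  have hwi : ∀ i : Fin N, Measurable fun x => A.wt (t + 1) (d t i).1 x := fun i =>
    A.measurable_wt_comp (t + 1) measurable_const measurable_id
  have hq := fun x => M.measurable_q_apply x
  have hg := M.measurable_g (t + 1)
  rw [A.scale_mul_lintegral_inst hw d
    (H := fun z => (A.wt (t + 1) (d t z.1).1 z.2 : ℝ≥0∞) * H z.2) (by fun_prop)]
  simp_rw [lintegral_est]
  have e : ∀ (i : Fin N) (x : X),
      ∫⁻ y, ((M.potential t (y, x) * A.wt (t + 1) (y t) x : ℝ≥0) : ℝ≥0∞) ∂(M.back t d i) =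
        ((M.q (d t i).1 x * M.g (t + 1) x * A.wt (t + 1) (d t i).1 x : ℝ≥0) : ℝ≥0∞) :=
      fun i x => by
    rw [← mul_one (((_ : ℝ≥0) : ℝ≥0∞)), ← measure_univ (μ := M.back t d i), ← lintegral_const]
    refine lintegral_congr_ae ?_
    filter_upwards [M.ae_back t d i] with y hy
    simp [StateSpaceModel.potential, hy]
  simp_rw [e]
  have e1 : ∀ i : Fin N, ((d t i).2 : ℝ≥0∞) * ∫⁻ x, ((M.q (d t i).1 x * M.g (t + 1) x : ℝ≥0) : ℝ≥0∞) *
      ((A.wt (t + 1) (d t i).1 x : ℝ≥0∞) * H x) ∂M.ν = ∫⁻ x, ((d t i).2 : ℝ≥0∞) *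
        (((M.q (d t i).1 x * M.g (t + 1) x : ℝ≥0) : ℝ≥0∞) *
          ((A.wt (t + 1) (d t i).1 x : ℝ≥0∞) * H x)) ∂M.ν :=
    fun i => by
      have := hwi i
      exact (lintegral_const_mul _ (by fun_prop)).symm
  simp_rw [e1]
  rw [← lintegral_finsetSum _ fun i _ => by have := hwi i; fun_prop, ← lintegral_const_mul]
  · refine lintegral_congr fun x => ?_
    rw [mul_assoc, Finset.sum_mul]
    congr 1
    refine Finset.sum_congr rfl fun i _ => ?_
    push_cast; ring
  · exact Finset.measurable_sum _ fun i _ => by have := hwi i; fun_prop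

end AuxiliaryProposal

end Estimators

/-! ### The same identities for bounded real-valued functions. -/

section RealValued

variable {X : Type*} [MeasurableSpace X] {N : ℕ}

lemma abs_integral_le_of_univ_le_one {Y : Type*} [MeasurableSpace Y] {μ : Measure Y}
    [IsFiniteMeasure μ] (hμ : μ Set.univ ≤ 1) {f : Y → ℝ} {K : ℝ} (hK0 : 0 ≤ K) (hK : ∀ y, |f y| ≤ K) :
    |∫ y, f y ∂μ| ≤ K := by
  refine (norm_integral_le_of_norm_le_const (f := f) (ae_of_all μ hK)).trans ?_
  have : μ.real Set.univ ≤ 1 := ENNReal.toReal_le_of_le_ofReal zero_le_one (by simpa using hμ)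
  nlinarith

namespace StateSpaceModel
variable (M : StateSpaceModel X)

lemma integral_backNext (t : ℕ) (d : Swarm N X) (x : X) {f : (ℕ → X) → ℝ} (hf : Measurable f)
    {K : ℝ} (hK : ∀ y, |f y| ≤ K) :
    ∫ y, f y ∂(M.backNext t d x) =
      ∑ j, (M.backCoef t d x j : ℝ) * ∫ y, f (extend t (y, x)) ∂(M.back t d j) := by
  have hm := measurable_extend_right (X := X) t x
  rw [backNext, integral_finsetSum_measure]
  · refine Finset.sum_congr rfl fun j _ => ?_
    rw [integral_smul_nnreal_measure, integral_map hm.aemeasurable hf.aestronglyMeasurable]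
    rfl
  · intro j _
    exact (Integrable_of_abs_le (hf.aestronglyMeasurable) (ae_of_all _ hK)).smul_measure_nnreal

lemma measurable_integral_backNext (t : ℕ) {f : (ℕ → X) → ℝ} (hf : Measurable f) :
    Measurable fun p : Swarm N X × X => ∫ y, f y ∂(M.backNext t p.1 p.2) :=
  measurable_integral_of_measurable (κ := fun p : Swarm N X × X => M.backNext t p.1 p.2)
    (M.measurable_backNext t)
    (F := fun p => f p.2) (hf.comp measurable_snd)

lemma abs_integral_backNext_le (t : ℕ) (d : Swarm N X) (x : X) {f : (ℕ → X) → ℝ} {K : ℝ}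
    (hK0 : 0 ≤ K) (hK : ∀ y, |f y| ≤ K) : |∫ y, f y ∂(M.backNext t d x)| ≤ K :=
  abs_integral_le_of_univ_le_one (M.backNext_univ_le t d x) hK0 hK

end StateSpaceModel

namespace AuxiliaryProposal

variable {M : StateSpaceModel X} (A : AuxiliaryProposal M)

/-- The particle system after one more step, given the ancestor indices and new particles. -/
def next (t : ℕ) (d : Swarm N X) (z : Fin N → Fin N × X) : Swarm N X := fun u =>
  if u ≤ t then d u else fun i => ((z i).2, A.wt (t + 1) (d t (z i).1).1 (z i).2)

lemma next_of_le {t u : ℕ} (h : u ≤ t) (d : Swarm N X) (z : Fin N → Fin N × X) :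
    A.next t d z u = d u := by simp [next, h]

lemma next_succ (t : ℕ) (d : Swarm N X) (z : Fin N → Fin N × X) :
    A.next t d z (t + 1) = fun i => ((z i).2, A.wt (t + 1) (d t (z i).1).1 (z i).2) := by
  simp [next]

lemma measurable_wt_pair (t : ℕ) (i : Fin N) :
    Measurable fun p : Swarm N X × (Fin N → Fin N × X) =>
      A.wt (t + 1) (p.1 t (p.2 i).1).1 (p.2 i).2 := by
  refine A.measurable_wt_comp (t + 1) ?_ (by fun_prop)
  have h : Measurable fun p : Fin N × Swarm N X => (p.2 t p.1).1 :=
    measurable_from_prod_countable_right fun j => Swarm.measurable_particle t j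
  exact h.comp (f := fun p : Swarm N X × (Fin N → Fin N × X) => ((p.2 i).1, p.1)) (by fun_prop)

lemma measurable_next (t : ℕ) :
    Measurable fun p : Swarm N X × (Fin N → Fin N × X) => A.next t p.1 p.2 := by
  refine measurable_pi_iff.2 fun u => ?_
  by_cases h : u ≤ t
  · simp only [next, h, if_true]
    fun_prop
  · simp only [next, h, if_false]
    refine measurable_pi_iff.2 fun i => Measurable.prodMk (by fun_prop) (A.measurable_wt_pair t i)

lemma scale_congr {t : ℕ} {d d' : Swarm N X} (h : ∀ u < t, d u = d' u) :
    A.scale t d = A.scale t d' := by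
  unfold scale
  refine Finset.prod_congr rfl fun u hu => ?_
  simp only [multTotal, h u (Finset.mem_range.1 hu)]

lemma est_next (t : ℕ) (d : Swarm N X) (z : Fin N → Fin N × X) :
    A.est (t + 1) (A.next t d z) = (A.scale (t + 1) d * (N : ℝ≥0)⁻¹) •
      ∑ i, A.wt (t + 1) (d t (z i).1).1 (z i).2 • M.backNext t d (z i).2 := by
  have h : ∀ u ≤ t, A.next t d z u = d u := fun u hu => A.next_of_le hu d z
  rw [est, A.scale_congr (t := t + 1) fun u hu => h u (by omega)]
  simp only [M.back_succ, A.next_succ, M.backNext_congr h]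

lemma lintegral_est_next (t : ℕ) (d : Swarm N X) (z : Fin N → Fin N × X) (f : (ℕ → X) → ℝ≥0∞) :
    ∫⁻ y, f y ∂(A.est (t + 1) (A.next t d z)) = ((A.scale (t + 1) d * (N : ℝ≥0)⁻¹ : ℝ≥0) : ℝ≥0∞) *
      ∑ i, (A.wt (t + 1) (d t (z i).1).1 (z i).2 : ℝ≥0∞) *
        ∫⁻ y, f y ∂(M.backNext t d (z i).2) := by
  rw [est_next, lintegral_smul_measure, lintegral_finsetSum_measure]
  simp_rw [lintegral_smul_measure]
  rfl

/-- The contribution of a new particle to the estimator. -/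
def incr (t : ℕ) (d : Swarm N X) (f : (ℕ → X) → ℝ) (z : Fin N × X) : ℝ :=
  (A.wt (t + 1) (d t z.1).1 z.2 : ℝ) * ∫ y, f y ∂(M.backNext t d z.2)

lemma integral_est_next (t : ℕ) (d : Swarm N X) (z : Fin N → Fin N × X) {f : (ℕ → X) → ℝ}
    (hf : Measurable f) {K : ℝ} (hK : ∀ y, |f y| ≤ K) :
    ∫ y, f y ∂(A.est (t + 1) (A.next t d z)) =
      (A.scale (t + 1) d : ℝ) * ((N : ℝ)⁻¹ * ∑ i, A.incr t d f (z i)) := by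
  rw [est_next, integral_smul_nnreal_measure, integral_finsetSum_measure]
  · simp_rw [integral_smul_nnreal_measure]
    simp only [NNReal.smul_def, NNReal.coe_mul, NNReal.coe_inv, NNReal.coe_natCast, smul_eq_mul,
      incr, mul_assoc]
  · intro j _
    exact (Integrable_of_abs_le (hf.aestronglyMeasurable) (ae_of_all _ hK)).smul_measure_nnreal

lemma measurable_incr (t : ℕ) (d : Swarm N X) {f : (ℕ → X) → ℝ} (hf : Measurable f) :
    Measurable (A.incr t d f) := by
  have h1 : Measurable fun z : Fin N × X => A.wt (t + 1) (d t z.1).1 z.2 := by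
    refine A.measurable_wt_comp (t + 1) ?_ measurable_snd
    exact (Measurable.of_discrete (f := fun i : Fin N => (d t i).1)).comp measurable_fst
  have h2 : Measurable fun z : Fin N × X => ∫ y, f y ∂(M.backNext t d z.2) :=
    (M.measurable_integral_backNext (N := N) t hf).comp (f := fun z : Fin N × X => (d, z.2))
      (by fun_prop)
  exact h1.coe_nnreal_real.mul h2

lemma abs_incr_le {t : ℕ} {C : ℝ≥0} (hw : ∀ x x', A.w (t + 1) x x' ≤ C) (d : Swarm N X)
    {f : (ℕ → X) → ℝ} {K : ℝ} (hK0 : 0 ≤ K) (hK : ∀ y, |f y| ≤ K) (z : Fin N × X) :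
    |A.incr t d f z| ≤ C * K := by
  rw [incr, abs_mul, NNReal.abs_eq]
  gcongr
  · exact A.wt_le (hw _ _)
  · exact M.abs_integral_backNext_le t d z.2 hK0 hK

variable [MeasurableSingletonClass X]

omit [MeasurableSingletonClass X] in
lemma integrable_est_of_forall_back {t : ℕ} {d : Swarm N X} {F : (ℕ → X) → ℝ}
    (h : ∀ i, Integrable F (M.back t d i)) : Integrable F (A.est t d) := by
  refine Integrable.smul_measure_nnreal ?_
  rw [integrable_finsetSum_measure]
  exact fun i _ => (h i).smul_measure_nnreal

omit [MeasurableSingletonClass X] in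
lemma integral_est_of_forall_back {t : ℕ} {d : Swarm N X} {F : (ℕ → X) → ℝ}
    (h : ∀ i, Integrable F (M.back t d i)) :
    ∫ y, F y ∂(A.est t d) = (A.scale t d : ℝ) * (N : ℝ)⁻¹ *
      ∑ i, ((d t i).2 : ℝ) * ∫ y, F y ∂(M.back t d i) := by
  rw [est, integral_smul_nnreal_measure, integral_finsetSum_measure]
  · simp_rw [integral_smul_nnreal_measure]
    simp only [NNReal.smul_def, NNReal.coe_mul, NNReal.coe_inv, NNReal.coe_natCast, smul_eq_mul]
  · exact fun i _ => (h i).smul_measure_nnreal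

/-- `F` needs neither measurability nor a bound, since `F (y t)` is almost surely constant under
`back`. This is what permits unbounded densities `q (·, x)` as integrands of the particle estimator.
-/
lemma integrable_back_state_mul (t : ℕ) (d : Swarm N X) (i : Fin N) (F : X → ℝ)
    {f : (ℕ → X) → ℝ} (hf : Measurable f) {K : ℝ} (hK : ∀ y, |f y| ≤ K) :
    Integrable (fun y => F (y t) * f y) (M.back t d i) ∧
      ∫ y, F (y t) * f y ∂(M.back t d i) = F (d t i).1 * ∫ y, f y ∂(M.back t d i) := by
  have hae : (fun y => F (y t) * f y) =ᵐ[M.back t d i] fun y => F (d t i).1 * f y := by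
    filter_upwards [M.ae_back t d i] with y hy
    rw [hy]
  refine ⟨?_, ?_⟩
  · exact ((Integrable_of_abs_le hf.aestronglyMeasurable (ae_of_all _ hK)).const_mul _).congr
      hae.symm
  · rw [integral_congr_ae hae, integral_const_mul]

lemma integrable_est_state_mul (t : ℕ) (d : Swarm N X) (F : X → ℝ)
    {f : (ℕ → X) → ℝ} (hf : Measurable f) {K : ℝ} (hK : ∀ y, |f y| ≤ K) :
    Integrable (fun y => F (y t) * f y) (A.est t d) :=
  A.integrable_est_of_forall_back fun i => (integrable_back_state_mul t d i F hf hK).1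

lemma integral_est_state_mul (t : ℕ) (d : Swarm N X) (F : X → ℝ)
    {f : (ℕ → X) → ℝ} (hf : Measurable f) {K : ℝ} (hK : ∀ y, |f y| ≤ K) :
    ∫ y, F (y t) * f y ∂(A.est t d) = (A.scale t d : ℝ) * (N : ℝ)⁻¹ *
      ∑ i, ((d t i).2 : ℝ) * (F (d t i).1 * ∫ y, f y ∂(M.back t d i)) := by
  rw [A.integral_est_of_forall_back fun i => (integrable_back_state_mul t d i F hf hK).1]
  simp_rw [fun i => (integrable_back_state_mul (M := M) t d i F hf hK).2]

lemma integrable_est_state (t : ℕ) (d : Swarm N X) (F : X → ℝ) :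
    Integrable (fun y => F (y t)) (A.est t d) := by
  simpa using A.integrable_est_state_mul t d F (f := fun _ => 1) measurable_const (K := 1) (by simp)

lemma integral_est_state (t : ℕ) (d : Swarm N X) (F : X → ℝ) :
    ∫ y, F (y t) ∂(A.est t d) = (A.scale t d : ℝ) * (N : ℝ)⁻¹ *
      ∑ i, ((d t i).2 : ℝ) * F (d t i).1 := by
  simpa using A.integral_est_state_mul t d F (f := fun _ => 1) measurable_const (K := 1) (by simp)

/-- The backward average of `f` is a ratio of two particle estimators. -/
lemma integral_est_mul_integral_backNext (t : ℕ) (d : Swarm N X) (x : X) {f : (ℕ → X) → ℝ}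
    (hf : Measurable f) {K : ℝ} (hK : ∀ y, |f y| ≤ K) :
    (∫ y, (M.q (y t) x : ℝ) ∂(A.est t d)) * ∫ y, f y ∂(M.backNext t d x) =
      ∫ y, (M.q (y t) x : ℝ) * f (extend t (y, x)) ∂(A.est t d) := by
  rw [A.integral_est_state t d fun x' => (M.q x' x : ℝ),
    A.integral_est_state_mul t d (fun x' => (M.q x' x : ℝ)) (f := fun y => f (extend t (y, x)))
      (hf.comp (StateSpaceModel.measurable_extend_right t x)) (fun y => hK _),
    M.integral_backNext t d x hf hK, mul_assoc]
  congr 1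
  have h1 : ∑ i, ((d t i).2 : ℝ) * (M.q (d t i).1 x : ℝ) = (M.backTotal t d x : ℝ) := by
    simp [StateSpaceModel.backTotal]
  rw [h1, Finset.mul_sum]
  refine Finset.sum_congr rfl fun j _ => ?_
  rw [← mul_assoc, ← NNReal.coe_mul, M.backTotal_mul_backCoef, NNReal.coe_mul, mul_assoc]

/-- The conditional expectation of the estimator of a bounded function after one step. -/
lemma scale_mul_integral_incr {t : ℕ} {C : ℝ≥0} (hw : ∀ x x', A.w (t + 1) x x' ≤ C)
    {C' : ℝ≥0} (hg : ∀ x, M.g (t + 1) x ≤ C')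
    (d : Swarm N X) {f : (ℕ → X) → ℝ} (hf : Measurable f) {K : ℝ} (hK : ∀ y, |f y| ≤ K) :
    (A.scale (t + 1) d : ℝ) * ∫ z, A.incr t d f z ∂(A.inst t d) =
      ∫ y, f y ∂(M.step t (A.est t d)) := by
  have := M.isFiniteMeasure_step hg (A.est t d)
  have hnonneg : ∀ (f : (ℕ → X) → ℝ) (K : ℝ), Measurable f → (∀ y, |f y| ≤ K) → (∀ y, 0 ≤ f y) →
      (A.scale (t + 1) d : ℝ) * ∫ z, A.incr t d f z ∂(A.inst t d) =
        ∫ y, f y ∂(M.step t (A.est t d)) := by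
    intro f K hf hK h0
    have h := A.scale_mul_lintegral_backNext hw d (f := fun y => ENNReal.ofReal (f y)) (by fun_prop)
    rw [integral_eq_lintegral_of_nonneg_ae (ae_of_all _ h0) hf.aestronglyMeasurable, ← h,
      ENNReal.toReal_mul, ENNReal.coe_toReal, integral_eq_lintegral_of_nonneg_ae
        (f := A.incr t d f) (ae_of_all _ fun z => mul_nonneg (NNReal.coe_nonneg _) (integral_nonneg h0))
        (A.measurable_incr t d hf).aestronglyMeasurable]
    congr 2
    refine lintegral_congr fun z => ?_
    rw [incr, ENNReal.ofReal_mul (NNReal.coe_nonneg _), ENNReal.ofReal_coe_nnreal,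
      ofReal_integral_eq_lintegral_ofReal (Integrable_of_abs_le hf.aestronglyMeasurable
        (ae_of_all _ hK)) (ae_of_all _ h0)]
  rcases isEmpty_or_nonempty (ℕ → X) with he | ⟨⟨y0⟩⟩
  · exact hnonneg f K hf hK fun y => (he.false y).elim
  have hK0 : 0 ≤ K := (abs_nonneg _).trans (hK y0)
  -- A bounded `f` is the difference of the nonnegative functions `f + K` and `K`, and both sides of
  -- the identity are additive.
  have h1 := hnonneg (fun y => f y + K) (2 * K) (by fun_prop)
    (fun y => (abs_add_le _ _).trans (by rw [abs_of_nonneg hK0]; linarith [hK y]))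
    (fun y => by linarith [neg_le_of_abs_le (hK y)])
  have h2 := hnonneg (fun _ => K) K measurable_const (fun y => by simp [abs_of_nonneg hK0])
    (fun _ => hK0)
  have hfi : ∀ (μ : Measure (ℕ → X)) [IsFiniteMeasure μ], Integrable f μ := fun μ _ =>
    Integrable_of_abs_le hf.aestronglyMeasurable (ae_of_all _ hK)
  have hinc : ∀ z, A.incr t d (fun y => f y + K) z = A.incr t d f z + A.incr t d (fun _ => K) z := by
    intro z
    rw [incr, integral_add (hfi _) (integrable_const _), mul_add]
    rfl
  have hi : ∀ (f : (ℕ → X) → ℝ), Measurable f → (∀ y, |f y| ≤ K) →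
      Integrable (A.incr t d f) (A.inst t d) := fun f hf hK =>
    Integrable_of_abs_le (A.measurable_incr t d hf).aestronglyMeasurable
      (ae_of_all _ fun z => A.abs_incr_le hw d hK0 hK z)
  simp_rw [hinc] at h1
  rw [integral_add (hi f hf hK) (hi _ measurable_const fun y => by simp [abs_of_nonneg hK0]),
    integral_add (hfi _) (integrable_const _), mul_add, h2] at h1
  linarith

/-- The conditional second moment of the contribution of a new particle. -/
lemma scale_mul_integral_incr_sq {t : ℕ} {C : ℝ≥0} (hw : ∀ x x', A.w (t + 1) x x' ≤ C)
    (d : Swarm N X) {f : (ℕ → X) → ℝ} (hf : Measurable f) :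
    (A.scale (t + 1) d : ℝ) * ∫ z, A.incr t d f z ^ 2 ∂(A.inst t d) =
      ∫ x, (∫ y, ((M.potential t (y, x) * A.wt (t + 1) (y t) x : ℝ≥0) : ℝ) ∂(A.est t d)) *
        (∫ y, f y ∂(M.backNext t d x)) ^ 2 ∂M.ν := by
  have hG : Measurable fun x => ∫ y, f y ∂(M.backNext t d x) :=
    (M.measurable_integral_backNext (N := N) t hf).comp (f := fun x => (d, x)) (by fun_prop)
  have hpw : Measurable fun p : X × (ℕ → X) => M.potential t (p.2, p.1) * A.wt (t + 1) (p.2 t) p.1 := by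
    refine Measurable.mul (by fun_prop) (A.measurable_wt_comp _ (by fun_prop) (by fun_prop))
  have h := A.scale_mul_lintegral_sq hw d
    (H := fun x => ENNReal.ofReal ((∫ y, f y ∂(M.backNext t d x)) ^ 2)) (by fun_prop)
  have hb : ∀ x, ∫⁻ y, ((M.potential t (y, x) * A.wt (t + 1) (y t) x : ℝ≥0) : ℝ≥0∞) ∂(A.est t d) =
      ENNReal.ofReal (∫ y, ((M.potential t (y, x) * A.wt (t + 1) (y t) x : ℝ≥0) : ℝ)
        ∂(A.est t d)) := by
    intro x
    rw [ofReal_integral_eq_lintegral_ofReal _ (ae_of_all _ fun _ => NNReal.coe_nonneg _)]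
    · simp
    · exact A.integrable_est_state t d fun x' =>
        ((M.q x' x * M.g (t + 1) x * A.wt (t + 1) x' x : ℝ≥0) : ℝ)
  simp_rw [hb] at h
  rw [integral_eq_lintegral_of_nonneg_ae (ae_of_all _ fun x => mul_nonneg
      (integral_nonneg fun _ => NNReal.coe_nonneg _) (sq_nonneg _)),
    integral_eq_lintegral_of_nonneg_ae (ae_of_all _ fun z => sq_nonneg _)]
  · simp_rw [fun x => ENNReal.ofReal_mul (p := ∫ y, ((M.potential t (y, x) * A.wt (t + 1) (y t) x :
      ℝ≥0) : ℝ) ∂(A.est t d)) (q := (∫ y, f y ∂(M.backNext t d x)) ^ 2)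
        (integral_nonneg fun _ => NNReal.coe_nonneg _)]
    rw [← h, ENNReal.toReal_mul, ENNReal.coe_toReal]
    congr 2
    refine lintegral_congr fun z => ?_
    rw [incr, mul_pow, ENNReal.ofReal_mul (sq_nonneg _), sq, ENNReal.ofReal_mul (NNReal.coe_nonneg _),
      ENNReal.ofReal_coe_nnreal, mul_assoc]
  · exact ((A.measurable_incr t d hf).pow_const 2).aestronglyMeasurable
  · refine AEStronglyMeasurable.mul ?_ (hG.pow_const 2).aestronglyMeasurable
    exact (hpw.coe_nnreal_real.stronglyMeasurable.integral_prod_right'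
      (ν := A.est t d)).aestronglyMeasurable

end AuxiliaryProposal

end RealValued

/-! ### Random particle systems: Markov transitions, degeneration, unbiasedness and boundedness. -/

section Runs

variable {X : Type*} [MeasurableSpace X] {N : ℕ}

namespace AuxiliaryProposal

variable {M : StateSpaceModel X} (A : AuxiliaryProposal M)

/-- A common bound for the likelihoods, the adjustment multipliers and the weights up to time `T`. -/
structure BoundedBy (T : ℕ) (C : ℝ≥0) : Prop where
  g_le : ∀ t ≤ T, ∀ x, M.g t x ≤ C
  ϑ_le : ∀ t, 1 ≤ t → t ≤ T → ∀ x, A.ϑ t x ≤ C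
  w₀_le : ∀ᵐ x ∂A.ρ₀, A.w₀ x ≤ C
  w_le : ∀ t, 1 ≤ t → t ≤ T → ∀ x x', A.w t x x' ≤ C

/-- The initial particle system. -/
def initSwarm (z : Fin N → X) : Swarm N X := fun _ i => (z i, (A.w₀ (z i)).toNNReal)

lemma measurable_w₀ : Measurable A.w₀ :=
  (Measure.measurable_rnDeriv _ _).mul (M.measurable_g 0).coe_nnreal_ennreal

lemma measurable_initSwarm : Measurable (A.initSwarm (N := N)) := by
  have := A.measurable_w₀
  unfold initSwarm
  fun_prop

/-- The random particle systems `D t`, generated by the auxiliary particle filter up to time `T`;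
`Z t` are the ancestor indices and new particles of step `t + 1`. -/
structure IsRun {Ω : Type*} [MeasurableSpace Ω] (P : Measure Ω) (T : ℕ) (D : ℕ → Ω → Swarm N X)
    (Z : ℕ → Ω → Fin N → Fin N × X) : Prop where
  measurable_D : ∀ t, Measurable (D t)
  measurable_Z : ∀ t, Measurable (Z t)
  init_law : P.map (D 0) = (Measure.pi fun _ : Fin N => A.ρ₀).map A.initSwarm
  next_eq : ∀ t ω, D (t + 1) ω = A.next t (D t ω) (Z t ω)
  condLaw : ∀ t < T, IsCondLawOn P (D t) (Z t) (A.instKernel t) {d | A.scale (t + 1) d ≠ 0}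

lemma instKernel_apply (t : ℕ) (d : Swarm N X) :
    A.instKernel t d = Measure.pi fun _ => A.inst t d := rfl

lemma multTotal_ne_zero_of_scale {t : ℕ} {d : Swarm N X} (h : A.scale (t + 1) d ≠ 0) :
    A.multTotal t d ≠ 0 := fun h0 => h (by rw [scale_succ, h0]; simp)

lemma scale_eq_zero_of_le {t u : ℕ} (htu : t ≤ u) {d : Swarm N X} (h : A.scale t d = 0) :
    A.scale u d = 0 := by
  induction u, htu using Nat.le_induction with
  | base => exact h
  | succ u _ ih => rw [scale_succ, ih, zero_mul]

lemma est_eq_zero_of_scale {t : ℕ} {d : Swarm N X} (h : A.scale t d = 0) : A.est t d = 0 := by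
  simp [est, h]

/-- `scale (t + 1)` involves weights up to time `t` only: it is predictable, and can be treated as a
constant in conditional computations for step `t + 1`. -/
lemma scale_next (t : ℕ) (d : Swarm N X) (z : Fin N → Fin N × X) :
    A.scale (t + 1) (A.next t d z) = A.scale (t + 1) d :=
  A.scale_congr fun u hu => A.next_of_le (by omega) d z

/-- Taking the constant function in the conditional mean identity shows that the total mass of the
left side is a multiple of `scale (t + 1)`. Hence the martingale increment is zero on the degenerate
event, however the run is continued. -/
lemma step_est_eq_zero [MeasurableSingletonClass X] {t : ℕ} {C : ℝ≥0}
    (hw : ∀ x x', A.w (t + 1) x x' ≤ C) {d : Swarm N X} (h : A.scale (t + 1) d = 0) :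
    M.step t (A.est t d) = 0 := by
  have h1 := A.scale_mul_lintegral_backNext hw d (f := fun _ => 1) measurable_const
  rw [h] at h1
  simpa using h1.symm

/-- One step of unbiasedness: the `N` exchangeable contributions have equal expectations, and the
factor `N⁻¹` turns their sum into a single one. Off the degenerate event the coordinates of the
product law have law `inst t d`. -/
lemma lintegral_pi_inst_est_next [MeasurableSingletonClass X] (hN : N ≠ 0) {t : ℕ} {C : ℝ≥0}
    (hw : ∀ x x', A.w (t + 1) x x' ≤ C) {d : Swarm N X} (h : A.scale (t + 1) d ≠ 0)
    {f : (ℕ → X) → ℝ≥0∞} (hf : Measurable f) :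
    ∫⁻ z, ∫⁻ y, f y ∂(A.est (t + 1) (A.next t d z)) ∂(A.instKernel t d) =
      ∫⁻ y, f y ∂(M.step t (A.est t d)) := by
  have := A.isProbabilityMeasure_inst (A.multTotal_ne_zero_of_scale h)
  set ψ : Fin N × X → ℝ≥0∞ := fun z => (A.wt (t + 1) (d t z.1).1 z.2 : ℝ≥0∞) *
    ∫⁻ y, f y ∂(M.backNext t d z.2) with hψ
  have hψm : Measurable ψ := by
    have h1 : Measurable fun z : Fin N × X => A.wt (t + 1) (d t z.1).1 z.2 := by
      refine A.measurable_wt_comp (t + 1) ?_ measurable_snd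
      exact (Measurable.of_discrete (f := fun i : Fin N => (d t i).1)).comp measurable_fst
    have h2 : Measurable fun z : Fin N × X => ∫⁻ y, f y ∂(M.backNext t d z.2) :=
      measurable_lintegral_of_measurable (κ := fun z : Fin N × X => M.backNext t d z.2)
        (M.measurable_backNext_comp t measurable_const measurable_snd)
        (F := fun p => f p.2) (by fun_prop)
    exact h1.coe_nnreal_ennreal.mul h2
  simp_rw [lintegral_est_next]
  rw [instKernel_apply, lintegral_const_mul _ (Finset.measurable_sum _ fun i _ => by
    exact hψm.comp (measurable_pi_apply i)), lintegral_finsetSum _ fun i _ => by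
    exact hψm.comp (measurable_pi_apply i)]
  have hi : ∀ i : Fin N, ∫⁻ z, ψ (z i) ∂(Measure.pi fun _ : Fin N => A.inst t d) =
      ∫⁻ z, ψ z ∂(A.inst t d) := fun i =>
    (measurePreserving_eval (fun _ : Fin N => A.inst t d) i).lintegral_comp hψm
  rw [← A.scale_mul_lintegral_backNext hw d hf]
  simp only [hψ] at hi
  simp_rw [hi]
  rw [Finset.sum_const, Finset.card_univ, Fintype.card_fin, nsmul_eq_mul, ← mul_assoc]
  congr 1
  rw [show ((N : ℕ) : ℝ≥0∞) = ((N : ℝ≥0) : ℝ≥0∞) by simp, ← ENNReal.coe_mul]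
  congr 1
  have : (N : ℝ≥0) ≠ 0 := by exact_mod_cast hN
  rw [mul_assoc, inv_mul_cancel₀ this, mul_one]

namespace IsRun

variable {A} {Ω : Type*} [MeasurableSpace Ω] {P : Measure Ω} [IsProbabilityMeasure P] {T : ℕ}
  {D : ℕ → Ω → Swarm N X} {Z : ℕ → Ω → Fin N → Fin N × X} {C : ℝ≥0}

omit [IsProbabilityMeasure P] in
lemma lintegral_init (h : A.IsRun P T D Z) {F : Swarm N X → ℝ≥0∞} (hF : Measurable F) :
    ∫⁻ ω, F (D 0 ω) ∂P = ∫⁻ z, F (A.initSwarm z) ∂(Measure.pi fun _ : Fin N => A.ρ₀) := by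
  rw [← lintegral_map hF (h.measurable_D 0), h.init_law, lintegral_map hF A.measurable_initSwarm]

omit [IsProbabilityMeasure P] in
lemma measurableSet_alive (h : A.IsRun P T D Z) (t : ℕ) :
    MeasurableSet (D t ⁻¹' {d | A.scale (t + 1) d ≠ 0}) :=
  h.measurable_D t (A.measurable_scale (t + 1) (measurableSet_singleton 0).compl)

/-- A function that vanishes once the filter degenerates is integrated with the transition kernel. -/
lemma lintegral_next (h : A.IsRun P T D Z) {t : ℕ} (ht : t < T)
    {F : Swarm N X × (Fin N → Fin N × X) → ℝ≥0∞} (hF : Measurable F)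
    (hF0 : ∀ d z, A.scale (t + 1) d = 0 → F (d, z) = 0) :
    ∫⁻ ω, F (D t ω, Z t ω) ∂P =
      ∫⁻ ω in D t ⁻¹' {d | A.scale (t + 1) d ≠ 0},
        ∫⁻ z, F (D t ω, z) ∂(A.instKernel t (D t ω)) ∂P := by
  rw [← (h.condLaw t ht).lintegral (h.measurable_D t) (h.measurable_Z t) hF,
    ← lintegral_indicator (h.measurableSet_alive t)]
  refine lintegral_congr fun ω => ?_
  by_cases h0 : A.scale (t + 1) (D t ω) = 0
  · rw [hF0 _ _ h0, Set.indicator_of_notMem]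
    exact fun h1 => h1 h0
  · rw [Set.indicator_of_mem]; exact h0

/-- The particle estimator of the unnormalized smoothing measure is unbiased. -/
lemma lintegral_est_eq [MeasurableSingletonClass X] (h : A.IsRun P T D Z) (hC : A.BoundedBy T C)
    (hN : N ≠ 0) {t : ℕ} (ht : t ≤ T) {f : (ℕ → X) → ℝ≥0∞} (hf : Measurable f) :
    ∫⁻ ω, ∫⁻ y, f y ∂(A.est t (D t ω)) ∂P = ∫⁻ y, f y ∂(M.pathMeasure t) := by
  have hN' : (N : ℝ≥0) ≠ 0 := by exact_mod_cast hN
  have hfm : ∀ t, Measurable fun d : Swarm N X => ∫⁻ y, f y ∂(A.est t d) := fun t =>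
    measurable_lintegral_of_measurable (κ := fun d : Swarm N X => A.est t d)
      (A.measurable_est t) (F := fun p => f p.2) (by fun_prop)
  induction t generalizing f with
  | zero =>
    rw [h.lintegral_init (hfm 0)]
    have hcm : Measurable fun (x : X) (_ : ℕ) => x := by fun_prop
    set ψ : X → ℝ≥0∞ := fun x => ((A.w₀ x).toNNReal : ℝ≥0∞) * f (fun _ => x) with hψ
    have hψm : Measurable ψ := by
      have := A.measurable_w₀
      exact this.ennreal_toNNReal.coe_nnreal_ennreal.mul (hf.comp hcm)
    have e : ∀ z : Fin N → X, ∫⁻ y, f y ∂(A.est 0 (A.initSwarm z)) =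
        ((N : ℝ≥0)⁻¹ : ℝ≥0) * ∑ i, ψ (z i) := fun z => by
      rw [lintegral_est]
      simp [scale, initSwarm, StateSpaceModel.back, lintegral_dirac' _ hf, hψ]
    simp_rw [e]
    rw [lintegral_const_mul _ (Finset.measurable_sum _ fun i _ => by
      exact hψm.comp (measurable_pi_apply i)), lintegral_finsetSum _ fun i _ => by
      exact hψm.comp (measurable_pi_apply i)]
    have hi : ∀ i : Fin N, ∫⁻ z, ψ (z i) ∂(Measure.pi fun _ : Fin N => A.ρ₀) =
        ∫⁻ x, ψ x ∂A.ρ₀ := fun i =>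
      (measurePreserving_eval (fun _ : Fin N => A.ρ₀) i).lintegral_comp hψm
    simp_rw [hi]
    rw [Finset.sum_const, Finset.card_univ, Fintype.card_fin, nsmul_eq_mul, ← mul_assoc,
      show ((N : ℕ) : ℝ≥0∞) = ((N : ℝ≥0) : ℝ≥0∞) by simp, ← ENNReal.coe_mul,
      inv_mul_cancel₀ hN', ENNReal.coe_one, one_mul, StateSpaceModel.pathMeasure,
      lintegral_map hf hcm, lintegral_withDensity_eq_lintegral_mul (g := fun x => f fun _ => x) _
      (M.measurable_g 0).coe_nnreal_ennreal (hf.comp hcm),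
      ← lintegral_rnDeriv_mul A.absolutelyContinuous]
    · refine lintegral_congr_ae ?_
      filter_upwards [hC.w₀_le] with x hx
      change ((A.w₀ x).toNNReal : ℝ≥0∞) * f (fun _ => x) =
        M.χ.rnDeriv A.ρ₀ x * ((M.g 0 x : ℝ≥0∞) * f fun _ => x)
      rw [ENNReal.coe_toNNReal (ne_top_of_le_ne_top ENNReal.coe_ne_top hx), w₀, mul_assoc]
    · exact ((M.measurable_g 0).coe_nnreal_ennreal.mul (hf.comp hcm)).aemeasurable
  | succ t ih =>
    have hw := hC.w_le (t + 1) (by omega) ht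
    have hstep : ∀ μ : Measure (ℕ → X), ∫⁻ y, f y ∂(M.step t μ) =
        ∫⁻ y, ∫⁻ x, (M.potential t (y, x) : ℝ≥0∞) * f (extend t (y, x)) ∂M.ν ∂μ := fun μ =>
      M.lintegral_step t μ hf
    have hm2 : Measurable fun y : ℕ → X =>
        ∫⁻ x, (M.potential t (y, x) : ℝ≥0∞) * f (extend t (y, x)) ∂M.ν :=
      Measurable.lintegral_prod_right' (f := fun p : (ℕ → X) × X =>
        (M.potential t p : ℝ≥0∞) * f (extend t p)) (by fun_prop)
    rw [show M.pathMeasure (t + 1) = M.step t (M.pathMeasure t) from rfl, hstep,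
      ← ih (by omega) hm2 fun t => measurable_lintegral_of_measurable
        (κ := fun d : Swarm N X => A.est t d) (A.measurable_est t) (hm2.comp measurable_snd)]
    simp_rw [← hstep, h.next_eq]
    rw [h.lintegral_next (by omega) (F := fun p => ∫⁻ y, f y ∂(A.est (t + 1) (A.next t p.1 p.2)))
      ((hfm (t + 1)).comp (A.measurable_next t)), ← lintegral_indicator (h.measurableSet_alive t)]
    · refine lintegral_congr fun ω => ?_
      -- On the degenerate event both the indicator and the predicted measure are zero, so
      -- unbiasedness holds with no correction.
      by_cases h0 : A.scale (t + 1) (D t ω) = 0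
      · simp [A.step_est_eq_zero hw h0, h0]
      · rw [Set.indicator_of_mem (by exact h0), A.lintegral_pi_inst_est_next hN hw h0 hf]
    · intro d z h0
      rw [A.est_eq_zero_of_scale (by rw [scale_next, h0])]
      simp

omit [IsProbabilityMeasure P] in
/-- The weights are almost surely bounded. -/
lemma ae_weight_le (h : A.IsRun P T D Z) (hC : A.BoundedBy T C) {t : ℕ} (ht : t ≤ T) :
    ∀ᵐ ω ∂P, ∀ u ≤ t, ∀ i, (D t ω u i).2 ≤ C := by
  induction t with
  | zero =>
    have hm : MeasurableSet {d : Swarm N X | ∀ u ≤ 0, ∀ i, (d u i).2 ≤ C} := by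
      have e : {d : Swarm N X | ∀ u ≤ 0, ∀ i, (d u i).2 ≤ C} =
          ⋂ i : Fin N, {d : Swarm N X | (d 0 i).2 ≤ C} := by ext; simp
      rw [e]
      exact MeasurableSet.iInter fun i =>
        measurableSet_le (Swarm.measurable_weight 0 i) measurable_const
    have h1 : ∀ᵐ d ∂(P.map (D 0)), d ∈ {d : Swarm N X | ∀ u ≤ 0, ∀ i, (d u i).2 ≤ C} := by
      rw [h.init_law]
      refine (ae_map_iff A.measurable_initSwarm.aemeasurable hm).2 ?_
      have : ∀ᵐ z ∂(Measure.pi fun _ : Fin N => A.ρ₀), ∀ i, A.w₀ (z i) ≤ C :=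
        ae_all_iff.2 fun i => (measurePreserving_eval (fun _ : Fin N => A.ρ₀) i).quasiMeasurePreserving.ae
          hC.w₀_le
      filter_upwards [this] with z hz u _ i
      exact ENNReal.toNNReal_mono ENNReal.coe_ne_top (hz i)
    exact (ae_map_iff (h.measurable_D 0).aemeasurable hm).1 h1
  | succ t ih =>
    filter_upwards [ih (by omega)] with ω hω u hu i
    rw [h.next_eq]
    rcases Nat.lt_or_ge t u with h1 | h1
    · obtain rfl : u = t + 1 := by omega
      rw [A.next_succ]
      exact A.wt_le (hC.w_le (t + 1) (by omega) ht _ _)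
    · rw [A.next_of_le h1]
      exact hω u h1 i

lemma _root_.ParticleSmoothing.AuxiliaryProposal.multTotal_le (hC : A.BoundedBy T C) {t : ℕ}
    (ht : t < T) {d : Swarm N X} (hd : ∀ i, (d t i).2 ≤ C) :
    (N : ℝ≥0)⁻¹ * A.multTotal t d ≤ C * C := by
  rcases eq_or_ne N 0 with rfl | hN
  · simp [multTotal]
  have hN' : (N : ℝ≥0) ≠ 0 := by exact_mod_cast hN
  calc (N : ℝ≥0)⁻¹ * A.multTotal t d ≤ (N : ℝ≥0)⁻¹ * ∑ _i : Fin N, C * C := by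
        unfold multTotal
        gcongr with i
        · exact hd i
        · exact hC.ϑ_le (t + 1) (by omega) (by omega) _
    _ = C * C := by
        rw [Finset.sum_const, Finset.card_univ, Fintype.card_fin, nsmul_eq_mul, ← mul_assoc,
          inv_mul_cancel₀ hN', one_mul]

lemma _root_.ParticleSmoothing.AuxiliaryProposal.scale_le (hC : A.BoundedBy T C) {t : ℕ}
    (ht : t ≤ T) {d : Swarm N X} (hd : ∀ u < t, ∀ i, (d u i).2 ≤ C) :
    A.scale t d ≤ (C * C) ^ t := by
  unfold scale
  calc ∏ u ∈ Finset.range t, (N : ℝ≥0)⁻¹ * A.multTotal u d ≤ ∏ _u ∈ Finset.range t, C * C := by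
        refine Finset.prod_le_prod' fun u hu => ?_
        have := Finset.mem_range.1 hu
        exact A.multTotal_le hC (by omega) (hd u this)
    _ = (C * C) ^ t := by simp

end IsRun

end AuxiliaryProposal

end Runs

/-! ### Law of large numbers with rate for bounded functions. -/

section LawOfLargeNumbers

variable {X : Type*} [MeasurableSpace X] {N : ℕ}

lemma lintegral_enorm_average_sub_le {E : Type*} [MeasurableSpace E] {N : ℕ} (hN : 0 < N)
    (ρ : Measure E) [IsProbabilityMeasure ρ] {φ : E → ℝ} (hφ : Measurable φ) {c : ℝ} (hc0 : 0 ≤ c)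
    (hc : ∀ᵐ x ∂ρ, |φ x| ≤ c) :
    ∫⁻ z, ‖(N : ℝ)⁻¹ * ∑ i, φ (z i) - ∫ x, φ x ∂ρ‖ₑ ∂(Measure.pi fun _ : Fin N => ρ)
      ≤ ENNReal.ofReal (c / √N) := by
  rw [← ofReal_integral_norm_eq_lintegral_enorm]
  · exact ENNReal.ofReal_le_ofReal (integral_abs_average_sub_le hN ρ hφ hc0 hc)
  · refine Integrable.sub (Integrable.const_mul (integrable_finsetSum _ fun i _ => ?_) _)
      (integrable_const _)
    exact (measurePreserving_eval (fun _ : Fin N => ρ) i).integrable_comp_of_integrable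
      (Integrable_of_abs_le hφ.aestronglyMeasurable hc)

namespace AuxiliaryProposal

variable {M : StateSpaceModel X} {A : AuxiliaryProposal M} {Ω : Type*} [MeasurableSpace Ω]
  {P : Measure Ω} [IsProbabilityMeasure P] {T : ℕ}
  {D : ℕ → Ω → Swarm N X} {Z : ℕ → Ω → Fin N → Fin N × X} {C : ℝ≥0}

/-- The contribution of an initial particle to the estimator. -/
def initIncr (A : AuxiliaryProposal M) (f : (ℕ → X) → ℝ) (x : X) : ℝ :=
  ((A.w₀ x).toNNReal : ℝ) * f fun _ => x

lemma measurable_initIncr {f : (ℕ → X) → ℝ} (hf : Measurable f) : Measurable (A.initIncr f) := by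
  have hcm : Measurable fun (x : X) (_ : ℕ) => x := by fun_prop
  exact A.measurable_w₀.ennreal_toNNReal.coe_nnreal_real.mul (hf.comp hcm)

lemma ae_abs_initIncr_le (hC : A.BoundedBy T C) {f : (ℕ → X) → ℝ} {K : ℝ}
    (hK : ∀ y, |f y| ≤ K) : ∀ᵐ x ∂A.ρ₀, |A.initIncr f x| ≤ C * K := by
  filter_upwards [hC.w₀_le] with x hx
  rw [initIncr, abs_mul, NNReal.abs_eq]
  gcongr
  · exact ENNReal.toNNReal_mono ENNReal.coe_ne_top hx
  · exact hK _

lemma integral_initIncr {f : (ℕ → X) → ℝ} (hf : Measurable f) :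
    ∫ x, A.initIncr f x ∂A.ρ₀ = ∫ y, f y ∂(M.pathMeasure 0) := by
  rw [M.integral_pathMeasure_zero hf, ← integral_rnDeriv_smul A.absolutelyContinuous]
  congr 1
  ext x
  simp only [initIncr, w₀, smul_eq_mul, ENNReal.coe_toNNReal_eq_toReal, ENNReal.toReal_mul,
    ENNReal.coe_toReal, mul_assoc]

lemma integral_est_init (z : Fin N → X) {f : (ℕ → X) → ℝ} (hf : Measurable f) {K : ℝ}
    (hK : ∀ y, |f y| ≤ K) :
    ∫ y, f y ∂(A.est 0 (A.initSwarm z)) = (N : ℝ)⁻¹ * ∑ i, A.initIncr f (z i) := by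
  rw [A.integral_est_of_forall_back fun i =>
    Integrable_of_abs_le hf.aestronglyMeasurable (ae_of_all _ hK)]
  simp [scale, initSwarm, StateSpaceModel.back, integral_dirac' _ _ hf.stronglyMeasurable, initIncr]

lemma measurable_integral_est (A : AuxiliaryProposal M) (t : ℕ) {f : (ℕ → X) → ℝ}
    (hf : Measurable f) : Measurable fun d : Swarm N X => ∫ y, f y ∂(A.est t d) :=
  measurable_integral_of_measurable (κ := fun d : Swarm N X => A.est t d) (A.measurable_est t)
    (F := fun p => f p.2) (by fun_prop)

/-- The one-step prediction of a function of the next path. -/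
def predict (M : StateSpaceModel X) (t : ℕ) (f : (ℕ → X) → ℝ) (y : ℕ → X) : ℝ :=
  ∫ x, (M.potential t (y, x) : ℝ) * f (extend t (y, x)) ∂M.ν

lemma measurable_predict (t : ℕ) {f : (ℕ → X) → ℝ} (hf : Measurable f) :
    Measurable (predict M t f) :=
  (StronglyMeasurable.integral_prod_right' (f := fun p : (ℕ → X) × X =>
    (M.potential t p : ℝ) * f (extend t p)) ((M.measurable_potential t).coe_nnreal_real.mul
      (hf.comp (measurable_extend t))).stronglyMeasurable).measurable

lemma predict_eq_Laux (t : ℕ) (f : (ℕ → X) → ℝ) (y : ℕ → X) :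
    predict M t f y = M.Laux 1 t y f := by
  rw [StateSpaceModel.Laux_succ]
  rfl

lemma abs_predict_le (hC : A.BoundedBy T C) {t : ℕ} (ht : t < T) {f : (ℕ → X) → ℝ} {K : ℝ}
    (hK : ∀ y, |f y| ≤ K) (y : ℕ → X) : |predict M t f y| ≤ C * K := by
  rw [predict_eq_Laux]
  simpa using M.abs_Laux_le hC.g_le hK (m := 1) (t := t) (by omega) y

lemma integral_step_eq_predict (hC : A.BoundedBy T C) {t : ℕ} (ht : t < T) {f : (ℕ → X) → ℝ}
    (hf : Measurable f) {K : ℝ} (hK : ∀ y, |f y| ≤ K) (μ : Measure (ℕ → X)) [IsFiniteMeasure μ] :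
    ∫ y, f y ∂(M.step t μ) = ∫ y, predict M t f y ∂μ := by
  have := M.isFiniteMeasure_step (hC.g_le (t + 1) (by omega)) μ
  exact M.integral_step t μ hf (Integrable_of_abs_le hf.aestronglyMeasurable (ae_of_all _ hK))

/-- The constant in the `O(1/√N)` bound for the error of the estimator. -/
def llnConst (C : ℝ≥0) : ℕ → ℝ≥0
  | 0 => C
  | t + 1 => (C * C) ^ (t + 1) * C + C * llnConst C t

/-- The `L¹` law of large numbers for bounded functions, with rate. -/
lemma IsRun.lintegral_enorm_est_sub_le [MeasurableSingletonClass X] (h : A.IsRun P T D Z)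
    (hC : A.BoundedBy T C) (hN : 0 < N) {t : ℕ} (ht : t ≤ T) {f : (ℕ → X) → ℝ} (hf : Measurable f)
    {K : ℝ} (hK0 : 0 ≤ K) (hK : ∀ y, |f y| ≤ K) :
    ∫⁻ ω, ‖∫ y, f y ∂(A.est t (D t ω)) - ∫ y, f y ∂(M.pathMeasure t)‖ₑ ∂P ≤
      ENNReal.ofReal (llnConst C t * K / √N) := by
  induction t generalizing f K with
  | zero =>
    rw [h.lintegral_init (F := fun d => ‖∫ y, f y ∂(A.est 0 d) - ∫ y, f y ∂(M.pathMeasure 0)‖ₑ)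
      ((A.measurable_integral_est 0 hf).sub_const _).enorm]
    simp_rw [integral_est_init _ hf hK, ← integral_initIncr (A := A) hf]
    exact lintegral_enorm_average_sub_le hN _ (measurable_initIncr hf) (by positivity)
      (ae_abs_initIncr_le hC hK)
  | succ t ih =>
    have hw := hC.w_le (t + 1) (by omega) ht
    have hg := hC.g_le (t + 1) ht
    have := M.isFiniteMeasure_pathMeasure hC.g_le (t := t) (by omega)
    have hsqrt : 0 < √(N : ℝ) := by positivity
    have hpm := measurable_predict (M := M) t hf
    have h2 := ih (by omega) hpm (K := C * K) (by positivity) (abs_predict_le hC (by omega) hK)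
    -- The error is the martingale increment, which is conditionally a centred i.i.d. average, plus
    -- the error at time `t` for the predicted function, which is covered by the induction
    -- hypothesis.
    have e1 : ∀ ω, ‖∫ y, f y ∂(A.est (t + 1) (D (t + 1) ω)) - ∫ y, f y ∂(M.pathMeasure (t + 1))‖ₑ ≤
        ‖∫ y, f y ∂(A.est (t + 1) (A.next t (D t ω) (Z t ω))) -
          ∫ y, predict M t f y ∂(A.est t (D t ω))‖ₑ +
        ‖∫ y, predict M t f y ∂(A.est t (D t ω)) - ∫ y, predict M t f y ∂(M.pathMeasure t)‖ₑ := by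
      intro ω
      rw [show M.pathMeasure (t + 1) = M.step t (M.pathMeasure t) from rfl,
        integral_step_eq_predict hC (by omega) hf hK, h.next_eq]
      refine le_trans (le_of_eq ?_) (enorm_add_le _ _)
      congr 1
      ring
    have hF : Measurable fun p : Swarm N X × (Fin N → Fin N × X) =>
        ‖∫ y, f y ∂(A.est (t + 1) (A.next t p.1 p.2)) -
          ∫ y, predict M t f y ∂(A.est t p.1)‖ₑ :=
      (((A.measurable_integral_est (t + 1) hf).comp (A.measurable_next t)).sub
        ((A.measurable_integral_est t hpm).comp measurable_fst)).enorm
    have h1 : ∫⁻ ω, ‖∫ y, f y ∂(A.est (t + 1) (A.next t (D t ω) (Z t ω))) -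
          ∫ y, predict M t f y ∂(A.est t (D t ω))‖ₑ ∂P ≤
        ENNReal.ofReal ((C * C) ^ (t + 1) * (C * K / √N)) := by
      rw [h.lintegral_next (by omega) hF]
      · refine (lintegral_mono_ae (g := fun _ =>
          ENNReal.ofReal ((C * C) ^ (t + 1) * (C * K / √N))) ?_).trans ?_
        · refine (ae_restrict_iff' (h.measurableSet_alive t)).2 ?_
          filter_upwards [h.ae_weight_le hC (t := t) (by omega)] with ω hω h0
          have h0' : A.scale (t + 1) (D t ω) ≠ 0 := h0
          have := A.isProbabilityMeasure_inst (A.multTotal_ne_zero_of_scale h0')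
          have e2 : ∀ z, ‖∫ y, f y ∂(A.est (t + 1) (A.next t (D t ω) z)) -
              ∫ y, predict M t f y ∂(A.est t (D t ω))‖ₑ = (A.scale (t + 1) (D t ω) : ℝ≥0∞) *
              ‖(N : ℝ)⁻¹ * ∑ i, A.incr t (D t ω) f (z i) -
                ∫ z, A.incr t (D t ω) f z ∂(A.inst t (D t ω))‖ₑ := by
            intro z
            rw [A.integral_est_next _ _ _ hf hK, ← integral_step_eq_predict hC (by omega) hf hK,
              ← A.scale_mul_integral_incr hw hg _ hf hK, ← mul_sub, enorm_mul]
            simp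
          simp_rw [e2]
          rw [instKernel_apply, lintegral_const_mul' _ _ ENNReal.coe_ne_top,
            ENNReal.ofReal_mul (by positivity)]
          gcongr
          · have hs := A.scale_le hC ht (d := D t ω) fun u hu => hω u (by omega)
            rw [← ENNReal.ofReal_coe_nnreal]
            exact ENNReal.ofReal_le_ofReal (by exact_mod_cast hs)
          · exact lintegral_enorm_average_sub_le hN _ (A.measurable_incr t _ hf) (by positivity)
              (ae_of_all _ fun z => A.abs_incr_le hw _ hK0 hK z)
        · rw [lintegral_const, Measure.restrict_apply_univ]
          refine (mul_le_mul_right prob_le_one _).trans ?_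
          rw [mul_one]
      · intro d z h0
        dsimp only
        rw [A.est_eq_zero_of_scale (by rw [scale_next, h0]),
          ← integral_step_eq_predict hC (by omega) hf hK, A.step_est_eq_zero hw h0]
        simp
    refine (lintegral_mono e1).trans ?_
    have hm : Measurable fun ω => ‖∫ y, predict M t f y ∂(A.est t (D t ω)) -
        ∫ y, predict M t f y ∂(M.pathMeasure t)‖ₑ :=
      (((A.measurable_integral_est t hpm).comp (h.measurable_D t)).sub_const _).enorm
    rw [lintegral_add_right _ hm]
    refine (add_le_add h1 h2).trans ?_
    rw [← ENNReal.ofReal_add (by positivity) (by positivity)]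
    refine ENNReal.ofReal_le_ofReal (le_of_eq ?_)
    simp only [llnConst]
    push_cast
    ring

end AuxiliaryProposal

end LawOfLargeNumbers

/-! ### Law of large numbers in `L¹(P ⊗ ν)` for integrable functions with a parameter. -/

section ParametricLLN

variable {X : Type*} [MeasurableSpace X] [MeasurableSingletonClass X]

namespace AuxiliaryProposal

variable {M : StateSpaceModel X} {A : AuxiliaryProposal M} {Ω : Type*} [MeasurableSpace Ω]
  {P : Measure Ω} [IsProbabilityMeasure P] {T : ℕ} {C : ℝ≥0}

omit [MeasurableSingletonClass X] in
lemma measurable_integral_est_prod {N : ℕ} {D : Ω → Swarm N X} (hD : Measurable D) (t : ℕ)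
    {F : (ℕ → X) × X → ℝ} (hF : Measurable F) :
    Measurable fun p : Ω × X => ∫ y, F (y, p.2) ∂(A.est t (D p.1)) :=
  measurable_integral_of_measurable (κ := fun p : Ω × X => A.est t (D p.1))
    ((A.measurable_est t).comp (hD.comp measurable_fst)) (F := fun p => F (p.2, p.1.2))
    (hF.comp (by fun_prop))

/-- Comparison of the estimation error of a parametrized function with the one of a bounded
approximation. -/
lemma IsRun.lintegral_lintegral_enorm_le {N : ℕ} {D : ℕ → Ω → Swarm N X}
    {Z : ℕ → Ω → Fin N → Fin N × X} (h : A.IsRun P T D Z)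
    (hC : A.BoundedBy T C) (hN : 0 < N) {t : ℕ} (ht : t ≤ T) {F Fb : (ℕ → X) × X → ℝ}
    (hF : Measurable F) (hFb : Measurable Fb) {K : ℝ} (hK0 : 0 ≤ K) (hK : ∀ p, |Fb p| ≤ K)
    {S : Set X} (hS : MeasurableSet S) (hFbS : ∀ y, ∀ x ∉ S, Fb (y, x) = 0)
    (hFi : Integrable F ((M.pathMeasure t).prod M.ν))
    (hFe : ∀ ω x, Integrable (fun y => F (y, x)) (A.est t (D t ω))) :
    ∫⁻ ω, ∫⁻ x, ‖∫ y, F (y, x) ∂(A.est t (D t ω)) - ∫ y, F (y, x) ∂(M.pathMeasure t)‖ₑ ∂M.ν ∂P ≤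
      2 * ∫⁻ p, ‖F p - Fb p‖ₑ ∂((M.pathMeasure t).prod M.ν) +
        ENNReal.ofReal (llnConst C t * K / √N) * M.ν S := by
  have := M.isFiniteMeasure_pathMeasure hC.g_le ht
  have hdiff : Measurable fun p => ‖F p - Fb p‖ₑ := (hF.sub hFb).enorm
  have hsec : ∀ x, Measurable fun y => Fb (y, x) := fun x => hFb.comp (by fun_prop)
  have hbi : ∀ (μ : Measure (ℕ → X)) [IsFiniteMeasure μ] (x : X),
      Integrable (fun y => Fb (y, x)) μ := fun μ _ x =>
    Integrable_of_abs_le (hsec x).aestronglyMeasurable (ae_of_all _ fun y => hK _)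
  have hkey : ∀ (μ : Measure (ℕ → X)) [IsFiniteMeasure μ] (x : X),
      Integrable (fun y => F (y, x)) μ →
      ‖∫ y, F (y, x) ∂μ - ∫ y, Fb (y, x) ∂μ‖ₑ ≤ ∫⁻ y, ‖F (y, x) - Fb (y, x)‖ₑ ∂μ := by
    intro μ _ x hi
    rw [← integral_sub hi (hbi μ x)]
    exact enorm_integral_le_lintegral_enorm _
  set a : Ω → X → ℝ≥0∞ := fun ω x => ∫⁻ y, ‖F (y, x) - Fb (y, x)‖ₑ ∂(A.est t (D t ω))
  set b : X → ℝ≥0∞ := fun x => ∫⁻ y, ‖F (y, x) - Fb (y, x)‖ₑ ∂(M.pathMeasure t)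
  set c : Ω → X → ℝ≥0∞ := fun ω x =>
    ‖∫ y, Fb (y, x) ∂(A.est t (D t ω)) - ∫ y, Fb (y, x) ∂(M.pathMeasure t)‖ₑ
  have hbm : Measurable b := hdiff.lintegral_prod_left'
  have ham : ∀ ω, Measurable (a ω) := fun ω => hdiff.lintegral_prod_left'
  have hcm2 : Measurable fun x => ∫ y, Fb (y, x) ∂(M.pathMeasure t) :=
    (hFb.comp measurable_swap).stronglyMeasurable.integral_prod_right'.measurable
  have hcm : Measurable (Function.uncurry c) :=
    ((measurable_integral_est_prod (h.measurable_D t) t hFb).sub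
      (hcm2.comp measurable_snd)).enorm
  have htri : ∀ ω, ∀ᵐ x ∂M.ν,
      ‖∫ y, F (y, x) ∂(A.est t (D t ω)) - ∫ y, F (y, x) ∂(M.pathMeasure t)‖ₑ ≤
        a ω x + b x + c ω x := by
    intro ω
    filter_upwards [hFi.prod_left_ae] with x hx
    have e : ∫ y, F (y, x) ∂(A.est t (D t ω)) - ∫ y, F (y, x) ∂(M.pathMeasure t) =
        ((∫ y, F (y, x) ∂(A.est t (D t ω)) - ∫ y, Fb (y, x) ∂(A.est t (D t ω))) -
          (∫ y, F (y, x) ∂(M.pathMeasure t) - ∫ y, Fb (y, x) ∂(M.pathMeasure t))) +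
        (∫ y, Fb (y, x) ∂(A.est t (D t ω)) - ∫ y, Fb (y, x) ∂(M.pathMeasure t)) := by ring
    rw [e]
    refine (enorm_add_le _ _).trans (add_le_add_left (enorm_sub_le.trans ?_) _)
    exact add_le_add (hkey _ x (hFe ω x)) (hkey _ x hx)
  -- Unbiasedness for nonnegative functions makes the expected truncation error under the random
  -- measure equal to the one under `pathMeasure`. This is uniform in `N` and requires no
  -- boundedness.
  have h1 : ∫⁻ ω, ∫⁻ x, a ω x ∂M.ν ∂P =
      ∫⁻ p, ‖F p - Fb p‖ₑ ∂((M.pathMeasure t).prod M.ν) := by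
    have e : ∀ ω, ∫⁻ x, a ω x ∂M.ν =
        ∫⁻ y, ∫⁻ x, ‖F (y, x) - Fb (y, x)‖ₑ ∂M.ν ∂(A.est t (D t ω)) := fun ω =>
      lintegral_lintegral_swap (f := fun x y => ‖F (y, x) - Fb (y, x)‖ₑ)
        (hdiff.comp measurable_swap).aemeasurable
    simp_rw [e]
    rw [h.lintegral_est_eq hC hN.ne' ht hdiff.lintegral_prod_right', lintegral_prod _
      hdiff.aemeasurable]
  have h2 : ∫⁻ x, b x ∂M.ν = ∫⁻ p, ‖F p - Fb p‖ₑ ∂((M.pathMeasure t).prod M.ν) :=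
    (lintegral_prod_symm _ hdiff.aemeasurable).symm
  -- The rate for bounded functions is the same for every section of `Fb`, and sections outside `S`
  -- vanish, so integration over `x` costs only the factor `ν S`.
  have h3 : ∫⁻ ω, ∫⁻ x, c ω x ∂M.ν ∂P ≤ ENNReal.ofReal (llnConst C t * K / √N) * M.ν S := by
    rw [lintegral_lintegral_swap hcm.aemeasurable, ← lintegral_indicator_const hS]
    refine lintegral_mono fun x => ?_
    by_cases hx : x ∈ S
    · rw [Set.indicator_of_mem hx]
      exact h.lintegral_enorm_est_sub_le hC hN ht (hsec x) hK0 fun y => hK _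
    · simp [c, hFbS _ x hx]
  calc _ ≤ ∫⁻ ω, ∫⁻ x, a ω x + b x + c ω x ∂M.ν ∂P :=
        lintegral_mono fun ω => lintegral_mono_ae (htri ω)
    _ = ∫⁻ ω, (∫⁻ x, a ω x ∂M.ν + ∫⁻ x, b x ∂M.ν + ∫⁻ x, c ω x ∂M.ν) ∂P := by
        refine lintegral_congr fun ω => ?_
        rw [lintegral_add_left (f := fun x => a ω x + b x) ((ham ω).add hbm),
          lintegral_add_left (ham ω)]
    _ = ∫⁻ ω, ∫⁻ x, a ω x ∂M.ν ∂P + ∫⁻ x, b x ∂M.ν + ∫⁻ ω, ∫⁻ x, c ω x ∂M.ν ∂P := by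
        have hcm' : Measurable fun ω => ∫⁻ x, c ω x ∂M.ν := hcm.lintegral_prod_right'
        rw [lintegral_add_right _ hcm', lintegral_add_right _ measurable_const]
        simp
    _ ≤ _ := by
        rw [h1, h2, two_mul]
        gcongr

omit [MeasurableSingletonClass X] in
-- Cut `F` off at height `n` and outside the `n`-th set of an exhaustion of `X` by sets of finite
-- `ν`-measure; dominated convergence with dominating function `|F|` gives the approximation.
lemma exists_bounded_approx {E : Type*} [MeasurableSpace E] (μ : Measure E) (ν : Measure X)
    [SFinite μ] [SigmaFinite ν] {F : E × X → ℝ} (hF : Measurable F) (hFi : Integrable F (μ.prod ν))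
    {ε : ℝ≥0∞} (hε : 0 < ε) :
    ∃ (Fb : E × X → ℝ) (K : ℝ) (S : Set X), Measurable Fb ∧ 0 ≤ K ∧ (∀ p, |Fb p| ≤ K) ∧
      MeasurableSet S ∧ ν S < ⊤ ∧ (∀ y, ∀ x ∉ S, Fb (y, x) = 0) ∧
      ∫⁻ p, ‖F p - Fb p‖ₑ ∂(μ.prod ν) < ε := by
  let B : ℕ → Set (E × X) := fun n => {p | |F p| ≤ n ∧ p.2 ∈ spanningSets ν n}
  have hB : ∀ n, MeasurableSet (B n) := fun n =>
    (measurableSet_le hF.abs measurable_const).inter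
      ((measurableSet_spanningSets ν n).preimage measurable_snd)
  have hlim : Tendsto (fun n => ∫⁻ p, ‖F p - (B n).indicator F p‖ₑ ∂(μ.prod ν)) atTop (𝓝 0) := by
    have h0 : ∫⁻ _ : E × X, (0 : ℝ≥0∞) ∂(μ.prod ν) = 0 := lintegral_zero
    rw [← h0]
    refine tendsto_lintegral_of_dominated_convergence (fun p => ‖F p‖ₑ)
      (fun n => (hF.sub (hF.indicator (hB n))).enorm) (fun n => ae_of_all _ fun p => ?_)
      hFi.hasFiniteIntegral.ne (ae_of_all _ fun p => ?_)
    · by_cases hp : p ∈ B n <;> simp [hp]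
    · obtain ⟨n1, hn1⟩ := exists_nat_ge |F p|
      have hmem := mem_spanningSetsIndex ν p.2
      refine tendsto_const_nhds.congr' ?_
      filter_upwards [eventually_ge_atTop (max n1 (spanningSetsIndex ν p.2))] with n hn
      have : p ∈ B n := ⟨hn1.trans (by exact_mod_cast (le_max_left _ _).trans hn),
        monotone_spanningSets ν ((le_max_right _ _).trans hn) hmem⟩
      simp [this]
  obtain ⟨n, hn⟩ := (hlim.eventually_lt_const hε).exists
  refine ⟨(B n).indicator F, n, spanningSets ν n, hF.indicator (hB n), Nat.cast_nonneg n, ?_,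
    measurableSet_spanningSets ν n, measure_spanningSets_lt_top ν n, ?_, hn⟩
  · intro p
    by_cases hp : p ∈ B n
    · rw [Set.indicator_of_mem hp]; exact hp.1
    · simp [hp]
  · intro y x hx
    exact Set.indicator_of_notMem (fun hp => hx hp.2) _

/-- The law of large numbers in `L¹(P ⊗ ν)` for integrable parametrized functions. -/
theorem tendsto_lintegral_lintegral_enorm {D : (N : ℕ) → ℕ → Ω → Swarm N X}
    {Z : (N : ℕ) → ℕ → Ω → Fin N → Fin N × X} (h : ∀ N, A.IsRun P T (D N) (Z N))
    (hC : A.BoundedBy T C) {t : ℕ} (ht : t ≤ T) {F : (ℕ → X) × X → ℝ} (hF : Measurable F)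
    (hFi : Integrable F ((M.pathMeasure t).prod M.ν))
    (hFe : ∀ N ω x, Integrable (fun y => F (y, x)) (A.est t (D N t ω))) :
    Tendsto (fun N => ∫⁻ ω, ∫⁻ x, ‖∫ y, F (y, x) ∂(A.est t (D N t ω)) -
      ∫ y, F (y, x) ∂(M.pathMeasure t)‖ₑ ∂M.ν ∂P) atTop (𝓝 0) := by
  have := M.isFiniteMeasure_pathMeasure hC.g_le ht
  rw [ENNReal.tendsto_nhds_zero]
  intro ε hε
  -- A quarter of `ε`, because the truncation error enters twice: once for the random measure and
  -- once for its limit.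
  have hε4 : 0 < ε / 2 / 2 :=
    ENNReal.div_pos (ENNReal.div_pos hε.ne' (by norm_num)).ne' (by norm_num)
  obtain ⟨Fb, K, S, hFb, hK0, hK, hS, hSfin, hFbS, hlt⟩ :=
    exists_bounded_approx (M.pathMeasure t) M.ν hF hFi hε4
  have hlim : Tendsto (fun N : ℕ => ENNReal.ofReal (llnConst C t * K / √(N : ℝ)) * M.ν S) atTop
      (𝓝 0) := by
    have h1 : Tendsto (fun N : ℕ => ENNReal.ofReal (llnConst C t * K / √(N : ℝ))) atTop (𝓝 0) := by
      rw [← ENNReal.ofReal_zero]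
      refine ENNReal.tendsto_ofReal ?_
      exact tendsto_const_nhds.div_atTop
        (Real.tendsto_sqrt_atTop.comp tendsto_natCast_atTop_atTop)
    simpa using ENNReal.Tendsto.mul_const h1 (Or.inr hSfin.ne)
  have hε2 : 0 < ε / 2 := ENNReal.div_pos hε.ne' (by norm_num)
  filter_upwards [hlim.eventually_le_const hε2, eventually_gt_atTop 0] with N hN hN0
  refine ((h N).lintegral_lintegral_enorm_le hC hN0 ht hF hFb hK0 hK hS hFbS hFi (hFe N)).trans ?_
  calc _ ≤ 2 * (ε / 2 / 2) + ε / 2 := by gcongr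
    _ = ε := by
      rw [ENNReal.mul_div_cancel (by simp) (by simp), ENNReal.add_halves]

end AuxiliaryProposal

end ParametricLLN

/-! ### Characteristic functions of sums with a conditionally almost Gaussian increment. -/

section ConditionalCLT

lemma abs_exp_neg_sub_exp_neg_le {a b : ℝ} (ha : 0 ≤ a) (hb : 0 ≤ b) :
    |Real.exp (-a) - Real.exp (-b)| ≤ |a - b| := by
  wlog hab : a ≤ b generalizing a b
  · rw [abs_sub_comm, abs_sub_comm a]
    exact this hb ha (le_of_not_ge hab)
  rw [abs_of_nonneg (sub_nonneg.2 (Real.exp_le_exp.2 (by linarith))), abs_sub_comm,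
    abs_of_nonneg (sub_nonneg.2 hab)]
  have h1 : Real.exp (-b) = Real.exp (-a) * Real.exp (-(b - a)) := by
    rw [← Real.exp_add]; ring_nf
  have h2 := Real.add_one_le_exp (-(b - a))
  have h3 : Real.exp (-a) ≤ 1 := Real.exp_le_one_iff.2 (by linarith)
  have h4 := Real.exp_pos (-a)
  rw [h1]
  nlinarith

lemma norm_exp_neg_sub_exp_neg_le {u v w : ℝ} (hv : 0 ≤ v) (hw : 0 ≤ w) :
    ‖Complex.exp (-(u ^ 2 * v / 2 : ℝ)) - Complex.exp (-(u ^ 2 * w / 2 : ℝ))‖ ≤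
      u ^ 2 / 2 * |v - w| := by
  have h := abs_exp_neg_sub_exp_neg_le (a := u ^ 2 * v / 2) (b := u ^ 2 * w / 2) (by positivity)
    (by positivity)
  rw [← Complex.ofReal_neg, ← Complex.ofReal_neg, ← Complex.ofReal_exp, ← Complex.ofReal_exp,
    ← Complex.ofReal_sub, Complex.norm_real, Real.norm_eq_abs]
  refine h.trans (le_of_eq ?_)
  have h1 : u ^ 2 * v / 2 - u ^ 2 * w / 2 = u ^ 2 / 2 * (v - w) := by ring
  rw [h1, abs_mul, abs_of_nonneg (by positivity)]

variable {Ω D E : Type*} [MeasurableSpace Ω] [MeasurableSpace D] [MeasurableSpace E]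
  {P : Measure Ω} [IsProbabilityMeasure P] {H : Ω → D} {Z : Ω → E} {κ : Kernel D E}
  [IsFiniteKernel κ] {G : Set D}

/-- Adding an increment `V` which is conditionally almost Gaussian with variance `v` close to `σ2`
multiplies the characteristic function by approximately `exp (-u ^ 2 σ2 / 2)`. -/
lemma IsCondLawOn.enorm_charFun_sub_le (h : IsCondLawOn P H Z κ G) (hH : Measurable H)
    (hZ : Measurable Z) (hG : MeasurableSet G) {U : D → ℝ} (hU : Measurable U) {V : D × E → ℝ}
    (hV : Measurable V) {v : D → ℝ} (hv : ∀ d, 0 ≤ v d) {σ2 : ℝ} (hσ : 0 ≤ σ2) {ε : ℝ} (hε : 0 ≤ ε)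
    {u : ℝ} (h1 : ∀ᵐ ω ∂P, H ω ∈ G → ‖∫ z, Complex.exp ((u * V (H ω, z) : ℝ) * Complex.I) ∂κ (H ω) -
      Complex.exp (-(u ^ 2 * v (H ω) / 2 : ℝ))‖ ≤ ε)
    (hκ : ∀ d ∈ G, κ d Set.univ = 1)
    (h2 : ∀ ω, H ω ∉ G → V (H ω, Z ω) = 0 ∧ v (H ω) = 0) :
    ‖∫ ω, Complex.exp ((u * (U (H ω) + V (H ω, Z ω)) : ℝ) * Complex.I) ∂P -
      Complex.exp (-(u ^ 2 * σ2 / 2 : ℝ)) * ∫ ω, Complex.exp ((u * U (H ω) : ℝ) * Complex.I) ∂P‖ₑ ≤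
      ENNReal.ofReal ε + ENNReal.ofReal (u ^ 2 / 2) * ∫⁻ ω, ‖v (H ω) - σ2‖ₑ ∂P := by
  set c := Complex.exp (-(u ^ 2 * σ2 / 2 : ℝ)) with hc
  have hc1 : ‖c‖ ≤ 1 := by
    rw [hc, ← Complex.ofReal_neg, Complex.norm_exp_ofReal, Real.exp_le_one_iff]
    have : 0 ≤ u ^ 2 * σ2 := by positivity
    linarith
  -- Conditionally on `H` the first factor is a constant of modulus one, so integrating out `Z`
  -- leaves only the distance between the conditional characteristic function of `V` and `c`.
  set F : D × E → ℂ := fun p => Complex.exp ((u * U p.1 : ℝ) * Complex.I) *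
    (Complex.exp ((u * V p : ℝ) * Complex.I) - c) with hF
  have hFm : Measurable F := by
    have h0 : Measurable fun p : D × E => U p.1 := hU.comp measurable_fst
    simp only [hF]
    fun_prop
  have hFb : ∀ p, ‖F p‖ ≤ 2 := fun p => by
    rw [hF, norm_mul, Complex.norm_exp_ofReal_mul_I, one_mul]
    refine (norm_sub_le _ _).trans ?_
    rw [Complex.norm_exp_ofReal_mul_I]; linarith
  have hexp : ∀ f : Ω → ℝ, Measurable f →
      Integrable (fun ω => Complex.exp ((f ω : ℝ) * Complex.I)) P := fun f hf =>
    Integrable.of_bound (by fun_prop) 1 (ae_of_all _ fun ω => (Complex.norm_exp_ofReal_mul_I _).le)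
  have hHZ : Measurable fun ω => V (H ω, Z ω) := hV.comp (hH.prodMk hZ)
  have hUH : Measurable fun ω => U (H ω) := hU.comp hH
  have e1 : ∫ ω, Complex.exp ((u * (U (H ω) + V (H ω, Z ω)) : ℝ) * Complex.I) ∂P -
      c * ∫ ω, Complex.exp ((u * U (H ω) : ℝ) * Complex.I) ∂P = ∫ ω, F (H ω, Z ω) ∂P := by
    rw [← integral_const_mul, ← integral_sub (hexp _ (by fun_prop)) ((hexp _ (by fun_prop)).const_mul c)]
    refine integral_congr_ae (ae_of_all _ fun ω => ?_)
    simp only [hF]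
    have e0 : Complex.exp ((u * (U (H ω) + V (H ω, Z ω)) : ℝ) * Complex.I) =
        Complex.exp ((u * U (H ω) : ℝ) * Complex.I) *
          Complex.exp ((u * V (H ω, Z ω) : ℝ) * Complex.I) := by
      rw [← Complex.exp_add]
      congr 1
      push_cast
      ring
    rw [e0]
    ring
  have hFi : Integrable (fun ω => F (H ω, Z ω)) P :=
    Integrable.of_bound (hFm.comp (hH.prodMk hZ)).aestronglyMeasurable 2 (ae_of_all _ fun ω => hFb _)
  have hGm : MeasurableSet (H ⁻¹' G) := hH hG
  set R : Ω → ℝ≥0∞ := fun ω => ENNReal.ofReal ε + ENNReal.ofReal (u ^ 2 / 2) * ‖v (H ω) - σ2‖ₑ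
  have hR : ∀ w : ℝ, 0 ≤ w → ∀ z : ℂ, ‖z - Complex.exp (-(u ^ 2 * w / 2 : ℝ))‖ ≤ ε →
      ‖z - c‖ₑ ≤ ENNReal.ofReal ε + ENNReal.ofReal (u ^ 2 / 2) * ‖w - σ2‖ₑ := by
    intro w hw z hz
    rw [Real.enorm_eq_ofReal_abs, ← ENNReal.ofReal_mul (by positivity),
      ← ENNReal.ofReal_add hε (by positivity), ← ofReal_norm]
    refine ENNReal.ofReal_le_ofReal ?_
    have := norm_exp_neg_sub_exp_neg_le (u := u) hw hσ
    calc ‖z - c‖ ≤ _ := norm_sub_le_norm_sub_add_norm_sub _ _ _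
      _ ≤ _ := add_le_add hz this
  have hA : ‖∫ ω in H ⁻¹' G, F (H ω, Z ω) ∂P‖ₑ ≤ ∫⁻ ω in H ⁻¹' G, R ω ∂P := by
    rw [h.integral hH hZ hFm hFb]
    refine (enorm_integral_le_lintegral_enorm _).trans (lintegral_mono_ae ?_)
    refine (ae_restrict_iff' hGm).2 ?_
    filter_upwards [h1] with ω hω hmem
    have : IsProbabilityMeasure (κ (H ω)) := ⟨hκ _ hmem⟩
    have e2 : ∫ z, F (H ω, z) ∂κ (H ω) = Complex.exp ((u * U (H ω) : ℝ) * Complex.I) *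
        (∫ z, Complex.exp ((u * V (H ω, z) : ℝ) * Complex.I) ∂κ (H ω) - c) := by
      simp only [hF]
      rw [integral_const_mul, integral_sub _ (integrable_const _)]
      · simp
      · have hVω : Measurable fun z => V (H ω, z) := hV.comp measurable_prodMk_left
        exact Integrable.of_bound (((Complex.measurable_ofReal.comp
          (hVω.const_mul u)).mul_const Complex.I).cexp.aestronglyMeasurable) 1
          (ae_of_all _ fun z => (Complex.norm_exp_ofReal_mul_I _).le)
    rw [e2, enorm_mul]
    have e3 : ‖Complex.exp ((u * U (H ω) : ℝ) * Complex.I)‖ₑ = 1 := by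
      rw [← ofReal_norm, Complex.norm_exp_ofReal_mul_I, ENNReal.ofReal_one]
    rw [e3, one_mul]
    exact hR _ (hv _) _ (hω hmem)
  -- Off `G` nothing is known about the law of `Z`, but `V = 0` and `v = 0` there, so `hR` applies
  -- with `w = 0` and `z = 1`, where the Gaussian approximation is exact.
  have hB : ‖∫ ω in (H ⁻¹' G)ᶜ, F (H ω, Z ω) ∂P‖ₑ ≤ ∫⁻ ω in (H ⁻¹' G)ᶜ, R ω ∂P := by
    refine (enorm_integral_le_lintegral_enorm _).trans (lintegral_mono_ae ?_)
    refine (ae_restrict_iff' hGm.compl).2 (ae_of_all _ fun ω hω => ?_)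
    obtain ⟨h3, h4⟩ := h2 ω hω
    simp only [hF]
    rw [enorm_mul]
    have e3 : ‖Complex.exp ((u * U (H ω) : ℝ) * Complex.I)‖ₑ = 1 := by
      rw [← ofReal_norm, Complex.norm_exp_ofReal_mul_I, ENNReal.ofReal_one]
    rw [e3, one_mul]
    refine hR _ (hv _) _ ?_
    rw [h3, h4]
    simpa using hε
  rw [e1, ← integral_add_compl hGm hFi]
  refine (enorm_add_le _ _).trans ((add_le_add hA hB).trans ?_)
  rw [lintegral_add_compl _ hGm]
  by_cases hm : AEMeasurable (fun ω => ‖v (H ω) - σ2‖ₑ) P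
  · simp only [R]
    rw [lintegral_add_left measurable_const, lintegral_const_mul'' _ hm]
    simp
  · simp only [R]
    rw [lintegral_add_left measurable_const, lintegral_const_mul' _ _ ENNReal.ofReal_ne_top]
    simp

/-- The recursion for the limits of the characteristic functions. -/
lemma tendsto_charFun_of_enorm_le {Φ Φ' : ℕ → ℂ} {r : ℕ → ℝ≥0∞} {u γ σ2 : ℝ}
    (hΦ : Tendsto Φ atTop (𝓝 (Complex.exp (-(u ^ 2 * γ / 2 : ℝ)))))
    (hle : ∀ᶠ n in atTop, ‖Φ' n - Complex.exp (-(u ^ 2 * σ2 / 2 : ℝ)) * Φ n‖ₑ ≤ r n)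
    (hr : Tendsto r atTop (𝓝 0)) :
    Tendsto Φ' atTop (𝓝 (Complex.exp (-(u ^ 2 * (γ + σ2) / 2 : ℝ)))) := by
  have h1 : Tendsto (fun n => Φ' n - Complex.exp (-(u ^ 2 * σ2 / 2 : ℝ)) * Φ n) atTop (𝓝 0) := by
    rw [tendsto_zero_iff_norm_tendsto_zero]
    have h2 : Tendsto (fun n => ‖Φ' n - Complex.exp (-(u ^ 2 * σ2 / 2 : ℝ)) * Φ n‖ₑ) atTop (𝓝 0) :=
      tendsto_of_tendsto_of_tendsto_of_le_of_le' tendsto_const_nhds hr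
        (Eventually.of_forall fun _ => zero_le) hle
    have h3 := (ENNReal.tendsto_toReal ENNReal.zero_ne_top).comp h2
    simpa [Function.comp_def] using h3
  have h4 := h1.add (hΦ.const_mul (Complex.exp (-(u ^ 2 * σ2 / 2 : ℝ))))
  simp only [sub_add_cancel, zero_add] at h4
  convert h4 using 2
  rw [← Complex.exp_add]
  congr 1
  push_cast
  ring

end ConditionalCLT

/-! ### Convergence of the conditional variances. -/

section ConditionalVariance

variable {X : Type*} [MeasurableSpace X]

namespace StateSpaceModel

variable (M : StateSpaceModel X)

/-- The density `x ↦ ∫ q(y_t, x) μ(dy)` of the predicted state. -/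
def predDensity (t : ℕ) (μ : Measure (ℕ → X)) (x : X) : ℝ := ∫ y, (M.q (y t) x : ℝ) ∂μ

/-- The integral of `f` against the joint density of the past path and the predicted state. -/
def jointDensity (t : ℕ) (f : (ℕ → X) → ℝ) (μ : Measure (ℕ → X)) (x : X) : ℝ :=
  ∫ y, (M.q (y t) x : ℝ) * f (extend t (y, x)) ∂μ

/-- The conditional mean of `f` given that the state at time `t + 1` is `x`. -/
def condMean (t : ℕ) (f : (ℕ → X) → ℝ) (μ : Measure (ℕ → X)) (x : X) : ℝ :=
  M.jointDensity t f μ x / M.predDensity t μ x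

lemma measurable_q_prod (t : ℕ) : Measurable fun p : (ℕ → X) × X => (M.q (p.1 t) p.2 : ℝ) :=
  (M.measurable_q_comp (by fun_prop) (by fun_prop)).coe_nnreal_real

lemma integrable_q_prod (t : ℕ) (μ : Measure (ℕ → X)) [IsFiniteMeasure μ] :
    Integrable (fun p : (ℕ → X) × X => (M.q (p.1 t) p.2 : ℝ)) (μ.prod M.ν) := by
  refine ⟨(M.measurable_q_prod t).aestronglyMeasurable, ?_⟩
  rw [hasFiniteIntegral_iff_enorm, lintegral_prod _ (M.measurable_q_prod t).enorm.aemeasurable]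
  simp [M.lintegral_q]

lemma integrable_q_mul_prod (t : ℕ) (μ : Measure (ℕ → X)) [IsFiniteMeasure μ]
    {F : (ℕ → X) × X → ℝ} (hF : Measurable F) {K : ℝ}
    (hK : ∀ p, |F p| ≤ K * M.q (p.1 t) p.2) : Integrable F (μ.prod M.ν) :=
  ((M.integrable_q_prod t μ).const_mul K).mono' hF.aestronglyMeasurable (ae_of_all _ hK)

lemma measurable_jointDensity_integrand (t : ℕ) {f : (ℕ → X) → ℝ} (hf : Measurable f) :
    Measurable fun p : (ℕ → X) × X => (M.q (p.1 t) p.2 : ℝ) * f (extend t p) :=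
  (M.measurable_q_prod t).mul (hf.comp (measurable_extend t))

lemma abs_jointDensity_integrand_le (t : ℕ) {f : (ℕ → X) → ℝ} {K : ℝ} (hK : ∀ y, |f y| ≤ K)
    (p : (ℕ → X) × X) : |(M.q (p.1 t) p.2 : ℝ) * f (extend t p)| ≤ K * M.q (p.1 t) p.2 := by
  rw [abs_mul, NNReal.abs_eq, mul_comm]
  gcongr
  exact hK _

/-- The numerator is dominated by `K` times the denominator. If the section of `q` is not
integrable, the denominator takes the default value zero and so does the quotient; hence the bound
holds for every `x`. -/
lemma abs_condMean_le (t : ℕ) {f : (ℕ → X) → ℝ} {K : ℝ} (hK0 : 0 ≤ K)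
    (hK : ∀ y, |f y| ≤ K) (μ : Measure (ℕ → X)) (x : X) : |M.condMean t f μ x| ≤ K := by
  by_cases hi : Integrable (fun y : ℕ → X => (M.q (y t) x : ℝ)) μ
  · have h0 : 0 ≤ M.predDensity t μ x := integral_nonneg fun _ => NNReal.coe_nonneg _
    have h1 : |M.jointDensity t f μ x| ≤ K * M.predDensity t μ x := by
      rw [jointDensity, predDensity, ← integral_const_mul, ← Real.norm_eq_abs]
      exact norm_integral_le_of_norm_le (hi.const_mul K)
        (ae_of_all _ fun y => M.abs_jointDensity_integrand_le t hK (y, x))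
    rw [condMean, abs_div, abs_of_nonneg h0]
    exact div_le_of_le_mul₀ h0 hK0 h1
  · rw [condMean, predDensity, integral_undef hi]
    simpa using hK0

lemma predDensity_mul_condMean (t : ℕ) {f : (ℕ → X) → ℝ} {K : ℝ}
    (hK : ∀ y, |f y| ≤ K) {μ : Measure (ℕ → X)} {x : X}
    (hi : Integrable (fun y : ℕ → X => (M.q (y t) x : ℝ)) μ) :
    M.predDensity t μ x * M.condMean t f μ x = M.jointDensity t f μ x := by
  refine mul_div_cancel_of_imp' fun h0 => ?_
  have h1 : |M.jointDensity t f μ x| ≤ K * M.predDensity t μ x := by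
    rw [jointDensity, predDensity, ← integral_const_mul, ← Real.norm_eq_abs]
    exact norm_integral_le_of_norm_le (hi.const_mul K)
      (ae_of_all _ fun y => M.abs_jointDensity_integrand_le t hK (y, x))
  rw [h0, mul_zero] at h1
  exact abs_nonpos_iff.1 h1

lemma measurable_condMean (t : ℕ) {f : (ℕ → X) → ℝ} (hf : Measurable f) (μ : Measure (ℕ → X))
    [SFinite μ] : Measurable (M.condMean t f μ) := by
  refine Measurable.div ?_ ?_
  · exact ((M.measurable_jointDensity_integrand t hf).comp
      measurable_swap).stronglyMeasurable.integral_prod_right'.measurable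
  · exact ((M.measurable_q_prod t).comp
      measurable_swap).stronglyMeasurable.integral_prod_right'.measurable

end StateSpaceModel

namespace AuxiliaryProposal

variable {M : StateSpaceModel X} (A : AuxiliaryProposal M)

/-- The integrated product of the unnormalized transition density and the importance weight. -/
def sqDensity (t : ℕ) (μ : Measure (ℕ → X)) (x : X) : ℝ :=
  ∫ y, ((M.potential t (y, x) * A.wt (t + 1) (y t) x : ℝ≥0) : ℝ) ∂μ

/-- The contribution of step `t + 1` to the asymptotic variance of the estimator of `f`. -/
def stepVar (t : ℕ) (f : (ℕ → X) → ℝ) : ℝ :=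
  (∫ y, (A.ϑ (t + 1) (y t) : ℝ) ∂(M.pathMeasure t)) *
    ∫ x, A.sqDensity t (M.pathMeasure t) x * M.condMean t f (M.pathMeasure t) x ^ 2 ∂M.ν

/-- The conditional variance of a particle contribution in step `t + 1`. -/
def condVar {N : ℕ} (t : ℕ) (d : Swarm N X) (f : (ℕ → X) → ℝ) : ℝ :=
  (A.scale (t + 1) d : ℝ) ^ 2 *
    ∫ z, (A.incr t d f z - ∫ z', A.incr t d f z' ∂(A.inst t d)) ^ 2 ∂(A.inst t d)

lemma stepVar_nonneg (t : ℕ) (f : (ℕ → X) → ℝ) : 0 ≤ A.stepVar t f :=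
  mul_nonneg (integral_nonneg fun _ => NNReal.coe_nonneg _) (integral_nonneg fun _ =>
    mul_nonneg (integral_nonneg fun _ => NNReal.coe_nonneg _) (sq_nonneg _))

lemma condVar_nonneg {N : ℕ} (t : ℕ) (d : Swarm N X) (f : (ℕ → X) → ℝ) : 0 ≤ A.condVar t d f :=
  mul_nonneg (sq_nonneg _) (integral_nonneg fun _ => sq_nonneg _)

lemma measurable_sqDensity_integrand (t : ℕ) : Measurable fun p : (ℕ → X) × X =>
    ((M.potential t p * A.wt (t + 1) (p.1 t) p.2 : ℝ≥0) : ℝ) :=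
  (Measurable.mul (by fun_prop)
    (A.measurable_wt_comp _ (by fun_prop) (by fun_prop))).coe_nnreal_real

variable {A} {T : ℕ} {C : ℝ≥0}

lemma abs_sqDensity_integrand_le (hC : A.BoundedBy T C) {t : ℕ} (ht : t < T) (p : (ℕ → X) × X) :
    |((M.potential t p * A.wt (t + 1) (p.1 t) p.2 : ℝ≥0) : ℝ)| ≤ (C * C : ℝ≥0) * M.q (p.1 t) p.2 := by
  rw [NNReal.abs_eq, ← NNReal.coe_mul, NNReal.coe_le_coe, StateSpaceModel.potential]
  have h1 := hC.g_le (t + 1) ht p.2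
  have h2 := A.wt_le (hC.w_le (t + 1) (by omega) ht (p.1 t) p.2)
  calc M.q (p.1 t) p.2 * M.g (t + 1) p.2 * A.wt (t + 1) (p.1 t) p.2
      ≤ M.q (p.1 t) p.2 * C * C := by gcongr
    _ = _ := by ring

variable [MeasurableSingletonClass X] {N : ℕ}

/-- The next `scale` is itself an `est`-integral of a bounded function, so the prefactor of the
conditional variance also obeys the law of large numbers. Its limit is the factor with `ϑ` in
`stepVar`. -/
lemma coe_scale_succ (t : ℕ) (d : Swarm N X) :
    (A.scale (t + 1) d : ℝ) = ∫ y, (A.ϑ (t + 1) (y t) : ℝ) ∂(A.est t d) := by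
  rw [A.integral_est_state t d fun x => (A.ϑ (t + 1) x : ℝ), scale_succ]
  push_cast
  rw [multTotal, mul_assoc]
  push_cast
  rfl

/-- Second moment minus squared mean, both multiplied by `scale²`. In the second moment one factor
`scale` is absorbed by the change of measure and one remains; in the squared mean both are absorbed.
-/
lemma condVar_eq (hC : A.BoundedBy T C) {t : ℕ} (ht : t < T) (d : Swarm N X)
    {f : (ℕ → X) → ℝ} (hf : Measurable f) {K : ℝ} (hK0 : 0 ≤ K) (hK : ∀ y, |f y| ≤ K) :
    A.condVar t d f = (A.scale (t + 1) d : ℝ) *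
      (∫ x, A.sqDensity t (A.est t d) x * (∫ y, f y ∂(M.backNext t d x)) ^ 2 ∂M.ν) -
      (∫ y, predict M t f y ∂(A.est t d)) ^ 2 := by
  have hw := hC.w_le (t + 1) (by omega) ht
  have hg := hC.g_le (t + 1) ht
  have e1 := A.scale_mul_integral_incr_sq hw d hf
  have e2 := A.scale_mul_integral_incr hw hg d hf hK
  rw [integral_step_eq_predict hC ht hf hK] at e2
  unfold sqDensity
  rw [← e1, ← e2, condVar]
  by_cases h0 : A.scale (t + 1) d = 0
  · simp [h0]
  have := A.isProbabilityMeasure_inst (A.multTotal_ne_zero_of_scale h0)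
  have hm := A.measurable_incr t d hf
  have hi : Integrable (A.incr t d f) (A.inst t d) :=
    Integrable_of_abs_le hm.aestronglyMeasurable (ae_of_all _ fun z => A.abs_incr_le hw d hK0 hK z)
  have hi2 : Integrable (fun z => A.incr t d f z ^ 2) (A.inst t d) := by
    refine Integrable_of_abs_le (c := (C * K) ^ 2) (hm.pow_const 2).aestronglyMeasurable
      (ae_of_all _ fun z => ?_)
    rw [abs_pow]
    exact pow_le_pow_left₀ (abs_nonneg _) (A.abs_incr_le hw d hK0 hK z) 2
  set m := ∫ z, A.incr t d f z ∂(A.inst t d)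
  have e3 : ∀ z, (A.incr t d f z - m) ^ 2 = A.incr t d f z ^ 2 - (2 * m * A.incr t d f z - m ^ 2) :=
    fun z => by ring
  simp_rw [e3]
  rw [integral_sub (g := fun z => 2 * m * A.incr t d f z - m ^ 2) hi2
      ((hi.const_mul _).sub (integrable_const _)),
    integral_sub (hi.const_mul _) (integrable_const _), integral_const_mul]
  simp only [integral_const, probReal_univ, smul_eq_mul, one_mul]
  ring

/-- `abs_mul_sq_sub_le` with `a` the predicted density, `b` the integrated weight density and `c`
the joint density. The backward mean for `est` and the conditional mean for `μ` both solve `a G =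
c`, and `b ≤ C² a` holds because `g` and the weights are bounded. -/
lemma abs_sqDensity_mul_sub_le (hC : A.BoundedBy T C) {t : ℕ} (ht : t < T) (d : Swarm N X)
    {f : (ℕ → X) → ℝ} (hf : Measurable f) {K : ℝ} (hK0 : 0 ≤ K) (hK : ∀ y, |f y| ≤ K)
    {μ : Measure (ℕ → X)} {x : X} (hi : Integrable (fun y : ℕ → X => (M.q (y t) x : ℝ)) μ) :
    |A.sqDensity t (A.est t d) x * (∫ y, f y ∂(M.backNext t d x)) ^ 2 -
      A.sqDensity t μ x * M.condMean t f μ x ^ 2| ≤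
      K ^ 2 * |A.sqDensity t (A.est t d) x - A.sqDensity t μ x| +
      2 * K ^ 2 * (C * C) * |M.predDensity t (A.est t d) x - M.predDensity t μ x| +
      2 * K * (C * C) * |M.jointDensity t f (A.est t d) x - M.jointDensity t f μ x| := by
  refine abs_mul_sq_sub_le (integral_nonneg fun _ => NNReal.coe_nonneg _) hK0 (by positivity)
    (M.abs_condMean_le t hK0 hK μ x) (M.abs_integral_backNext_le t d x hK0 hK) ?_
    (M.predDensity_mul_condMean t hK hi) (A.integral_est_mul_integral_backNext t d x hf hK)
    (integral_nonneg fun _ => NNReal.coe_nonneg _)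
  rw [sqDensity, StateSpaceModel.predDensity, ← integral_const_mul]
  refine integral_mono (A.integrable_est_state t d fun x' =>
    ((M.q x' x * M.g (t + 1) x * A.wt (t + 1) x' x : ℝ≥0) : ℝ))
    ((A.integrable_est_state t d fun x' => (M.q x' x : ℝ)).const_mul _) fun y => ?_
  exact (le_abs_self _).trans (by simpa using abs_sqDensity_integrand_le hC ht (y, x))

omit [MeasurableSingletonClass X] in
lemma integrable_sqDensity_mul (hC : A.BoundedBy T C) {t : ℕ} (ht : t < T)
    (μ : Measure (ℕ → X)) [IsFiniteMeasure μ] {G : X → ℝ} (hG : Measurable G) {K : ℝ}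
    (hGK : ∀ x, |G x| ≤ K) : Integrable (fun x => A.sqDensity t μ x * G x ^ 2) M.ν := by
  have h1 : Integrable (A.sqDensity t μ) M.ν :=
    (M.integrable_q_mul_prod t μ (A.measurable_sqDensity_integrand t)
      (abs_sqDensity_integrand_le hC ht)).integral_prod_right
  refine h1.mul_bdd (c := K ^ 2) (hG.pow_const 2).aestronglyMeasurable (ae_of_all _ fun x => ?_)
  rw [norm_pow]
  exact pow_le_pow_left₀ (norm_nonneg _) (hGK x) 2

/-- The difference between two ratio functionals, integrated over the predicted state. -/
lemma enorm_integral_sqDensity_sub_le (hC : A.BoundedBy T C) {t : ℕ} (ht : t < T) (d : Swarm N X)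
    {f : (ℕ → X) → ℝ} (hf : Measurable f) {K : ℝ} (hK0 : 0 ≤ K) (hK : ∀ y, |f y| ≤ K)
    (μ : Measure (ℕ → X)) [IsFiniteMeasure μ] :
    ‖∫ x, A.sqDensity t (A.est t d) x * (∫ y, f y ∂(M.backNext t d x)) ^ 2 ∂M.ν -
      ∫ x, A.sqDensity t μ x * M.condMean t f μ x ^ 2 ∂M.ν‖ₑ ≤
      ENNReal.ofReal (K ^ 2) * ∫⁻ x, ‖A.sqDensity t (A.est t d) x - A.sqDensity t μ x‖ₑ ∂M.ν +
      ENNReal.ofReal (2 * K ^ 2 * (C * C)) *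
        ∫⁻ x, ‖M.predDensity t (A.est t d) x - M.predDensity t μ x‖ₑ ∂M.ν +
      ENNReal.ofReal (2 * K * (C * C)) *
        ∫⁻ x, ‖M.jointDensity t f (A.est t d) x - M.jointDensity t f μ x‖ₑ ∂M.ν := by
  have hGm : Measurable fun x => ∫ y, f y ∂(M.backNext t d x) :=
    (M.measurable_integral_backNext (N := N) t hf).comp (f := fun x => (d, x)) (by fun_prop)
  rw [← integral_sub (integrable_sqDensity_mul hC ht _ hGm fun x =>
    M.abs_integral_backNext_le t d x hK0 hK) (integrable_sqDensity_mul hC ht μ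
    (M.measurable_condMean t hf μ) fun x => M.abs_condMean_le t hK0 hK μ x)]
  refine (enorm_integral_le_lintegral_enorm _).trans ?_
  have hmeas : ∀ {F : (ℕ → X) × X → ℝ}, Measurable F → ∀ (μ : Measure (ℕ → X)) [SFinite μ],
      Measurable fun x => ∫ y, F (y, x) ∂μ := fun hF μ _ =>
    (hF.comp measurable_swap).stronglyMeasurable.integral_prod_right'.measurable
  have m₁ : Measurable fun x => ‖A.sqDensity t (A.est t d) x - A.sqDensity t μ x‖ₑ :=
    ((hmeas (A.measurable_sqDensity_integrand t) _).sub
      (hmeas (A.measurable_sqDensity_integrand t) μ)).enorm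
  have m₂ : Measurable fun x => ‖M.predDensity t (A.est t d) x - M.predDensity t μ x‖ₑ :=
    ((hmeas (M.measurable_q_prod t) _).sub (hmeas (M.measurable_q_prod t) μ)).enorm
  have m₃ : Measurable fun x =>
      ‖M.jointDensity t f (A.est t d) x - M.jointDensity t f μ x‖ₑ :=
    ((hmeas (M.measurable_jointDensity_integrand t hf) _).sub
      (hmeas (M.measurable_jointDensity_integrand t hf) μ)).enorm
  have m₁₂ := (m₁.const_mul (ENNReal.ofReal (K ^ 2))).add
    (m₂.const_mul (ENNReal.ofReal (2 * K ^ 2 * (C * C))))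
  simp only [Pi.add_def] at m₁₂
  rw [← lintegral_const_mul _ m₁, ← lintegral_const_mul _ m₂, ← lintegral_const_mul _ m₃,
    ← lintegral_add_left (m₁.const_mul _), ← lintegral_add_left m₁₂]
  refine lintegral_mono_ae ?_
  filter_upwards [(M.integrable_q_prod t μ).prod_left_ae] with x hx
  simp only [Real.enorm_eq_ofReal_abs]
  rw [← ENNReal.ofReal_mul (by positivity), ← ENNReal.ofReal_mul (by positivity),
    ← ENNReal.ofReal_mul (by positivity), ← ENNReal.ofReal_add (by positivity) (by positivity),
    ← ENNReal.ofReal_add (by positivity) (by positivity)]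
  exact ENNReal.ofReal_le_ofReal (abs_sqDensity_mul_sub_le hC ht d hf hK0 hK hx)

/-- The limit contains no squared mean because the predicted function is centred under
`pathMeasure`. The three groups of terms come from the second-moment integral (times a bounded
`scale`), from `scale` itself (times the limit `S`), and from the mean (times its own bound). -/
lemma enorm_condVar_sub_le (hC : A.BoundedBy T C) {t : ℕ} (ht : t < T) {d : Swarm N X}
    (hd : ∀ u ≤ t, ∀ i, (d u i).2 ≤ C) {f : (ℕ → X) → ℝ} (hf : Measurable f) {K : ℝ}
    (hK0 : 0 ≤ K) (hK : ∀ y, |f y| ≤ K) (h0 : ∫ y, predict M t f y ∂(M.pathMeasure t) = 0)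
    {S : ℝ} (hS : S = ∫ x, A.sqDensity t (M.pathMeasure t) x *
      M.condMean t f (M.pathMeasure t) x ^ 2 ∂M.ν) {B : ℝ} (hB : B = ((C : ℝ) * C) ^ (t + 1)) :
    ‖A.condVar t d f - A.stepVar t f‖ₑ ≤
      ENNReal.ofReal B * (ENNReal.ofReal (K ^ 2) * ∫⁻ x, ‖A.sqDensity t (A.est t d) x -
        A.sqDensity t (M.pathMeasure t) x‖ₑ ∂M.ν +
      ENNReal.ofReal (2 * K ^ 2 * (C * C)) *
        ∫⁻ x, ‖M.predDensity t (A.est t d) x - M.predDensity t (M.pathMeasure t) x‖ₑ ∂M.ν +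
      ENNReal.ofReal (2 * K * (C * C)) * ∫⁻ x, ‖M.jointDensity t f (A.est t d) x -
        M.jointDensity t f (M.pathMeasure t) x‖ₑ ∂M.ν) +
      ENNReal.ofReal |S| * ‖∫ y, (A.ϑ (t + 1) (y t) : ℝ) ∂(A.est t d) -
        ∫ y, (A.ϑ (t + 1) (y t) : ℝ) ∂(M.pathMeasure t)‖ₑ +
      ENNReal.ofReal (B * (C * K)) * ‖∫ y, predict M t f y ∂(A.est t d) -
        ∫ y, predict M t f y ∂(M.pathMeasure t)‖ₑ := by
  have hfin := M.isFiniteMeasure_pathMeasure hC.g_le (t := t) (by omega)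
  have hw := hC.w_le (t + 1) (by omega) ht
  have hg := hC.g_le (t + 1) ht
  have hscale : (A.scale (t + 1) d : ℝ) ≤ B := by
    have := A.scale_le hC ht (d := d) fun u hu => hd u (by omega)
    rw [hB]
    exact_mod_cast this
  have hdiff := enorm_integral_sqDensity_sub_le hC ht d hf hK0 hK (M.pathMeasure t)
  rw [← hS] at hdiff
  have hpred : ‖∫ y, predict M t f y ∂(A.est t d)‖ₑ ≤ ENNReal.ofReal (B * (C * K)) := by
    rw [← integral_step_eq_predict hC ht hf hK, ← A.scale_mul_integral_incr hw hg d hf hK,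
      Real.enorm_eq_ofReal_abs]
    refine ENNReal.ofReal_le_ofReal ?_
    rw [abs_mul, NNReal.abs_eq]
    refine mul_le_mul hscale ?_ (abs_nonneg _) (by rw [hB]; positivity)
    exact abs_integral_le_of_univ_le_one (A.inst_univ_le t d) (by positivity)
      fun z => A.abs_incr_le hw d hK0 hK z
  have hsplit : A.condVar t d f - A.stepVar t f = (A.scale (t + 1) d : ℝ) *
        (∫ x, A.sqDensity t (A.est t d) x * (∫ y, f y ∂(M.backNext t d x)) ^ 2 ∂M.ν - S) +
      S * (∫ y, (A.ϑ (t + 1) (y t) : ℝ) ∂(A.est t d) -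
        ∫ y, (A.ϑ (t + 1) (y t) : ℝ) ∂(M.pathMeasure t)) -
      (∫ y, predict M t f y ∂(A.est t d)) *
        (∫ y, predict M t f y ∂(A.est t d) - ∫ y, predict M t f y ∂(M.pathMeasure t)) := by
    rw [condVar_eq hC ht d hf hK0 hK, ← coe_scale_succ, h0, stepVar, ← hS]
    ring
  rw [hsplit]
  refine enorm_sub_le.trans (add_le_add ((enorm_add_le _ _).trans (add_le_add ?_ ?_)) ?_)
  · rw [enorm_mul]
    gcongr
    rw [Real.enorm_eq_ofReal_abs, NNReal.abs_eq]
    exact ENNReal.ofReal_le_ofReal hscale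
  · rw [enorm_mul, Real.enorm_eq_ofReal_abs]
  · rw [enorm_mul]
    gcongr

lemma tendsto_ofReal_div_sqrt (c : ℝ) :
    Tendsto (fun N : ℕ => ENNReal.ofReal (c / √(N : ℝ))) atTop (𝓝 0) := by
  rw [← ENNReal.ofReal_zero]
  exact ENNReal.tendsto_ofReal (tendsto_const_nhds.div_atTop
    (Real.tendsto_sqrt_atTop.comp tendsto_natCast_atTop_atTop))

section Limits

variable {Ω : Type*} [MeasurableSpace Ω] {P : Measure Ω} [IsProbabilityMeasure P]
  {D : (N : ℕ) → ℕ → Ω → Swarm N X} {Z : (N : ℕ) → ℕ → Ω → Fin N → Fin N × X}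

lemma tendsto_lintegral_enorm_est_sub (h : ∀ N, A.IsRun P T (D N) (Z N))
    (hC : A.BoundedBy T C) {t : ℕ} (ht : t ≤ T) {f : (ℕ → X) → ℝ} (hf : Measurable f)
    {K : ℝ} (hK0 : 0 ≤ K) (hK : ∀ y, |f y| ≤ K) :
    Tendsto (fun N => ∫⁻ ω, ‖∫ y, f y ∂(A.est t (D N t ω)) - ∫ y, f y ∂(M.pathMeasure t)‖ₑ ∂P)
      atTop (𝓝 0) := by
  refine tendsto_of_tendsto_of_tendsto_of_le_of_le' tendsto_const_nhds
    (tendsto_ofReal_div_sqrt (llnConst C t * K)) (Eventually.of_forall fun _ => zero_le) ?_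
  filter_upwards [eventually_gt_atTop 0] with N hN
  exact (h N).lintegral_enorm_est_sub_le hC hN ht hf hK0 hK

/-- The conditional variances converge in `L¹`. -/
theorem tendsto_lintegral_enorm_condVar_sub (h : ∀ N, A.IsRun P T (D N) (Z N))
    (hC : A.BoundedBy T C) {t : ℕ} (ht : t < T) {f : (ℕ → X) → ℝ} (hf : Measurable f)
    {K : ℝ} (hK0 : 0 ≤ K) (hK : ∀ y, |f y| ≤ K) (h0 : ∫ y, f y ∂(M.pathMeasure (t + 1)) = 0) :
    Tendsto (fun N => ∫⁻ ω, ‖A.condVar t (D N t ω) f - A.stepVar t f‖ₑ ∂P) atTop (𝓝 0) := by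
  have hfin := M.isFiniteMeasure_pathMeasure hC.g_le (t := t) (by omega)
  have hpm := measurable_predict (M := M) t hf
  have h0' : ∫ y, predict M t f y ∂(M.pathMeasure t) = 0 := by
    rw [← integral_step_eq_predict hC ht hf hK]; exact h0
  have hϑm : Measurable fun y : ℕ → X => (A.ϑ (t + 1) (y t) : ℝ) :=
    ((A.measurable_ϑ (t + 1)).comp (measurable_pi_apply t)).coe_nnreal_real
  have hjm := M.measurable_jointDensity_integrand t hf
  have hsm := A.measurable_sqDensity_integrand t
  have l₁ := tendsto_lintegral_lintegral_enorm h hC ht.le hsm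
      (M.integrable_q_mul_prod t _ hsm (abs_sqDensity_integrand_le hC ht))
      fun N ω x => A.integrable_est_state t _ fun x' =>
        ((M.q x' x * M.g (t + 1) x * A.wt (t + 1) x' x : ℝ≥0) : ℝ)
  have l₂ := tendsto_lintegral_lintegral_enorm h hC ht.le (M.measurable_q_prod t)
      (M.integrable_q_prod t _)
      fun N ω x => A.integrable_est_state t _ fun x' => (M.q x' x : ℝ)
  have l₃ := tendsto_lintegral_lintegral_enorm h hC ht.le hjm
      (M.integrable_q_mul_prod t _ hjm (M.abs_jointDensity_integrand_le t hK))
      fun N ω x => A.integrable_est_state_mul t _ (fun x' => (M.q x' x : ℝ))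
        (f := fun y => f (extend t (y, x)))
        (hf.comp (StateSpaceModel.measurable_extend_right t x)) fun y => hK _
  have l₄ := tendsto_lintegral_enorm_est_sub h hC ht.le hϑm (K := C) (by positivity) fun y => by
      rw [NNReal.abs_eq]; exact_mod_cast hC.ϑ_le (t + 1) (by omega) ht _
  have l₅ := tendsto_lintegral_enorm_est_sub h hC ht.le hpm (K := C * K) (by positivity)
    (abs_predict_le hC ht hK)
  have hmE : ∀ {F : (ℕ → X) × X → ℝ}, Measurable F → ∀ N, Measurable fun ω =>
      ∫⁻ x, ‖∫ y, F (y, x) ∂(A.est t (D N t ω)) - ∫ y, F (y, x) ∂(M.pathMeasure t)‖ₑ ∂M.ν :=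
    fun {F} hF N => Measurable.lintegral_prod_right' (f := fun p : Ω × X =>
      ‖∫ y, F (y, p.2) ∂(A.est t (D N t p.1)) - ∫ y, F (y, p.2) ∂(M.pathMeasure t)‖ₑ)
      ((measurable_integral_est_prod ((h N).measurable_D t) t hF).sub
        (((hF.comp measurable_swap).stronglyMeasurable.integral_prod_right'.measurable).comp
          measurable_snd)).enorm
  have m₁ := hmE hsm
  have m₂ := hmE (M.measurable_q_prod t)
  have m₃ := hmE hjm
  have m₄ : ∀ N, Measurable fun ω => ‖∫ y, (A.ϑ (t + 1) (y t) : ℝ) ∂(A.est t (D N t ω)) -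
        ∫ y, (A.ϑ (t + 1) (y t) : ℝ) ∂(M.pathMeasure t)‖ₑ := fun N =>
    (((A.measurable_integral_est t hϑm).comp ((h N).measurable_D t)).sub_const _).enorm
  have hk : ∀ (k : ℝ) {r : ℕ → ℝ≥0∞}, Tendsto r atTop (𝓝 0) →
      Tendsto (fun N => ENNReal.ofReal k * r N) atTop (𝓝 0) := fun k r hr => by
    simpa using ENNReal.Tendsto.const_mul hr (Or.inr ENNReal.ofReal_ne_top)
  have hadd : ∀ {r r' : ℕ → ℝ≥0∞}, Tendsto r atTop (𝓝 0) → Tendsto r' atTop (𝓝 0) →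
      Tendsto (fun N => r N + r' N) atTop (𝓝 0) := fun hr hr' => by
    simpa using hr.add hr'
  have hsum := hadd (hadd (hk (((C : ℝ) * C) ^ (t + 1)) (hadd (hadd (hk (K ^ 2) l₁)
    (hk (2 * K ^ 2 * (C * C)) l₂)) (hk (2 * K * (C * C)) l₃))) (hk |∫ x, A.sqDensity t (M.pathMeasure t) x *
      M.condMean t f (M.pathMeasure t) x ^ 2 ∂M.ν| l₄))
      (hk (((C : ℝ) * C) ^ (t + 1) * (C * K)) l₅)
  refine tendsto_of_tendsto_of_tendsto_of_le_of_le tendsto_const_nhds hsum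
    (fun _ => zero_le) fun N => ?_
  refine (lintegral_mono_ae (((h N).ae_weight_le hC (t := t) (by omega)).mono fun ω hω =>
    enorm_condVar_sub_le hC ht hω hf hK0 hK h0' rfl rfl)).trans (le_of_eq ?_)
  have a₁₂ := ((m₁ N).const_mul (ENNReal.ofReal (K ^ 2))).add
    ((m₂ N).const_mul (ENNReal.ofReal (2 * K ^ 2 * (C * C))))
  have a₁₃ := a₁₂.add ((m₃ N).const_mul (ENNReal.ofReal (2 * K * (C * C))))
  have a₁₃' := a₁₃.const_mul (ENNReal.ofReal (((C : ℝ) * C) ^ (t + 1)))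
  have a₁₄ := a₁₃'.add ((m₄ N).const_mul (ENNReal.ofReal |∫ x, A.sqDensity t (M.pathMeasure t) x *
      M.condMean t f (M.pathMeasure t) x ^ 2 ∂M.ν|))
  simp only [StateSpaceModel.predDensity, StateSpaceModel.jointDensity, sqDensity] at *
  simp only [Pi.add_def] at a₁₂ a₁₃ a₁₃' a₁₄
  rw [lintegral_add_left a₁₄, lintegral_add_left a₁₃', lintegral_const_mul _ a₁₃,
    lintegral_add_left a₁₂, lintegral_add_left ((m₁ N).const_mul _),
    lintegral_const_mul _ (m₁ N), lintegral_const_mul _ (m₂ N), lintegral_const_mul _ (m₃ N),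
    lintegral_const_mul _ (m₄ N), lintegral_const_mul' _ _ ENNReal.ofReal_ne_top]

end Limits

end AuxiliaryProposal

end ConditionalVariance

/-! ### The martingale central limit theorem for the unnormalized estimator. -/

section CentralLimitTheorem

variable {X : Type*} [MeasurableSpace X]

namespace AuxiliaryProposal

variable {M : StateSpaceModel X} (A : AuxiliaryProposal M)

/-- The asymptotic variance, accumulated up to time `t`, of the unnormalized estimator of a function
`f` of the path up to time `T`. -/
def pathVar (T : ℕ) (f : (ℕ → X) → ℝ) (t : ℕ) : ℝ :=
  ∫ x, A.initIncr (fun y => M.L T 0 y f) x ^ 2 ∂A.ρ₀ +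
    ∑ r ∈ Finset.range t, A.stepVar r fun y => M.L T (r + 1) y f

lemma pathVar_nonneg (T : ℕ) (f : (ℕ → X) → ℝ) (t : ℕ) : 0 ≤ A.pathVar T f t :=
  add_nonneg (integral_nonneg fun _ => sq_nonneg _)
    (Finset.sum_nonneg fun _ _ => A.stepVar_nonneg _ _)

variable {A} {T : ℕ} {C : ℝ≥0}

/-- This recursion makes the estimates of `L T t y f` a martingale in `t` whose terminal value is
the estimate of `f`. -/
lemma predict_L {t : ℕ} (ht : t < T) (f : (ℕ → X) → ℝ) :
    predict M t (fun y => M.L T (t + 1) y f) = fun y => M.L T t y f := by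
  funext y
  rw [predict_eq_Laux]
  simp only [StateSpaceModel.L]
  rw [show T - t = 1 + (T - (t + 1)) by omega, M.Laux_add]

lemma measurable_L (t : ℕ) {f : (ℕ → X) → ℝ} (hf : Measurable f) :
    Measurable fun y => M.L T t y f := M.measurable_Laux _ hf t

lemma abs_L_le (hC : A.BoundedBy T C) {t : ℕ} (ht : t ≤ T) {f : (ℕ → X) → ℝ} {K : ℝ}
    (hK : ∀ y, |f y| ≤ K) (y : ℕ → X) : |M.L T t y f| ≤ C ^ (T - t) * K :=
  M.abs_Laux_le hC.g_le hK (by omega) y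

variable {Ω : Type*} [MeasurableSpace Ω] {P : Measure Ω} [IsProbabilityMeasure P]

omit [IsProbabilityMeasure P] in
lemma IsRun.integral_init {N : ℕ} {D : ℕ → Ω → Swarm N X} {Z : ℕ → Ω → Fin N → Fin N × X}
    (h : A.IsRun P T D Z) {F : Swarm N X → ℂ} (hF : Measurable F) :
    ∫ ω, F (D 0 ω) ∂P = ∫ z, F (A.initSwarm z) ∂(Measure.pi fun _ : Fin N => A.ρ₀) := by
  rw [← integral_map (h.measurable_D 0).aemeasurable hF.aestronglyMeasurable, h.init_law,
    integral_map A.measurable_initSwarm.aemeasurable hF.aestronglyMeasurable]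

lemma sqrt_mul_inv {N : ℕ} (hN : 0 < N) : √(N : ℝ) * (N : ℝ)⁻¹ = (√(N : ℝ))⁻¹ := by
  have h : (0 : ℝ) < N := by exact_mod_cast hN
  have h1 : 0 < √(N : ℝ) := Real.sqrt_pos.2 h
  have h2 : √(N : ℝ) * √(N : ℝ) = N := Real.mul_self_sqrt h.le
  field_simp
  linarith

lemma measurable_cexp_ofReal_mul_I {α : Type*} [MeasurableSpace α] {f : α → ℝ} (hf : Measurable f) :
    Measurable fun a => Complex.exp ((f a : ℝ) * Complex.I) :=
  ((Complex.measurable_ofReal.comp hf).mul_const Complex.I).cexp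

omit [IsProbabilityMeasure P] in
/-- The initial step of the central limit theorem. -/
lemma IsRun.norm_charFun_init_sub_le {N : ℕ} {D : ℕ → Ω → Swarm N X}
    {Z : ℕ → Ω → Fin N → Fin N × X} (h : A.IsRun P T D Z) (hC : A.BoundedBy T C) (hN : 0 < N)
    {f : (ℕ → X) → ℝ} (hf : Measurable f) {K : ℝ} (hK : ∀ y, |f y| ≤ K)
    (h0 : ∫ y, f y ∂(M.pathMeasure 0) = 0) (u : ℝ) :
    ‖∫ ω, Complex.exp ((u * (√(N : ℝ) * ∫ y, f y ∂(A.est 0 (D 0 ω))) : ℝ) * Complex.I) ∂P -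
      Complex.exp (-(u ^ 2 * (∫ x, A.initIncr f x ^ 2 ∂A.ρ₀) / 2 : ℝ))‖ ≤
      iidConst |u * (C * K)| / √(N : ℝ) := by
  have hm : Measurable fun d : Swarm N X => u * (√(N : ℝ) * ∫ y, f y ∂(A.est 0 d)) :=
    ((A.measurable_integral_est 0 hf).const_mul _).const_mul _
  rw [h.integral_init (F := fun d => Complex.exp ((u * (√(N : ℝ) * ∫ y, f y ∂(A.est 0 d)) : ℝ) *
    Complex.I)) (measurable_cexp_ofReal_mul_I hm)]
  simp_rw [integral_est_init _ hf hK, ← mul_assoc (√(N : ℝ)), sqrt_mul_inv hN]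
  exact norm_charFun_pi_sub_exp_le hN A.ρ₀ (measurable_initIncr hf) (ae_abs_initIncr_le hC hK)
    (by rw [integral_initIncr hf, h0]) u

variable [MeasurableSingletonClass X]

omit [IsProbabilityMeasure P] in
/-- The conditional characteristic function of the increment in one step. -/
lemma norm_charFun_instKernel_sub_le {N : ℕ} (hC : A.BoundedBy T C) (hN : 0 < N) {t : ℕ}
    (ht : t < T) {d : Swarm N X} (hd : ∀ v ≤ t, ∀ i, (d v i).2 ≤ C)
    (hs : A.scale (t + 1) d ≠ 0) {f : (ℕ → X) → ℝ} (hf : Measurable f) {K : ℝ} (hK0 : 0 ≤ K)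
    (hK : ∀ y, |f y| ≤ K) (u : ℝ) :
    ‖∫ z, Complex.exp ((u * (√(N : ℝ) * (∫ y, f y ∂(A.est (t + 1) (A.next t d z)) -
      ∫ y, predict M t f y ∂(A.est t d))) : ℝ) * Complex.I) ∂(A.instKernel t d) -
      Complex.exp (-(u ^ 2 * A.condVar t d f / 2 : ℝ))‖ ≤
      iidConst |u * (((C : ℝ) * C) ^ (t + 1) * (2 * (C * K)))| / √(N : ℝ) := by
  have hw := hC.w_le (t + 1) (by omega) ht
  have hg := hC.g_le (t + 1) ht
  have := A.isProbabilityMeasure_inst (A.multTotal_ne_zero_of_scale hs)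
  set m := ∫ z, A.incr t d f z ∂(A.inst t d) with hm
  -- The predictable factor `scale` is absorbed into the summands, so that their second moment is
  -- exactly `condVar`.
  set φ : Fin N × X → ℝ := fun z => (A.scale (t + 1) d : ℝ) * (A.incr t d f z - m) with hφ
  have him := A.measurable_incr t d hf
  have hφm : Measurable φ := (him.sub_const m).const_mul _
  have hinc := fun z => A.abs_incr_le hw d hK0 hK z
  have hma : |m| ≤ C * K :=
    abs_integral_le_of_univ_le_one (A.inst_univ_le t d) (by positivity) hinc
  have hscale : (A.scale (t + 1) d : ℝ) ≤ ((C : ℝ) * C) ^ (t + 1) := by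
    have := A.scale_le hC ht (d := d) fun u hu => hd u (by omega)
    exact_mod_cast this
  have hφb : ∀ z, |φ z| ≤ ((C : ℝ) * C) ^ (t + 1) * (2 * (C * K)) := fun z => by
    rw [hφ, abs_mul, NNReal.abs_eq]
    refine mul_le_mul hscale ((abs_sub _ _).trans ?_) (abs_nonneg _) (by positivity)
    linarith [hinc z]
  have hi : Integrable (A.incr t d f) (A.inst t d) :=
    Integrable_of_abs_le him.aestronglyMeasurable (ae_of_all _ hinc)
  have hφ0 : ∫ z, φ z ∂(A.inst t d) = 0 := by
    simp only [hφ]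
    rw [integral_const_mul, integral_sub hi (integrable_const _)]
    simp [hm]
  have hφ2 : ∫ z, φ z ^ 2 ∂(A.inst t d) = A.condVar t d f := by
    simp only [hφ, mul_pow]
    rw [integral_const_mul, condVar]
  have key := norm_charFun_pi_sub_exp_le hN (A.inst t d) hφm (ae_of_all _ hφb) hφ0 u
  rw [hφ2] at key
  rw [instKernel_apply]
  convert key using 7 with z
  rw [A.integral_est_next _ _ _ hf hK, ← integral_step_eq_predict hC ht hf hK,
    ← A.scale_mul_integral_incr hw hg _ hf hK, ← hm, ← sqrt_mul_inv hN]
  simp only [hφ]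
  rw [← Finset.mul_sum, Finset.sum_sub_distrib, Finset.sum_const, Finset.card_univ,
    Fintype.card_fin, nsmul_eq_mul]
  have hN' : (N : ℝ) ≠ 0 := by exact_mod_cast hN.ne'
  field_simp

/-- One step of the central limit theorem. -/
lemma IsRun.enorm_charFun_next_sub_le {N : ℕ} {D : ℕ → Ω → Swarm N X}
    {Z : ℕ → Ω → Fin N → Fin N × X} (h : A.IsRun P T D Z) (hC : A.BoundedBy T C) (hN : 0 < N)
    {t : ℕ} (ht : t < T) {f : (ℕ → X) → ℝ} (hf : Measurable f) {K : ℝ} (hK0 : 0 ≤ K)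
    (hK : ∀ y, |f y| ≤ K) (u : ℝ) :
    ‖∫ ω, Complex.exp ((u * (√(N : ℝ) * ∫ y, f y ∂(A.est (t + 1) (D (t + 1) ω))) : ℝ) *
        Complex.I) ∂P - Complex.exp (-(u ^ 2 * A.stepVar t f / 2 : ℝ)) *
      ∫ ω, Complex.exp ((u * (√(N : ℝ) * ∫ y, predict M t f y ∂(A.est t (D t ω))) : ℝ) *
        Complex.I) ∂P‖ₑ ≤
      ENNReal.ofReal (iidConst |u * (((C : ℝ) * C) ^ (t + 1) * (2 * (C * K)))| / √(N : ℝ)) +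
        ENNReal.ofReal (u ^ 2 / 2) * ∫⁻ ω, ‖A.condVar t (D t ω) f - A.stepVar t f‖ₑ ∂P := by
  have hw := hC.w_le (t + 1) (by omega) ht
  have hpm := measurable_predict (M := M) t hf
  have hpe := A.measurable_integral_est (N := N) t hpm
  have hne : Measurable fun p : Swarm N X × (Fin N → Fin N × X) =>
      ∫ y, f y ∂(A.est (t + 1) (A.next t p.1 p.2)) :=
    (A.measurable_integral_est (t + 1) hf).comp (A.measurable_next t)
  have key := IsCondLawOn.enorm_charFun_sub_le (h.condLaw t ht) (h.measurable_D t)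
    (h.measurable_Z t) (A.measurable_scale (t + 1) (measurableSet_singleton 0).compl)
    (U := fun d => √(N : ℝ) * ∫ y, predict M t f y ∂(A.est t d)) (hpe.const_mul _)
    (V := fun p => √(N : ℝ) * (∫ y, f y ∂(A.est (t + 1) (A.next t p.1 p.2)) -
      ∫ y, predict M t f y ∂(A.est t p.1))) ((hne.sub (hpe.comp measurable_fst)).const_mul _)
    (v := fun d => A.condVar t d f) (fun d => A.condVar_nonneg t d f) (A.stepVar_nonneg t f)
    (ε := iidConst |u * (((C : ℝ) * C) ^ (t + 1) * (2 * (C * K)))| / √(N : ℝ))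
    (by unfold iidConst; positivity) (u := u) ?_ ?_ ?_
  · convert key using 6 with ω
    rw [h.next_eq]
    congr 3
    ring
  · filter_upwards [h.ae_weight_le hC (t := t) (by omega)] with ω hω hs
    exact norm_charFun_instKernel_sub_le hC hN ht hω hs hf hK0 hK u
  · intro d hs
    have := A.isProbabilityMeasure_inst (A.multTotal_ne_zero_of_scale hs)
    rw [instKernel_apply]
    exact measure_univ
  · intro ω hs
    have hs : A.scale (t + 1) (D t ω) = 0 := not_not.1 hs
    refine ⟨?_, by simp [condVar, hs]⟩
    rw [A.est_eq_zero_of_scale (by rw [scale_next, hs]),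
      ← integral_step_eq_predict hC ht hf hK, A.step_est_eq_zero hw hs]
    simp

/-- The central limit theorem for the unnormalized particle estimator of the smoothing measure. -/
theorem tendsto_charFun_est {D : (N : ℕ) → ℕ → Ω → Swarm N X}
    {Z : (N : ℕ) → ℕ → Ω → Fin N → Fin N × X} (h : ∀ N, A.IsRun P T (D N) (Z N))
    (hC : A.BoundedBy T C) {f : (ℕ → X) → ℝ} (hf : Measurable f) {K : ℝ} (hK0 : 0 ≤ K)
    (hK : ∀ y, |f y| ≤ K) (h0 : ∫ y, f y ∂(M.pathMeasure T) = 0) (u : ℝ) {t : ℕ} (ht : t ≤ T) :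
    Tendsto (fun N : ℕ => ∫ ω, Complex.exp
      ((u * (√(N : ℝ) * ∫ y, M.L T t y f ∂(A.est t (D N t ω))) : ℝ) * Complex.I) ∂P) atTop
      (𝓝 (Complex.exp (-(u ^ 2 * A.pathVar T f t / 2 : ℝ)))) := by
  have hγ := M.isFiniteMeasure_pathMeasure hC.g_le (le_refl T)
  -- Adjointness carries the centring of `f` at time `T` back to every earlier time; each step needs
  -- it for the limit of its conditional variance.
  have hL0 : ∀ r ≤ T, ∫ y, M.L T r y f ∂(M.pathMeasure r) = 0 := fun r hr => by
    rw [M.integral_Laux_eq hC.g_le hf hr le_rfl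
      (Integrable_of_abs_le hf.aestronglyMeasurable (ae_of_all _ hK)), h0]
  induction t with
  | zero =>
    rw [tendsto_iff_norm_sub_tendsto_zero]
    have hlim : Tendsto (fun N : ℕ => iidConst |u * (C * (C ^ (T - 0) * K))| / √(N : ℝ)) atTop
        (𝓝 0) := tendsto_const_nhds.div_atTop
      (Real.tendsto_sqrt_atTop.comp tendsto_natCast_atTop_atTop)
    refine squeeze_zero' (Eventually.of_forall fun _ => norm_nonneg _) ?_ hlim
    filter_upwards [eventually_gt_atTop 0] with N hN
    have := (h N).norm_charFun_init_sub_le hC hN (measurable_L (M := M) (T := T) 0 hf)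
      (abs_L_le hC (Nat.zero_le T) hK) (hL0 0 (Nat.zero_le T)) u
    simpa [pathVar] using this
  | succ t ih =>
    have hKt := abs_L_le hC ht hK
    have hfm := measurable_L (M := M) (T := T) (t + 1) hf
    rw [pathVar, Finset.sum_range_succ, ← add_assoc]
    refine tendsto_charFun_of_enorm_le (ih (by omega))
      (r := fun N => ENNReal.ofReal (iidConst |u * (((C : ℝ) * C) ^ (t + 1) *
        (2 * (C * (C ^ (T - (t + 1)) * K))))| / √(N : ℝ)) + ENNReal.ofReal (u ^ 2 / 2) *
        ∫⁻ ω, ‖A.condVar t (D N t ω) (fun y => M.L T (t + 1) y f) -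
          A.stepVar t (fun y => M.L T (t + 1) y f)‖ₑ ∂P) ?_ ?_
    · filter_upwards [eventually_gt_atTop 0] with N hN
      have := (h N).enorm_charFun_next_sub_le hC hN (t := t) (by omega) hfm (by positivity) hKt u
      rwa [predict_L (by omega)] at this
    · have l1 := tendsto_ofReal_div_sqrt (iidConst |u * (((C : ℝ) * C) ^ (t + 1) *
        (2 * (C * (C ^ (T - (t + 1)) * K))))|)
      have l2 := tendsto_lintegral_enorm_condVar_sub h hC (t := t) (by omega) hfm (by positivity)
        hKt (hL0 (t + 1) ht)
      have l3 := ENNReal.Tendsto.const_mul (a := ENNReal.ofReal (u ^ 2 / 2)) l2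
        (Or.inr ENNReal.ofReal_ne_top)
      simpa using l1.add l3

end AuxiliaryProposal

end CentralLimitTheorem

/-! ### Identification of the accumulated variance with `Γ`. -/

section AsymptoticVariance

variable {X : Type*} [MeasurableSpace X]

namespace StateSpaceModel

variable {M : StateSpaceModel X} {T : ℕ} {C : ℝ≥0}

/-- The total mass of the unnormalized smoothing measure. -/
def mass (M : StateSpaceModel X) (t : ℕ) : ℝ := (M.pathMeasure t).real Set.univ

lemma unnormalized_one (hC : ∀ t ≤ T, ∀ x, M.g t x ≤ C) {t : ℕ} (ht : t ≤ T) :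
    M.unnormalized t (fun _ => 1) = M.mass t := by
  have := M.isFiniteMeasure_pathMeasure hC ht
  rw [M.unnormalized_eq_integral (T := t) (fun u hu => hC u (hu.trans ht)) measurable_const
    (integrable_const _)]
  simp [mass]

lemma smoothing_eq (hC : ∀ t ≤ T, ∀ x, M.g t x ≤ C) {t : ℕ} (ht : t ≤ T) {f : (ℕ → X) → ℝ}
    (hf : Measurable f) (hi : Integrable f (M.pathMeasure t)) :
    M.smoothing t f = (∫ y, f y ∂(M.pathMeasure t)) / M.mass t := by
  rw [smoothing, unnormalized_one hC ht,
    M.unnormalized_eq_integral (T := t) (fun u hu => hC u (hu.trans ht)) hf hi]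

lemma integral_L_one (hC : ∀ t ≤ T, ∀ x, M.g t x ≤ C) {r t : ℕ} (hrt : r ≤ t) (ht : t ≤ T) :
    ∫ y, M.L t r y (fun _ => 1) ∂(M.pathMeasure r) = M.mass t := by
  have := M.isFiniteMeasure_pathMeasure hC ht
  rw [M.integral_Laux_eq hC measurable_const hrt ht (integrable_const _)]
  simp [mass]

/-- The mass at time `t` is an integral against the measure at time `r`, so it vanishes if that
measure is zero. Positivity at the final time therefore justifies all earlier normalizations. -/
lemma mass_ne_zero (hC : ∀ t ≤ T, ∀ x, M.g t x ≤ C) {r t : ℕ} (hrt : r ≤ t) (ht : t ≤ T)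
    (h : M.mass t ≠ 0) : M.mass r ≠ 0 := by
  have := M.isFiniteMeasure_pathMeasure hC (hrt.trans ht)
  intro h0
  rw [mass, measureReal_eq_zero_iff, Measure.measure_univ_eq_zero] at h0
  rw [← integral_L_one hC hrt ht, h0] at h
  simp at h

lemma L_one_const (t r : ℕ) (y : ℕ → X) :
    M.L t r y (fun _ => 1) = M.L t r (fun _ => y r) (fun _ => 1) :=
  M.Laux_congr (s := r + 1) (fun _ _ _ => rfl) rfl fun u h1 h2 => by omega

lemma measurable_const_path : Measurable fun (x : X) (_ : ℕ) => x := by fun_prop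

lemma integrable_L (hC : ∀ t ≤ T, ∀ x, M.g t x ≤ C) {r t : ℕ} (hrt : r ≤ t) (ht : t ≤ T)
    {f : (ℕ → X) → ℝ} (hf : Measurable f) {K : ℝ} (hK : ∀ y, |f y| ≤ K) {E : Type*}
    [MeasurableSpace E] {a : E → ℕ → X} (ha : Measurable a) (μ : Measure E) [IsFiniteMeasure μ] :
    Integrable (fun y => M.L t r (a y) f) μ :=
  Integrable_of_abs_le ((M.measurable_Laux _ hf r).comp ha).aestronglyMeasurable
    (ae_of_all _ fun y => M.abs_Laux_le hC hK (m := t - r) (by omega) (a y))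

lemma filtering_L_one (hC : ∀ t ≤ T, ∀ x, M.g t x ≤ C) {r t : ℕ} (hrt : r ≤ t) (ht : t ≤ T) :
    M.filtering r (fun x => M.L t r (fun _ => x) (fun _ => 1)) = M.mass t / M.mass r := by
  have := M.isFiniteMeasure_pathMeasure hC (hrt.trans ht)
  have hm : Measurable fun (y : ℕ → X) (_ : ℕ) => y r :=
    measurable_const_path.comp (measurable_pi_apply r)
  have hLm : Measurable fun y : ℕ → X => M.L t r (fun _ => y r) (fun _ => 1) :=
    (M.measurable_Laux _ measurable_const r).comp hm
  rw [filtering, smoothing_eq hC (hrt.trans ht) hLm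
    (integrable_L hC hrt ht measurable_const (K := 1) (by simp) hm _), ← integral_L_one hC hrt ht]
  simp_rw [← L_one_const]

/-- Applying the transition density and the likelihood to `L_{r+1}` is one unfolding of `L_r`, which
brings the quantity back to `filtering_L_one`. -/
lemma predictive_succ (hC : ∀ t ≤ T, ∀ x, M.g t x ≤ C) {r t : ℕ} (hrt : r < t) (ht : t ≤ T) :
    M.predictive (r + 1) (fun x => (M.g (r + 1) x : ℝ) *
      M.L t (r + 1) (fun _ => x) (fun _ => 1)) = M.mass t / M.mass r := by
  have := M.isFiniteMeasure_pathMeasure hC (t := r) (by omega)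
  rw [← filtering_L_one hC hrt.le ht, predictive]
  congr 1
  funext x
  simp only [L]
  rw [show t - r = (t - (r + 1)) + 1 by omega, Laux]
  refine integral_congr_ae (ae_of_all _ fun x' => ?_)
  simp only
  rw [← mul_assoc]
  congr 1
  exact M.Laux_congr (s := r + 2) (fun _ _ _ => rfl) (by simp) fun u h1 h2 => by omega

lemma predictive_zero (hC : ∀ t ≤ T, ∀ x, M.g t x ≤ C) {t : ℕ} (ht : t ≤ T) :
    M.predictive 0 (fun x => (M.g 0 x : ℝ) * M.L t 0 (fun _ => x) (fun _ => 1)) = M.mass t := by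
  rw [← unnormalized_one hC ht]
  rfl

/-- A function of the path from time `s` on, conditionally on the state at time `r ≤ s`. -/
lemma L_eq_Lmarg {s r : ℕ} (hrs : r ≤ s) (hsT : s ≤ T) {f : (ℕ → X) → ℝ}
    (hf : ∀ y y' : ℕ → X, (∀ u, s ≤ u → u ≤ T → y u = y' u) → f y = f y') (y : ℕ → X) :
    M.L T r y f = M.Lmarg r s (y r) fun x => M.L T s (fun _ => x) f := by
  simp only [Lmarg, L]
  rw [show T - r = (s - r) + (T - s) by omega, M.Laux_add]
  have h1 : (fun z => M.Laux (T - s) (r + (s - r)) z f) =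
      fun z => M.Laux (T - s) s (fun _ => z s) f := by
    funext z
    rw [show r + (s - r) = s by omega]
    refine M.Laux_congr (s := s) (fun z z' h => hf z z' fun u h1 h2 => h u h1 (by omega)) rfl ?_
    intro u h1 h2
    rw [show u = s by omega]
  rw [h1]
  refine M.Laux_congr (s := r) (fun z z' h => ?_) rfl fun u h1 h2 => ?_
  · rw [h s hrs (by omega)]
  · rw [show u = r by omega]

end StateSpaceModel

namespace AuxiliaryProposal

variable {M : StateSpaceModel X} {A : AuxiliaryProposal M} {T : ℕ} {C : ℝ≥0}

lemma filtering_ϑ (hC : A.BoundedBy T C) {r : ℕ} (hr : r < T) :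
    M.filtering r (fun x => (A.ϑ (r + 1) x : ℝ)) =
      (∫ y, (A.ϑ (r + 1) (y r) : ℝ) ∂(M.pathMeasure r)) / M.mass r := by
  have := M.isFiniteMeasure_pathMeasure hC.g_le hr.le
  have hϑm : Measurable fun y : ℕ → X => (A.ϑ (r + 1) (y r) : ℝ) :=
    ((A.measurable_ϑ (r + 1)).comp (measurable_pi_apply r)).coe_nnreal_real
  refine M.smoothing_eq hC.g_le hr.le hϑm (Integrable_of_abs_le (c := C) hϑm.aestronglyMeasurable
    (ae_of_all _ fun y => ?_))
  rw [NNReal.abs_eq]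
  exact_mod_cast hC.ϑ_le (r + 1) (by omega) hr _

/-- The change of variables `ϑ p ω² = q g ω`, integrated against the filter. -/
lemma filtering_sq (hC : A.BoundedBy T C) {r : ℕ} (hr : r < T) {G G' : X → ℝ}
    (hG' : Measurable G') {K : ℝ} (hK : ∀ x, |G' x| ≤ K) (hGG' : G =ᵐ[M.ν] G') :
    M.filtering r (fun x => (A.ϑ (r + 1) x : ℝ) *
      ∫ x', (A.p (r + 1) x x' : ℝ) * (A.w (r + 1) x x').toReal ^ 2 * G x' ^ 2 ∂M.ν) =
      (∫ x, A.sqDensity r (M.pathMeasure r) x * G' x ^ 2 ∂M.ν) / M.mass r := by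
  have := M.isFiniteMeasure_pathMeasure hC.g_le hr.le
  have hsm := A.measurable_sqDensity_integrand r
  have hFm : Measurable fun p : (ℕ → X) × X =>
      ((M.potential r p * A.wt (r + 1) (p.1 r) p.2 : ℝ≥0) : ℝ) * G' p.2 ^ 2 :=
    hsm.mul ((hG'.comp measurable_snd).pow_const 2)
  have hFi : Integrable (fun p : (ℕ → X) × X =>
      ((M.potential r p * A.wt (r + 1) (p.1 r) p.2 : ℝ≥0) : ℝ) * G' p.2 ^ 2)
      ((M.pathMeasure r).prod M.ν) := by
    refine (M.integrable_q_mul_prod r _ hsm (abs_sqDensity_integrand_le hC hr)).mul_bdd (c := K ^ 2)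
      ((hG'.comp measurable_snd).pow_const 2).aestronglyMeasurable (ae_of_all _ fun x => ?_)
    rw [norm_pow]
    exact pow_le_pow_left₀ (norm_nonneg _) (hK _) 2
  have e : ∀ y : ℕ → X, (A.ϑ (r + 1) (y r) : ℝ) * ∫ x', (A.p (r + 1) (y r) x' : ℝ) *
      (A.w (r + 1) (y r) x').toReal ^ 2 * G x' ^ 2 ∂M.ν = ∫ x', ((M.potential r (y, x') *
        A.wt (r + 1) (y r) x' : ℝ≥0) : ℝ) * G' x' ^ 2 ∂M.ν := by
    intro y
    rw [← integral_const_mul]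
    refine integral_congr_ae ?_
    filter_upwards [hGG'] with x hx
    have h1 := A.wt_mul_eq (hC.w_le (r + 1) (by omega) hr (y r) x)
    have h2 : (A.w (r + 1) (y r) x).toReal = (A.wt (r + 1) (y r) x : ℝ) := rfl
    have h3 : (A.ϑ (r + 1) (y r) : ℝ) * A.p (r + 1) (y r) x * A.wt (r + 1) (y r) x =
        (M.potential r (y, x) : ℝ) := by exact_mod_cast h1
    rw [hx, h2, NNReal.coe_mul, ← h3]
    ring
  rw [StateSpaceModel.filtering]
  simp_rw [e]
  rw [M.smoothing_eq hC.g_le hr.le hFm.stronglyMeasurable.integral_prod_right'.measurable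
    hFi.integral_prod_left, integral_integral_swap hFi]
  congr 2
  funext x
  simp only
  rw [integral_mul_const]
  rfl

/-- Bounded likelihoods and weights give `sqDensity ≤ C² · predDensity`. Thus the states where the
conditional mean is an undefined quotient carry no variance. -/
lemma sqDensity_eq_zero (hC : A.BoundedBy T C) {r : ℕ} (hr : r < T) {x : X}
    (hi : Integrable (fun y : ℕ → X => (M.q (y r) x : ℝ)) (M.pathMeasure r))
    (h : M.predDensity r (M.pathMeasure r) x = 0) : A.sqDensity r (M.pathMeasure r) x = 0 := by
  have h1 : A.sqDensity r (M.pathMeasure r) x ≤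
      (C * C : ℝ≥0) * M.predDensity r (M.pathMeasure r) x := by
    rw [StateSpaceModel.predDensity, ← integral_const_mul]
    refine (le_abs_self _).trans ?_
    rw [← Real.norm_eq_abs]
    exact norm_integral_le_of_norm_le (hi.const_mul _)
      (ae_of_all _ fun y => abs_sqDensity_integrand_le hC hr (y, x))
  rw [h, mul_zero] at h1
  exact le_antisymm h1 (integral_nonneg fun _ => NNReal.coe_nonneg _)

lemma ae_integrable_q (hC : A.BoundedBy T C) {r : ℕ} (hr : r < T) :
    ∀ᵐ x ∂M.ν, Integrable (fun y : ℕ → X => (M.q (y r) x : ℝ)) (M.pathMeasure r) := by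
  have := M.isFiniteMeasure_pathMeasure hC.g_le hr.le
  exact (M.integrable_q_prod r _).prod_left_ae

/-- The normalizing mass cancels in the quotient. Rewriting the iterated integrals as path integrals
needs the section of `q` at `x` to be integrable, which Fubini grants only for `ν`-almost every `x`;
this suffices inside the variance. -/
lemma gSmooth_ae_eq (hC : A.BoundedBy T C) {r : ℕ} (hr : r < T) (hmass : M.mass r ≠ 0)
    {f : (ℕ → X) → ℝ} (hf : Measurable f) {K : ℝ} (hK : ∀ y, |f y| ≤ K) :
    (fun x => M.gSmooth T r x f) =ᵐ[M.ν]
      M.condMean r (fun y => M.L T (r + 1) y f) (M.pathMeasure r) := by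
  have hLm := measurable_L (M := M) (T := T) (r + 1) hf
  filter_upwards [ae_integrable_q hC hr] with x hx
  have hqm : Measurable fun y : ℕ → X => (M.q (y r) x : ℝ) :=
    (M.measurable_q_comp (by fun_prop) measurable_const).coe_nnreal_real
  have hjm : Measurable fun y : ℕ → X => (M.q (y r) x : ℝ) * M.L T (r + 1) (extend r (y, x)) f :=
    hqm.mul (hLm.comp (StateSpaceModel.measurable_extend_right r x))
  have hji : Integrable (fun y : ℕ → X => (M.q (y r) x : ℝ) * M.L T (r + 1) (extend r (y, x)) f)
      (M.pathMeasure r) :=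
    (hx.const_mul _).mono' hjm.aestronglyMeasurable
      (ae_of_all _ fun y => M.abs_jointDensity_integrand_le r (abs_L_le hC hr hK) (y, x))
  have e1 := M.smoothing_eq hC.g_le hr.le hjm hji
  have e2 := M.smoothing_eq hC.g_le hr.le hqm hx
  rw [StateSpaceModel.gSmooth, StateSpaceModel.filtering, e2, StateSpaceModel.condMean]
  change M.smoothing r (fun y : ℕ → X => (M.q (y r) x : ℝ) *
    M.L T (r + 1) (extend r (y, x)) f) / _ = _
  rw [e1, div_div_div_cancel_right₀ hmass]
  rfl

/-- The terms of the variance after the time `s`. -/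
lemma upsilon_term (hC : A.BoundedBy T C) {r : ℕ} (hr : r < T) (hmass : M.mass T ≠ 0)
    {f : (ℕ → X) → ℝ} (hf : Measurable f) {K : ℝ} (hK0 : 0 ≤ K) (hK : ∀ y, |f y| ≤ K) :
    M.filtering r (fun x => A.upsilon T r x f) * M.filtering r (fun x => (A.ϑ (r + 1) x : ℝ)) /
      M.predictive (r + 1) (fun x => (M.g (r + 1) x : ℝ) *
        M.L T (r + 1) (fun _ => x) (fun _ => 1)) ^ 2 =
      A.stepVar r (fun y => M.L T (r + 1) y f) / M.mass T ^ 2 := by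
  have := M.isFiniteMeasure_pathMeasure hC.g_le hr.le
  have hmr := M.mass_ne_zero hC.g_le hr.le le_rfl hmass
  have hLm := measurable_L (M := M) (T := T) (r + 1) hf
  unfold upsilon
  rw [filtering_sq hC hr (M.measurable_condMean r hLm _)
    (M.abs_condMean_le r (by positivity) (abs_L_le hC hr hK) _)
    (gSmooth_ae_eq hC hr hmr hf hK), filtering_ϑ hC hr,
    M.predictive_succ hC.g_le hr le_rfl, stepVar]
  field_simp

lemma measurable_Lmarg (r s : ℕ) {f : X → ℝ} (hf : Measurable f) :
    Measurable fun x => M.Lmarg r s x f :=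
  (M.measurable_Laux (s - r) (hf.comp (measurable_pi_apply s)) r).comp
    StateSpaceModel.measurable_const_path

/-- Since `f` only sees times from `s` on and `r + 1 ≤ s`, `L_{r+1} f` depends on the path through
its state at `r + 1` alone. It then factors out of the joint density, and the conditional mean is
the marginal kernel wherever the predicted density is nonzero; elsewhere `sqDensity` vanishes. -/
lemma V_succ_term (hC : A.BoundedBy T C) {s r : ℕ} (hr : r < s) (hs : s ≤ T)
    (hmass : M.mass s ≠ 0) {f : (ℕ → X) → ℝ} (hf : Measurable f) {K : ℝ}
    (hK : ∀ y, |f y| ≤ K)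
    (hdep : ∀ y y' : ℕ → X, (∀ u, s ≤ u → u ≤ T → y u = y' u) → f y = f y') :
    A.V (r + 1) s (fun x => M.L T s (fun _ => x) f) =
      A.stepVar r (fun y => M.L T (r + 1) y f) / M.mass s ^ 2 := by
  have := M.isFiniteMeasure_pathMeasure hC.g_le (t := r) (by omega)
  have hmr := M.mass_ne_zero hC.g_le hr.le hs hmass
  have hLs : Measurable fun x => M.L T s (fun _ => x) f :=
    (measurable_L (M := M) (T := T) s hf).comp StateSpaceModel.measurable_const_path
  have hb1 : ∀ x, |M.L T s (fun _ => x) f| ≤ C ^ (T - s) * K := fun x => abs_L_le hC hs hK _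
  have hb2 : ∀ x, |M.Lmarg (r + 1) s x (fun x => M.L T s (fun _ => x) f)| ≤
      C ^ (s - (r + 1)) * (C ^ (T - s) * K) := fun x =>
    M.abs_Laux_le hC.g_le (f := fun y => M.L T s (fun _ => y s) f) (fun y => hb1 (y s))
      (m := s - (r + 1)) (by omega) _
  rw [V, filtering_sq hC (r := r) (by omega) (measurable_Lmarg (M := M) (r + 1) s hLs) hb2
    (ae_eq_refl _), filtering_ϑ hC (by omega)]
  have e1 : M.predictive (r + 1) (fun x => (M.g (r + 1) x : ℝ) *
      M.Lmarg (r + 1) s x (fun _ => 1)) = M.mass s / M.mass r :=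
    M.predictive_succ hC.g_le hr hs
  have e2 : ∫ x, A.sqDensity r (M.pathMeasure r) x *
      M.Lmarg (r + 1) s x (fun x => M.L T s (fun _ => x) f) ^ 2 ∂M.ν =
      ∫ x, A.sqDensity r (M.pathMeasure r) x *
        M.condMean r (fun y => M.L T (r + 1) y f) (M.pathMeasure r) x ^ 2 ∂M.ν := by
    refine integral_congr_ae ?_
    filter_upwards [ae_integrable_q hC (r := r) (by omega)] with x hx
    by_cases h0 : M.predDensity r (M.pathMeasure r) x = 0
    · rw [sqDensity_eq_zero hC (by omega) hx h0]
      simp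
    · have e3 : M.jointDensity r (fun y => M.L T (r + 1) y f) (M.pathMeasure r) x =
          M.predDensity r (M.pathMeasure r) x *
            M.Lmarg (r + 1) s x (fun x => M.L T s (fun _ => x) f) := by
        rw [StateSpaceModel.jointDensity, StateSpaceModel.predDensity, ← integral_mul_const]
        congr 1
        funext y
        rw [M.L_eq_Lmarg hr hs hdep, extend_self]
      simp only [StateSpaceModel.condMean]
      rw [e3, mul_div_cancel_left₀ _ h0]
  rw [e1, e2, stepVar]
  field_simp

lemma V_zero_term (hC : A.BoundedBy T C) {s : ℕ} (hs : s ≤ T) {f : (ℕ → X) → ℝ}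
    (hdep : ∀ y y' : ℕ → X, (∀ u, s ≤ u → u ≤ T → y u = y' u) → f y = f y') :
    A.V 0 s (fun x => M.L T s (fun _ => x) f) =
      (∫ x, A.initIncr (fun y => M.L T 0 y f) x ^ 2 ∂A.ρ₀) / M.mass s ^ 2 := by
  have e1 : M.predictive 0 (fun x => (M.g 0 x : ℝ) * M.Lmarg 0 s x (fun _ => 1)) = M.mass s :=
    M.predictive_zero hC.g_le hs
  rw [V, e1]
  congr 2
  funext x
  rw [initIncr, M.L_eq_Lmarg (Nat.zero_le s) hs hdep, mul_pow]
  rfl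

/-- The asymptotic variance of the estimator is the accumulated variance of the unnormalized
estimator, normalized by the squared total mass. -/
theorem smoothingVariance_eq (hC : A.BoundedBy T C) {s : ℕ} (hs : s ≤ T) (hmass : M.mass T ≠ 0)
    {f : (ℕ → X) → ℝ} (hf : Measurable f) {K : ℝ} (hK0 : 0 ≤ K) (hK : ∀ y, |f y| ≤ K)
    (hdep : ∀ y y' : ℕ → X, (∀ u, s ≤ u → u ≤ T → y u = y' u) → f y = f y') :
    A.smoothingVariance s T f = A.pathVar T f T / M.mass T ^ 2 := by
  have hms := M.mass_ne_zero hC.g_le hs le_rfl hmass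
  have e1 : A.filterVariance s (fun x => M.L T s (fun _ => x) f) =
      A.pathVar T f s / M.mass s ^ 2 := by
    rw [filterVariance, Finset.sum_range_succ', V_zero_term hC hs hdep, pathVar, add_div, add_comm,
      Finset.sum_div]
    congr 1
    refine Finset.sum_congr rfl fun r hr => ?_
    exact V_succ_term hC (Finset.mem_range.1 hr) hs hms hf hK hdep
  have e2 : ∀ r ∈ Finset.Ico s T,
      M.filtering r (fun x => A.upsilon T r x f) *
        M.filtering r (fun x => (A.ϑ (r + 1) x : ℝ)) /
        M.predictive (r + 1)
          (fun x => (M.g (r + 1) x : ℝ) * M.L T (r + 1) (fun _ => x) (fun _ => 1)) ^ 2 =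
      A.stepVar r (fun y => M.L T (r + 1) y f) / M.mass T ^ 2 := fun r hr =>
    upsilon_term hC (Finset.mem_Ico.1 hr).2 hmass hf hK0 hK
  -- The filter part carries `1 / mass s ^ 2` and is divided by `(mass T / mass s) ^ 2`, so all
  -- terms share the factor `1 / mass T ^ 2`.
  rw [smoothingVariance, e1, M.filtering_L_one hC.g_le hs le_rfl, Finset.sum_congr rfl e2,
    ← Finset.sum_div, pathVar, pathVar, ← Finset.sum_range_add_sum_Ico _ hs]
  field_simp
  ring

end AuxiliaryProposal

end AsymptoticVariance

/-! ### Index paths of the backward chain and the two conventions for `0/0`. -/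

section BackwardPaths

variable {X : Type*} [MeasurableSpace X] {N : ℕ}

omit [MeasurableSpace X] in
lemma onSegment_extend (s n : ℕ) (H : (Fin (n + 2) → X) → ℝ) (y : ℕ → X) (x : X) :
    onSegment s (n + 1) H (extend (s + n) (y, x)) =
      onSegment s n (fun z => H (Fin.snoc (α := fun _ => X) z x)) y := by
  unfold onSegment
  congr 1
  funext k
  refine Fin.lastCases ?_ (fun k => ?_) k
  · rw [Fin.snoc_last, Fin.val_last, ← add_assoc, extend_self]
  · rw [Fin.snoc_castSucc, Fin.val_castSucc, extend_of_le (by omega)]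

lemma measurable_onSegment (s n : ℕ) {H : (Fin (n + 1) → X) → ℝ} (hH : Measurable H) :
    Measurable (onSegment s n H) := hH.comp (by fun_prop)

lemma measurable_snoc_right (n : ℕ) (x : X) :
    Measurable fun z : Fin n → X => (Fin.snoc (α := fun _ => X) z x : Fin (n + 1) → X) := by
  refine measurable_pi_iff.2 fun k => ?_
  refine Fin.lastCases ?_ (fun k => ?_) k
  · simp only [Fin.snoc_last]; fun_prop
  · simp only [Fin.snoc_castSucc]; fun_prop

namespace StateSpaceModel

variable (M : StateSpaceModel X)

/-- The product of the backward transition probabilities along an index path. -/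
def backProd (d : Swarm N X) (s n : ℕ) (j : Fin (n + 1) → Fin N) : ℝ≥0 :=
  ∏ k : Fin n, M.backCoef (s + k) d (d (s + k + 1) (j k.succ)).1 (j k.castSucc)

lemma backProd_snoc (d : Swarm N X) (s n : ℕ) (j : Fin (n + 1) → Fin N) (i : Fin N) :
    M.backProd d s (n + 1) (Fin.snoc (α := fun _ => Fin N) j i) =
      M.backProd d s n j * M.backCoef (s + n) d (d (s + n + 1) i).1 (j (Fin.last n)) := by
  unfold backProd
  rw [Fin.prod_univ_castSucc]
  congr 1
  · refine Finset.prod_congr rfl fun k _ => ?_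
    rw [Fin.snoc_castSucc, Fin.succ_castSucc, Fin.snoc_castSucc]
    rfl
  · rw [Fin.succ_last, Fin.snoc_last, Fin.snoc_castSucc]
    rfl

/-- The backward law is the law of the particle trajectory along a backward Markov index path. -/
lemma sum_integral_back [MeasurableSingletonClass X] (d : Swarm N X) (s n : ℕ)
    {H : Fin N → (Fin (n + 1) → X) → ℝ}
    (hH : ∀ i, Measurable (H i)) {K : ℝ} (hK : ∀ i z, |H i z| ≤ K) :
    ∑ i, ∫ y, onSegment s n (H i) y ∂(M.back (s + n) d i) =
      ∑ j : Fin (n + 1) → Fin N, (M.backProd d s n j : ℝ) *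
        H (j (Fin.last n)) (fun k => (d (s + k) (j k)).1) := by
  induction n generalizing K with
  | zero =>
    rw [← (Equiv.funUnique (Fin 1) (Fin N)).symm.sum_comp]
    refine Finset.sum_congr rfl fun i _ => ?_
    have h1 : onSegment s 0 (H i) =ᵐ[M.back (s + 0) d i] fun _ => H i fun _ => (d s i).1 := by
      filter_upwards [M.ae_back (s + 0) d i] with y hy
      unfold onSegment
      congr 1
      funext k
      rw [Fin.val_eq_zero k, hy, add_zero]
    rw [integral_congr_ae h1]
    simp [backProd]
  | succ n ih =>
    have hK0 : 0 ≤ |K| := abs_nonneg _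
    have hsn : ∀ i, Measurable fun z : Fin (n + 1) → X =>
        H i (Fin.snoc (α := fun _ => X) z (d (s + n + 1) i).1) := fun i =>
      (hH i).comp (measurable_snoc_right _ _)
    have h1 : ∀ i, ∫ y, onSegment s (n + 1) (H i) y ∂(M.back (s + (n + 1)) d i) =
        ∑ j : Fin (n + 1) → Fin N, (M.backProd d s n j : ℝ) *
          ((M.backCoef (s + n) d (d (s + n + 1) i).1 (j (Fin.last n)) : ℝ) *
          H i (Fin.snoc (α := fun _ => X) (fun k => (d (s + k) (j k)).1) (d (s + n + 1) i).1)) := by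
      intro i
      rw [← add_assoc, back_succ, M.integral_backNext _ _ _ (measurable_onSegment s (n + 1) (hH i))
        (fun y => hK i _)]
      simp_rw [onSegment_extend]
      -- The integrand is allowed to depend on the terminal index for the sake of this step: the
      -- transition probability from `i` to `l` is absorbed into the function to which the induction
      -- hypothesis is applied.
      rw [← ih (H := fun l z => (M.backCoef (s + n) d (d (s + n + 1) i).1 l : ℝ) *
        H i (Fin.snoc (α := fun _ => X) z (d (s + n + 1) i).1)) (K := |K|)
        (fun l => (hsn i).const_mul _)]
      · simp only [onSegment]
        simp_rw [integral_const_mul]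
      · intro l z
        rw [abs_mul, NNReal.abs_eq, ← one_mul |K|]
        refine mul_le_mul ?_ ((hK i _).trans (le_abs_self K)) (abs_nonneg _) zero_le_one
        have h2 := M.sum_backCoef i.pos.ne' (s + n) d (d (s + n + 1) i).1
        have h3 : M.backCoef (s + n) d (d (s + n + 1) i).1 l ≤ 1 := by
          rw [← h2]
          exact Finset.single_le_sum (f := fun l => M.backCoef (s + n) d (d (s + n + 1) i).1 l)
            (fun _ _ => zero_le) (Finset.mem_univ l)
        exact_mod_cast h3
    simp_rw [h1]
    rw [← (Fin.snocEquiv fun _ : Fin (n + 2) => Fin N).sum_comp, Fintype.sum_prod_type]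
    refine Finset.sum_congr rfl fun i _ => Finset.sum_congr rfl fun j _ => ?_
    simp only [Fin.snocEquiv, Equiv.coe_fn_mk]
    rw [backProd_snoc, Fin.snoc_last, NNReal.coe_mul, mul_assoc]
    congr 3
    funext k
    refine Fin.lastCases ?_ (fun k => ?_) k
    · rw [Fin.snoc_last, Fin.snoc_last, Fin.val_last]
      rfl
    · rw [Fin.snoc_castSucc, Fin.snoc_castSucc, Fin.val_castSucc]

end StateSpaceModel

/-- The total weight of the particles at time `t`. -/
def weightTotal (t : ℕ) (d : Swarm N X) : ℝ≥0 := ∑ i, (d t i).2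

namespace StateSpaceModel

variable (M : StateSpaceModel X)

/-- The probability of an index path under the backward Markov chain, with `a / 0 = 0`. -/
def indexWeight (d : Swarm N X) (s n : ℕ) (j : Fin (n + 1) → Fin N) : ℝ≥0 :=
  (d (s + n) (j (Fin.last n))).2 / weightTotal (s + n) d *
    ∏ k : Fin n, (d (s + k) (j k.castSucc)).2 *
      M.q (d (s + k) (j k.castSucc)).1 (d (s + k + 1) (j k.succ)).1 /
        M.backTotal (s + k) d (d (s + k + 1) (j k.succ)).1

/-- The probability of an index path under the backward Markov chain, with uniform transition
probabilities wherever the backward weights vanish. -/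
def backWeight (d : Swarm N X) (s n : ℕ) (j : Fin (n + 1) → Fin N) : ℝ≥0 :=
  (d (s + n) (j (Fin.last n))).2 / weightTotal (s + n) d * M.backProd d s n j

/-- Every particle of positive weight can be reached from a particle of positive weight. -/
def IsReachable (t : ℕ) (d : Swarm N X) : Prop :=
  ∀ u < t, ∀ i, (d (u + 1) i).2 ≠ 0 → M.backTotal u d (d (u + 1) i).1 ≠ 0

variable {M}

lemma IsReachable.mono {t t' : ℕ} {d : Swarm N X} (h : M.IsReachable t' d) (htt : t ≤ t') :
    M.IsReachable t d := fun u hu => h u (hu.trans_le htt)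

/-- If the terminal weight is nonzero, reachability excludes a vanishing denominator in the last
transition. That transition contains the weight of the preceding particle as a factor, so the
remaining product is again multiplied by its own terminal weight and the induction proceeds. -/
lemma weight_mul_backProd {d : Swarm N X} {s n : ℕ} (h : M.IsReachable (s + n) d)
    (j : Fin (n + 1) → Fin N) :
    (d (s + n) (j (Fin.last n))).2 * M.backProd d s n j = (d (s + n) (j (Fin.last n))).2 *
      ∏ k : Fin n, (d (s + k) (j k.castSucc)).2 *
      M.q (d (s + k) (j k.castSucc)).1 (d (s + k + 1) (j k.succ)).1 /
        M.backTotal (s + k) d (d (s + k + 1) (j k.succ)).1 := by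
  induction n with
  | zero => simp [backProd]
  | succ n ih =>
    by_cases h0 : (d (s + (n + 1)) (j (Fin.last (n + 1)))).2 = 0
    · rw [h0, zero_mul, zero_mul]
    have h1 := ih (h.mono (by omega)) fun k => j k.castSucc
    have h2 : M.backTotal (s + n) d (d (s + n + 1) (j (Fin.last (n + 1)))).1 ≠ 0 :=
      h (s + n) (by omega) _ h0
    congr 1
    rw [backProd, Fin.prod_univ_castSucc, Fin.prod_univ_castSucc]
    simp only [Fin.val_castSucc, Fin.val_last, Fin.succ_last, Fin.succ_castSucc]
    rw [backCoef, if_neg h2]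
    simp only [backProd] at h1
    have e : ∀ a b c e f : ℝ≥0, b * a = b * c → a * (b * e / f) = c * (b * e / f) := by
      intro a b c e f h
      calc a * (b * e / f) = b * a * (e / f) := by ring
        _ = b * c * (e / f) := by rw [h]
        _ = _ := by ring
    exact e _ _ _ _ _ h1

lemma indexWeight_eq {d : Swarm N X} {s n : ℕ} (h : M.IsReachable (s + n) d)
    (j : Fin (n + 1) → Fin N) : M.indexWeight d s n j = M.backWeight d s n j := by
  rw [indexWeight, backWeight, div_mul_eq_mul_div, div_mul_eq_mul_div, weight_mul_backProd h]

variable (M)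

lemma measurable_indexWeight (s n : ℕ) (j : Fin (n + 1) → Fin N) :
    Measurable fun d : Swarm N X => M.indexWeight d s n j := by
  unfold indexWeight weightTotal
  refine Measurable.mul (by fun_prop) (Finset.measurable_prod _ fun k _ => Measurable.div
    (Measurable.mul (by fun_prop) (M.measurable_q_comp (by fun_prop) (by fun_prop))) ?_)
  exact Measurable.comp (g := fun p : Swarm N X × X => M.backTotal (s + k) p.1 p.2)
    (f := fun d : Swarm N X => (d, (d (s + k + 1) (j k.succ)).1)) (M.measurable_backTotal _)
    (by fun_prop)

lemma measurable_backWeight (s n : ℕ) (j : Fin (n + 1) → Fin N) :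
    Measurable fun d : Swarm N X => M.backWeight d s n j := by
  unfold backWeight weightTotal backProd
  refine Measurable.mul (by fun_prop) (Finset.measurable_prod _ fun k _ => ?_)
  exact Measurable.comp (g := fun p : Swarm N X × X => M.backCoef (s + k) p.1 p.2 (j k.castSucc))
    (f := fun d : Swarm N X => (d, (d (s + k + 1) (j k.succ)).1)) (M.measurable_backCoef _ _)
    (by fun_prop)

end StateSpaceModel

namespace AuxiliaryProposal

variable {M : StateSpaceModel X} (A : AuxiliaryProposal M)

/-- The total mass of the particle estimator. -/
def estMass (t : ℕ) (d : Swarm N X) : ℝ≥0 := A.scale t d * (N : ℝ≥0)⁻¹ * weightTotal t d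

lemma measurable_estMass (t : ℕ) : Measurable fun d : Swarm N X => A.estMass t d := by
  unfold estMass weightTotal
  fun_prop

lemma integral_est_one (t : ℕ) (d : Swarm N X) :
    ∫ _, (1 : ℝ) ∂(A.est t d) = A.estMass t d := by
  rw [A.integral_est_of_forall_back fun i => integrable_const _]
  simp [estMass, weightTotal]

lemma est_eq_zero_of_weightTotal {t : ℕ} {d : Swarm N X} (h : weightTotal t d = 0) :
    A.est t d = 0 := by
  have h1 : ∀ i, (d t i).2 = 0 := fun i => Finset.sum_eq_zero_iff.1 h i (Finset.mem_univ i)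
  simp [est, h1]

variable [MeasurableSingletonClass X]

/-- The particle estimator of a function of `x_{s:s+n}` as an average over index paths. -/
lemma integral_onSegment_est (d : Swarm N X) (s n : ℕ) {H : (Fin (n + 1) → X) → ℝ}
    (hH : Measurable H) {K : ℝ} (hK : ∀ z, |H z| ≤ K) :
    ∫ y, onSegment s n H y ∂(A.est (s + n) d) = (A.estMass (s + n) d : ℝ) *
      ∑ j : Fin (n + 1) → Fin N, (M.backWeight d s n j : ℝ) *
        H (fun k => (d (s + k) (j k)).1) := by
  by_cases h0 : weightTotal (s + n) d = 0
  · rw [A.est_eq_zero_of_weightTotal h0, estMass, h0]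
    simp
  have h0' : (weightTotal (s + n) d : ℝ) ≠ 0 := by exact_mod_cast h0
  rw [A.integral_est_of_forall_back fun i => Integrable_of_abs_le
    (measurable_onSegment s n hH).aestronglyMeasurable (ae_of_all _ fun y => hK _)]
  have h1 := M.sum_integral_back d s n (H := fun i z => ((d (s + n) i).2 : ℝ) * H z)
    (fun i => hH.const_mul _) (K := (weightTotal (s + n) d : ℝ) * |K|) fun i z => by
      rw [abs_mul, NNReal.abs_eq]
      refine mul_le_mul ?_ ((hK z).trans (le_abs_self K)) (abs_nonneg _) (NNReal.coe_nonneg _)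
      exact_mod_cast Finset.single_le_sum (f := fun i => (d (s + n) i).2) (fun _ _ => zero_le)
        (Finset.mem_univ i)
  simp only [onSegment, integral_const_mul] at h1
  simp only [onSegment]
  rw [h1, estMass]
  push_cast
  rw [Finset.mul_sum, Finset.mul_sum]
  refine Finset.sum_congr rfl fun j _ => ?_
  rw [StateSpaceModel.backWeight]
  push_cast
  field_simp

/-- Apply `sum_integral_back` to the function that returns the weight of the terminal particle, and
use that each `back` is a probability measure. -/
lemma sum_backWeight {d : Swarm N X} {s n : ℕ} (h : weightTotal (s + n) d ≠ 0) :
    ∑ j : Fin (n + 1) → Fin N, M.backWeight d s n j = 1 := by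
  have h0 : (weightTotal (s + n) d : ℝ) ≠ 0 := by exact_mod_cast h
  have h1 := M.sum_integral_back d s n (H := fun i _ => ((d (s + n) i).2 : ℝ))
    (fun i => measurable_const) (K := (weightTotal (s + n) d : ℝ)) fun i z => by
      rw [NNReal.abs_eq]
      exact_mod_cast Finset.single_le_sum (f := fun i => (d (s + n) i).2) (fun _ _ => zero_le)
        (Finset.mem_univ i)
  simp only [onSegment, integral_const, probReal_univ, smul_eq_mul, one_mul] at h1
  have h2 : (weightTotal (s + n) d : ℝ) * ∑ j : Fin (n + 1) → Fin N, (M.backWeight d s n j : ℝ) =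
      weightTotal (s + n) d := by
    rw [Finset.mul_sum]
    conv_rhs => rw [weightTotal]
    push_cast
    rw [h1]
    refine Finset.sum_congr rfl fun j _ => ?_
    rw [StateSpaceModel.backWeight]
    push_cast
    field_simp
  have h3 := mul_left_cancel₀ h0 (h2.trans (mul_one _).symm)
  exact_mod_cast h3

end AuxiliaryProposal

end BackwardPaths

/-! ### Runs of the auxiliary particle filter as Markov chains of particle systems. -/

section ParticleFilters

variable {X : Type*} [MeasurableSpace X] {N : ℕ}

namespace AuxiliaryProposal

variable {M : StateSpaceModel X} (A : AuxiliaryProposal M) {Ω : Type*}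
  (ξ : ℕ → Fin N → Ω → X) (I : ℕ → Fin N → Ω → Fin N)

/-- The weighted particle systems of a run of the filter, frozen at time `t`. -/
def cloud (t : ℕ) (ω : Ω) : Swarm N X := fun u i =>
  (ξ (min u t) i ω, (A.weight ξ I (min u t) i ω).toNNReal)

lemma weight_nonneg (t : ℕ) (i : Fin N) (ω : Ω) : 0 ≤ A.weight ξ I t i ω := by
  cases t <;> exact ENNReal.toReal_nonneg

lemma cloud_fst {u t : ℕ} (h : u ≤ t) (ω : Ω) (i : Fin N) :
    (A.cloud ξ I t ω u i).1 = ξ u i ω := by simp [cloud, h]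

lemma coe_cloud_snd {u t : ℕ} (h : u ≤ t) (ω : Ω) (i : Fin N) :
    ((A.cloud ξ I t ω u i).2 : ℝ) = A.weight ξ I u i ω := by
  simp [cloud, h, A.weight_nonneg ξ I u i ω]

lemma coe_multTotal_cloud {u t : ℕ} (h : u ≤ t) (ω : Ω) :
    (A.multTotal u (A.cloud ξ I t ω) : ℝ) =
      ∑ i, A.weight ξ I u i ω * (A.ϑ (u + 1) (ξ u i ω) : ℝ) := by
  rw [multTotal]
  push_cast
  simp_rw [A.coe_cloud_snd ξ I h, A.cloud_fst ξ I h]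

lemma coe_weightTotal_cloud {u t : ℕ} (h : u ≤ t) (ω : Ω) :
    (weightTotal u (A.cloud ξ I t ω) : ℝ) = ∑ i, A.weight ξ I u i ω := by
  rw [weightTotal]
  push_cast
  simp_rw [A.coe_cloud_snd ξ I h]

lemma scale_ne_zero_iff (t : ℕ) (d : Swarm N X) :
    A.scale t d ≠ 0 ↔ ∀ u < t, A.multTotal u d ≠ 0 := by
  rw [scale, Finset.prod_ne_zero_iff]
  refine forall_congr' fun u => ?_
  rw [Finset.mem_range]
  refine imp_congr_right fun _ => ⟨fun h h0 => h (by rw [h0, mul_zero]), fun h => ?_⟩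
  rcases eq_or_ne N 0 with rfl | hN
  · simp [multTotal] at h
  · exact mul_ne_zero (inv_ne_zero (by exact_mod_cast hN)) h

lemma mem_alive_iff {t t' : ℕ} (h : t ≤ t' + 1) (ω : Ω) :
    ω ∈ A.alive ξ I t ↔ A.scale t (A.cloud ξ I t' ω) ≠ 0 := by
  rw [scale_ne_zero_iff]
  refine forall_congr' fun u => imp_congr_right fun hu => ?_
  rw [← A.coe_multTotal_cloud ξ I (show u ≤ t' by omega), ← pos_iff_ne_zero]
  exact NNReal.coe_pos

/-- Freezing at time `t + 1` repeats the last generation at all later times, which matches the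
values that `next` assigns there. -/
lemma cloud_succ (t : ℕ) (ω : Ω) : A.cloud ξ I (t + 1) ω =
    A.next t (A.cloud ξ I t ω) fun i => (I (t + 1) i ω, ξ (t + 1) i ω) := by
  funext u i
  rcases Nat.lt_or_ge t u with h | h
  · simp only [next, not_le.2 h, if_false, A.cloud_fst ξ I le_rfl]
    simp only [cloud, min_eq_right (show t + 1 ≤ u by omega)]
    refine Prod.ext rfl ?_
    simp [weight, wt]
  · simp only [next, h, if_true, cloud, min_eq_left h, min_eq_left (show u ≤ t + 1 by omega)]

lemma cloud_zero (ω : Ω) : A.cloud ξ I 0 ω = A.initSwarm fun i => ξ 0 i ω := by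
  funext u i
  simp only [cloud, Nat.min_zero, initSwarm]
  refine Prod.ext rfl ?_
  simp [weight]

lemma inst_cloud (t : ℕ) (ω : Ω) : A.inst t (A.cloud ξ I t ω) =
    A.instrumental (t + 1) (fun i => ξ t i ω) fun i => A.weight ξ I t i ω := by
  simp only [inst, A.coe_cloud_snd ξ I le_rfl, A.cloud_fst ξ I le_rfl]

/-- Events defined through the frozen system belong to the history, so the conditional law
prescribed given `F_t` specializes to one given the system. -/
lemma measurable_cloud_history (t : ℕ) : Measurable[A.history ξ I t] (A.cloud ξ I t) := by
  refine @measurable_pi_lambda _ _ _ (A.history ξ I t) _ _ fun u =>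
    @measurable_pi_lambda _ _ _ (A.history ξ I t) _ _ fun i => ?_
  have h1 : Measurable[MeasurableSpace.comap (fun ω => (ξ (min u t) i ω,
      A.weight ξ I (min u t) i ω)) inferInstance]
      fun ω => (ξ (min u t) i ω, A.weight ξ I (min u t) i ω) := comap_measurable _
  have h2 : Measurable[A.history ξ I t]
      fun ω => (ξ (min u t) i ω, A.weight ξ I (min u t) i ω) :=
    h1.mono ((le_iSup (fun i => MeasurableSpace.comap (fun ω => (ξ (min u t) i ω,
      A.weight ξ I (min u t) i ω)) inferInstance) i).trans
      (le_iSup₂_of_le (min u t) (min_le_right u t) le_rfl)) le_rfl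
  have h3 : Measurable fun p : X × ℝ => (p.1, p.2.toNNReal) := by fun_prop
  exact h3.comp h2

variable [MeasurableSpace Ω] {P : Measure Ω} {T : ℕ} {ξ I}

/-- A run of the auxiliary particle filter as a Markov chain of particle systems. -/
lemma IsParticleFilter.isRun [IsFiniteMeasure P] (h : A.IsParticleFilter P T ξ I) :
    A.IsRun P T (A.cloud ξ I) fun t ω i => (I (t + 1) i ω, ξ (t + 1) i ω) := by
  have hZ : ∀ t, Measurable fun ω i => (I (t + 1) i ω, ξ (t + 1) i ω) := fun t =>
    measurable_pi_iff.2 fun i => (h.measurable_ancestor _ i).prodMk (h.measurable_particle _ i)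
  have hξ0 : Measurable fun ω i => ξ 0 i ω := measurable_pi_iff.2 fun i => h.measurable_particle 0 i
  have hD : ∀ t, Measurable (A.cloud ξ I t) := fun t => by
    induction t with
    | zero =>
      have e : A.cloud ξ I 0 = fun ω => A.initSwarm fun i => ξ 0 i ω :=
        funext fun ω => A.cloud_zero ξ I ω
      rw [e]
      exact A.measurable_initSwarm.comp hξ0
    | succ t ih =>
      have e : A.cloud ξ I (t + 1) = fun ω => A.next t (A.cloud ξ I t ω)
          fun i => (I (t + 1) i ω, ξ (t + 1) i ω) := funext fun ω => A.cloud_succ ξ I t ω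
      rw [e]
      exact (A.measurable_next t).comp (ih.prodMk (hZ t))
  refine ⟨hD, hZ, ?_, fun t ω => A.cloud_succ ξ I t ω, fun t ht => ?_⟩
  · have e : A.cloud ξ I 0 = A.initSwarm ∘ fun ω i => ξ 0 i ω :=
      funext fun ω => A.cloud_zero ξ I ω
    rw [e, ← Measure.map_map A.measurable_initSwarm hξ0, h.law_zero]
  · refine IsCondLawOn.of_forall (hD t) (hZ t) fun B hB S hS => ?_
    have hal : A.cloud ξ I t ⁻¹' {d | A.scale (t + 1) d ≠ 0} = A.alive ξ I (t + 1) := by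
      ext ω
      exact (A.mem_alive_iff ξ I le_rfl ω).symm
    rw [hal]
    refine (h.law_succ t ht _ (A.measurable_cloud_history ξ I t hB) S hS).trans ?_
    simp_rw [instKernel_apply, inst_cloud]

/-- Almost surely, the particles are drawn from ancestors of positive weight. -/
lemma ae_inst (t : ℕ) (d : Swarm N X) : ∀ᵐ z ∂(A.inst t d), (d t z.1).2 ≠ 0 := by
  have hm : Measurable fun z : Fin N × X => (d t z.1).2 :=
    (Measurable.of_discrete (f := fun i : Fin N => (d t i).2)).comp measurable_fst
  have hms : MeasurableSet {z : Fin N × X | (d t z.1).2 = 0} := hm (measurableSet_singleton 0)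
  have h1 : A.inst t d {z : Fin N × X | (d t z.1).2 = 0} = 0 := by
    rw [← lintegral_indicator_one hms, A.lintegral_inst _ _ (measurable_one.indicator hms)]
    refine Finset.sum_eq_zero fun i _ => ?_
    by_cases h0 : (d t i).2 = 0
    · simp [h0]
    · simp [h0]
  rw [ae_iff]
  simpa using h1

/-- Almost surely, on the event that the filter has not degenerated, every particle of positive
weight can be reached from a particle of positive weight. -/
lemma IsRun.ae_isReachable [IsProbabilityMeasure P] {D : ℕ → Ω → Swarm N X}
    {Z : ℕ → Ω → Fin N → Fin N × X} (h : A.IsRun P T D Z) {t : ℕ} (ht : t ≤ T) :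
    ∀ᵐ ω ∂P, A.scale t (D t ω) ≠ 0 → M.IsReachable t (D t ω) := by
  induction t with
  | zero => exact ae_of_all _ fun ω _ u hu => absurd hu (Nat.not_lt_zero u)
  | succ t ih =>
    set B : Set (Swarm N X × (Fin N → Fin N × X)) :=
      ⋃ i, {p | A.scale (t + 1) p.1 ≠ 0 ∧ (p.1 t (p.2 i).1).2 = 0} with hB
    have hBm : MeasurableSet B := by
      refine MeasurableSet.iUnion fun i => MeasurableSet.inter ?_ ?_
      · exact ((A.measurable_scale (t + 1)).comp measurable_fst)
          (measurableSet_singleton 0).compl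
      · have h1 : Measurable fun p : Fin N × Swarm N X => (p.2 t p.1).2 :=
          measurable_from_prod_countable_right fun j => Swarm.measurable_weight t j
        have h2 : Measurable fun p : Swarm N X × (Fin N → Fin N × X) => (p.1 t (p.2 i).1).2 :=
          h1.comp (f := fun p : Swarm N X × (Fin N → Fin N × X) => ((p.2 i).1, p.1))
            (by fun_prop)
        exact h2 (measurableSet_singleton 0)
    have hnull : P ((fun ω => (D t ω, Z t ω)) ⁻¹' B) = 0 := by
      rw [← lintegral_indicator_one (((h.measurable_D t).prodMk (h.measurable_Z t)) hBm)]
      have h3 := h.lintegral_next (t := t) (by omega) (F := B.indicator 1)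
        (measurable_one.indicator hBm) fun d z h0 => by simp [hB, h0]
      refine (h3.trans (setLIntegral_congr_fun (g := fun _ => 0) (h.measurableSet_alive t)
        fun ω hω => ?_)).trans lintegral_zero
      have hω' : A.scale (t + 1) (D t ω) ≠ 0 := hω
      have := A.isProbabilityMeasure_inst (A.multTotal_ne_zero_of_scale hω')
      have h4 : ∀ᵐ z ∂(Measure.pi fun _ : Fin N => A.inst t (D t ω)), ∀ i,
          (D t ω t (z i).1).2 ≠ 0 := ae_all_iff.2 fun i =>
        (measurePreserving_eval (fun _ : Fin N => A.inst t (D t ω)) i).quasiMeasurePreserving.ae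
          (A.ae_inst t (D t ω))
      rw [instKernel_apply]
      refine (lintegral_congr_ae (h4.mono fun z hz => ?_)).trans lintegral_zero
      simp [hB, hz]
    filter_upwards [ih (by omega), measure_eq_zero_iff_ae_notMem.1 hnull] with ω hω hωB hs u hu i hi
    rw [h.next_eq] at hs hi ⊢
    rw [scale_next] at hs
    rcases Nat.lt_or_ge u t with hut | hut
    · have h5 := hω (fun h0 => hs (A.scale_eq_zero_of_le (Nat.le_succ t) h0)) u hut i
      rw [A.next_of_le (by omega)] at hi
      have h6 := h5 hi
      rw [A.next_of_le (show u + 1 ≤ t by omega)]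
      simpa only [StateSpaceModel.backTotal, A.next_of_le hut.le] using h6
    · obtain rfl : u = t := by omega
      rw [A.next_succ] at hi ⊢
      simp only at hi ⊢
      -- The ancestor of the new particle witnesses reachability: almost surely its weight is
      -- nonzero, and `q` from it to the new particle is nonzero because it is a factor of the
      -- numerator of the new weight.
      have h7 : (D u ω u (Z u ω i).1).2 ≠ 0 := fun h0 =>
        hωB (Set.mem_iUnion.2 ⟨i, hs, h0⟩)
      have h8 : M.q (D u ω u (Z u ω i).1).1 (Z u ω i).2 ≠ 0 := by
        intro h0
        exact hi (by simp [wt, w, h0])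
      simp only [StateSpaceModel.backTotal, A.next_of_le le_rfl]
      intro h9
      exact mul_ne_zero h7 h8 (Finset.sum_eq_zero_iff.1 h9 (Z u ω i).1 (Finset.mem_univ _))

variable (ξ I)

omit [MeasurableSpace Ω] in
lemma pathWeight_eq (s n : ℕ) (j : Fin (n + 1) → Fin N) (ω : Ω) :
    A.pathWeight ξ I s n j ω = M.indexWeight (A.cloud ξ I (s + n) ω) s n j := by
  have h1 : ∀ k : Fin n, s + (k : ℕ) ≤ s + n := fun k => by omega
  have h2 : ∀ k : Fin n, s + (k : ℕ) + 1 ≤ s + n := fun k => by omega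
  rw [pathWeight, StateSpaceModel.indexWeight]
  push_cast
  rw [A.coe_weightTotal_cloud ξ I le_rfl, A.coe_cloud_snd ξ I le_rfl]
  congr 1
  refine Finset.prod_congr rfl fun k _ => ?_
  rw [StateSpaceModel.backTotal]
  push_cast
  simp_rw [A.coe_cloud_snd ξ I (h1 k), A.cloud_fst ξ I (h1 k), A.cloud_fst ξ I (h2 k)]

omit [MeasurableSpace Ω] in
lemma ffbsm_eq (s n : ℕ) (h : (Fin (n + 1) → X) → ℝ) (ω : Ω) :
    A.ffbsm ξ I s n h ω = ∑ j : Fin (n + 1) → Fin N,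
      (M.indexWeight (A.cloud ξ I (s + n) ω) s n j : ℝ) *
        h (fun k => (A.cloud ξ I (s + n) ω (s + k) (j k)).1) := by
  rw [ffbsm]
  refine Finset.sum_congr rfl fun j _ => ?_
  rw [pathWeight_eq]
  congr 2
  funext k
  rw [A.cloud_fst ξ I (by omega)]

omit [MeasurableSpace Ω] in
lemma ffbsi_eq (s n : ℕ) (J : Fin N → Ω → Fin (n + 1) → Fin N) (h : (Fin (n + 1) → X) → ℝ) (ω : Ω) :
    ffbsi ξ s n J h ω = (N : ℝ)⁻¹ * ∑ ℓ,
      h (fun k => (A.cloud ξ I (s + n) ω (s + k) (J ℓ ω k)).1) := by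
  rw [ffbsi]
  congr 1
  refine Finset.sum_congr rfl fun ℓ _ => ?_
  congr 1
  funext k
  rw [A.cloud_fst ξ I (by omega)]

end AuxiliaryProposal

end ParticleFilters

/-! ### FFBSm as a ratio of particle estimators, and the conditional law of FFBSi. -/

section BackwardSmoothing

variable {X : Type*} [MeasurableSpace X]

namespace AuxiliaryProposal

variable {M : StateSpaceModel X} {A : AuxiliaryProposal M} {T : ℕ} {C : ℝ≥0}

lemma estMass_le (hC : A.BoundedBy T C) {N : ℕ} {t : ℕ} (ht : t ≤ T) {d : Swarm N X}
    (hd : ∀ u ≤ t, ∀ i, (d u i).2 ≤ C) : A.estMass t d ≤ (C * C) ^ t * C := by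
  rw [estMass, mul_assoc]
  refine mul_le_mul' (A.scale_le hC ht fun u hu => hd u hu.le) ?_
  rcases eq_or_ne N 0 with rfl | hN
  · simp
  have hN' : (N : ℝ≥0) ≠ 0 := by exact_mod_cast hN
  calc (N : ℝ≥0)⁻¹ * weightTotal t d ≤ (N : ℝ≥0)⁻¹ * ∑ _i : Fin N, C := by
        unfold weightTotal
        gcongr with i
        exact hd t le_rfl i
    _ = C := by
        rw [Finset.sum_const, Finset.card_univ, Fintype.card_fin, nsmul_eq_mul, ← mul_assoc,
          inv_mul_cancel₀ hN', one_mul]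

lemma abs_integral_est_le {N : ℕ} (t : ℕ) (d : Swarm N X) {f : (ℕ → X) → ℝ} {K : ℝ}
    (hK : ∀ y, |f y| ≤ K) : |∫ y, f y ∂(A.est t d)| ≤ K * A.estMass t d := by
  have h1 : (A.est t d).real Set.univ = A.estMass t d := by
    rw [← A.integral_est_one t d]
    simp
  rw [← h1]
  exact norm_integral_le_of_norm_le_const (f := f) (ae_of_all _ hK)

variable [MeasurableSingletonClass X]

/-- The self-normalized estimator over index paths as a ratio of particle estimators. -/
lemma estMass_mul_sub {N : ℕ} {s n : ℕ} {d : Swarm N X}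
    (hd : A.scale (s + n) d ≠ 0 → M.IsReachable (s + n) d) {H : (Fin (n + 1) → X) → ℝ}
    (hH : Measurable H) (c : ℝ) {K : ℝ} (hK : ∀ z, |H z - c| ≤ K) :
    (A.estMass (s + n) d : ℝ) * (∑ j : Fin (n + 1) → Fin N, (M.indexWeight d s n j : ℝ) *
        H (fun k => (d (s + k) (j k)).1) - c) =
      ∫ y, onSegment s n (fun z => H z - c) y ∂(A.est (s + n) d) := by
  rw [A.integral_onSegment_est d s n (hH.sub_const c) hK]
  by_cases h0 : A.estMass (s + n) d = 0
  · simp [h0]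
  have h1 : weightTotal (s + n) d ≠ 0 := fun h => h0 (by simp [estMass, h])
  have h2 : A.scale (s + n) d ≠ 0 := fun h => h0 (by simp [estMass, h])
  congr 1
  simp_rw [M.indexWeight_eq (hd h2), mul_sub]
  rw [Finset.sum_sub_distrib, ← Finset.sum_mul]
  have h3 : ∑ j : Fin (n + 1) → Fin N, (M.backWeight d s n j : ℝ) = 1 := by
    exact_mod_cast sum_backWeight (M := M) h1
  rw [h3, one_mul]

variable {Ω : Type*} [MeasurableSpace Ω] {P : Measure Ω} [IsProbabilityMeasure P]

section Limits

variable {D : (N : ℕ) → ℕ → Ω → Swarm N X} {Z : (N : ℕ) → ℕ → Ω → Fin N → Fin N × X}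

lemma tendsto_lintegral_estMass (h : ∀ N, A.IsRun P T (D N) (Z N)) (hC : A.BoundedBy T C) {t : ℕ}
    (ht : t ≤ T) :
    Tendsto (fun N => ∫⁻ ω, ‖(A.estMass t (D N t ω) : ℝ) - M.mass t‖ₑ ∂P) atTop (𝓝 0) := by
  have h1 := tendsto_lintegral_enorm_est_sub h hC ht (f := fun _ => 1) measurable_const (K := 1)
    zero_le_one (by simp)
  simp_rw [A.integral_est_one] at h1
  simpa [StateSpaceModel.mass] using h1

lemma tendstoInMeasure_estMass (h : ∀ N, A.IsRun P T (D N) (Z N)) (hC : A.BoundedBy T C) {t : ℕ}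
    (ht : t ≤ T) :
    TendstoInMeasure P (fun N ω => (A.estMass t (D N t ω) : ℝ)) atTop fun _ => M.mass t := by
  refine tendstoInMeasure_of_tendsto_eLpNorm one_ne_zero
    (fun N => ((A.measurable_estMass t).comp ((h N).measurable_D t)).coe_nnreal_real.aestronglyMeasurable)
    aestronglyMeasurable_const ?_
  simp_rw [eLpNorm_one_eq_lintegral_enorm]
  exact tendsto_lintegral_estMass h hC ht

/-- The central limit theorem for the unnormalized particle estimator. -/
lemma tendstoInDistribution_est (h : ∀ N, A.IsRun P T (D N) (Z N)) (hC : A.BoundedBy T C)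
    {f : (ℕ → X) → ℝ} (hf : Measurable f) {K : ℝ} (hK0 : 0 ≤ K)
    (hK : ∀ y, |f y| ≤ K) (h0 : ∫ y, f y ∂(M.pathMeasure T) = 0) :
    TendstoInDistribution (fun (N : ℕ) ω => √(N : ℝ) * ∫ y, f y ∂(A.est T (D N T ω))) atTop id
      (fun _ => P) (gaussianReal 0 (A.pathVar T f T).toNNReal) := by
  refine tendstoInDistribution_gaussian (fun N => ?_) (A.pathVar_nonneg T f T) fun u => ?_
  · exact (((A.measurable_integral_est T hf).comp ((h N).measurable_D T)).const_mul _).aemeasurable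
  · have h1 := tendsto_charFun_est h hC hf hK0 hK h0 u le_rfl
    simpa [StateSpaceModel.L, StateSpaceModel.Laux] using h1

end Limits

section BackwardSampling

variable {N : ℕ}

/-- The law of one index path under the backward Markov chain. -/
def backwardLaw (M : StateSpaceModel X) (s n : ℕ) (d : Swarm N X) :
    Measure (Fin (n + 1) → Fin N) :=
  ∑ j, M.backWeight d s n j • Measure.dirac j

omit [MeasurableSingletonClass X] in
lemma backwardLaw_singleton (s n : ℕ) (d : Swarm N X) (j : Fin (n + 1) → Fin N) :
    backwardLaw M s n d {j} = M.backWeight d s n j := by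
  classical
  rw [backwardLaw, Measure.finsetSum_apply, Finset.sum_eq_single j]
  · simp
  · intro j' _ hj
    simp [hj]
  · simp

omit [MeasurableSingletonClass X] in
lemma measurable_backwardLaw (s n : ℕ) : Measurable fun d : Swarm N X => backwardLaw M s n d := by
  refine Measure.measurable_of_measurable_coe _ fun S hS => ?_
  simp only [backwardLaw, Measure.finsetSum_apply]
  refine Finset.measurable_sum _ fun j _ => ?_
  exact (M.measurable_backWeight s n j).coe_nnreal_ennreal.mul_const _

omit [MeasurableSingletonClass X] in
lemma integral_backwardLaw (s n : ℕ) (d : Swarm N X) (F : (Fin (n + 1) → Fin N) → ℝ) :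
    ∫ j, F j ∂(backwardLaw M s n d) = ∑ j, (M.backWeight d s n j : ℝ) * F j := by
  rw [backwardLaw, integral_finsetSum_measure fun j _ => (integrable_dirac (by simp)).smul_measure_nnreal]
  simp_rw [integral_smul_nnreal_measure, integral_dirac]
  rfl

lemma isProbabilityMeasure_backwardLaw {s n : ℕ} {d : Swarm N X} (h : weightTotal (s + n) d ≠ 0) :
    IsProbabilityMeasure (backwardLaw M s n d) := by
  refine ⟨?_⟩
  rw [backwardLaw, Measure.finsetSum_apply]
  simp only [Measure.smul_apply, measure_univ]
  have := sum_backWeight (M := M) h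
  simp only [ENNReal.smul_def, smul_eq_mul, mul_one]
  exact_mod_cast this

lemma backwardLaw_univ_le (s n : ℕ) (d : Swarm N X) : backwardLaw M s n d Set.univ ≤ 1 := by
  by_cases h : weightTotal (s + n) d = 0
  · simp [backwardLaw, StateSpaceModel.backWeight, h]
  · have := isProbabilityMeasure_backwardLaw (M := M) h
    exact prob_le_one

instance (s n : ℕ) (d : Swarm N X) : IsFiniteMeasure (backwardLaw M s n d) := by
  unfold backwardLaw; infer_instance

/-- The law of `N` independent index paths under the backward Markov chain. -/
def backwardKernel (M : StateSpaceModel X) (s n : ℕ) :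
    Kernel (Swarm N X) (Fin N → Fin (n + 1) → Fin N) :=
  ⟨fun d => Measure.pi fun _ => backwardLaw M s n d, measurable_pi_const (measurable_backwardLaw s n)⟩

omit [MeasurableSingletonClass X] in
lemma backwardKernel_apply (s n : ℕ) (d : Swarm N X) :
    backwardKernel M s n d = Measure.pi fun _ => backwardLaw M s n d := rfl

instance (s n : ℕ) : IsFiniteKernel (backwardKernel (N := N) M s n) :=
  ⟨⟨1, ENNReal.one_lt_top, fun d => by
    rw [backwardKernel_apply, Measure.pi_univ]
    exact Finset.prod_le_one' fun _ _ => backwardLaw_univ_le s n d⟩⟩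

/-- The sampling hypothesis gives the probabilities of individual index tuples, which determine the
law on a finite set. It uses the weights with `0/0 = 0`; by reachability these almost surely equal
the weights of `backwardLaw` on the event where the filter is alive and its final weights are not
all zero. -/
lemma IsBackwardSample.isCondLawOn {ξ : ℕ → Fin N → Ω → X} {I : ℕ → Fin N → Ω → Fin N} {s n : ℕ}
    (h : A.IsParticleFilter P (s + n) ξ I) {J : Fin N → Ω → Fin (n + 1) → Fin N}
    (hJ : A.IsBackwardSample P ξ I s n J) :
    IsCondLawOn P (A.cloud ξ I (s + n)) (fun ω ℓ => J ℓ ω) (backwardKernel M s n)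
      {d | A.scale (s + n) d ≠ 0 ∧ weightTotal (s + n) d ≠ 0} := by
  have hrun := h.isRun
  have hJm : Measurable fun ω ℓ => J ℓ ω := measurable_pi_iff.2 hJ.measurable
  have hD := hrun.measurable_D (s + n)
  set G : Set (Swarm N X) := {d | A.scale (s + n) d ≠ 0 ∧ weightTotal (s + n) d ≠ 0} with hG
  have hGm : MeasurableSet G := by
    refine MeasurableSet.inter (A.measurable_scale _ (measurableSet_singleton 0).compl) ?_
    have : Measurable fun d : Swarm N X => weightTotal (s + n) d := by
      unfold weightTotal; fun_prop
    exact this (measurableSet_singleton 0).compl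
  refine IsCondLawOn.of_forall hD hJm fun B hB S hS => ?_
  set E := A.cloud ξ I (s + n) ⁻¹' B ∩ A.cloud ξ I (s + n) ⁻¹' G with hE
  have hEm : MeasurableSet E := (hD hB).inter (hD hGm)
  have hκ : Measurable fun ω => backwardKernel M s n (A.cloud ξ I (s + n) ω) :=
    (backwardKernel M s n).measurable.comp hD
  have key : (P.restrict E).map (fun ω ℓ => J ℓ ω) =
      (P.restrict E).bind fun ω => backwardKernel M s n (A.cloud ξ I (s + n) ω) := by
    refine Measure.ext_of_singleton fun j => ?_
    have hj : MeasurableSet {j} := measurableSet_singleton j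
    rw [Measure.map_apply hJm hj, Measure.restrict_apply (hJm hj),
      Measure.bind_apply hj hκ.aemeasurable, Set.inter_comm]
    have hlaw := hJ.law E (((A.measurable_cloud_history ξ I (s + n)) (hB.inter hGm))) ?_ j
    · have e : E ∩ (fun ω ℓ => J ℓ ω) ⁻¹' {j} = E ∩ {ω | ∀ ℓ, J ℓ ω = j ℓ} := by
        ext ω
        simp [funext_iff]
      rw [e, hlaw]
      refine lintegral_congr_ae ((ae_restrict_iff' hEm).2 ?_)
      filter_upwards [IsRun.ae_isReachable A hrun le_rfl] with ω hω hωE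
      rw [backwardKernel_apply, Measure.pi_singleton,
        ENNReal.ofReal_prod_of_nonneg fun ℓ _ => by rw [A.pathWeight_eq]; exact NNReal.coe_nonneg _]
      refine Finset.prod_congr rfl fun ℓ _ => ?_
      rw [backwardLaw_singleton, A.pathWeight_eq, M.indexWeight_eq (hω hωE.2.1),
        ENNReal.ofReal_coe_nnreal]
    · intro ω hω
      refine ⟨(A.mem_alive_iff ξ I (Nat.le_succ _) ω).2 hω.2.1, ?_⟩
      change 0 < ∑ i, A.weight ξ I (s + n) i ω
      rw [← A.coe_weightTotal_cloud ξ I le_rfl]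
      exact NNReal.coe_pos.2 (pos_iff_ne_zero.2 hω.2.2)
  have h2 := congrArg (fun μ => μ S) key
  rw [Measure.map_apply hJm hS, Measure.restrict_apply (hJm hS),
    Measure.bind_apply hS hκ.aemeasurable, Set.inter_comm] at h2
  exact h2

end BackwardSampling

end AuxiliaryProposal

end BackwardSmoothing

/-! ### The extra randomness of backward simulation. -/

section BackwardSimulation

variable {X : Type*} [MeasurableSpace X]

namespace AuxiliaryProposal

variable {M : StateSpaceModel X} {A : AuxiliaryProposal M} {s n : ℕ} {C : ℝ≥0}

/-- The average of `H` over `N` particle trajectories with given index paths. -/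
def pathAverage {N : ℕ} (s n : ℕ) (H : (Fin (n + 1) → X) → ℝ)
    (p : Swarm N X × (Fin N → Fin (n + 1) → Fin N)) : ℝ :=
  (N : ℝ)⁻¹ * ∑ ℓ, H fun k => (p.1 (s + k) (p.2 ℓ k)).1

lemma measurable_pathAverage {N : ℕ} (s n : ℕ) {H : (Fin (n + 1) → X) → ℝ} (hH : Measurable H) :
    Measurable (pathAverage (N := N) s n H) := by
  refine measurable_from_prod_countable_left fun j => ?_
  unfold pathAverage
  refine (Finset.measurable_sum _ fun ℓ _ => ?_).const_mul _
  exact hH.comp (by fun_prop)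

/-- The conditional variance of the backward simulation step. -/
def simVar (A : AuxiliaryProposal M) {N : ℕ} (s n : ℕ) (H : (Fin (n + 1) → X) → ℝ)
    (d : Swarm N X) : ℝ :=
  (A.estMass (s + n) d : ℝ) * ∫ y, onSegment s n (fun z => H z ^ 2) y ∂(A.est (s + n) d) -
    (∫ y, onSegment s n H y ∂(A.est (s + n) d)) ^ 2

lemma est_eq_zero_of_degenerate {N : ℕ} {d : Swarm N X}
    (h : ¬ (A.scale (s + n) d ≠ 0 ∧ weightTotal (s + n) d ≠ 0)) :
    A.est (s + n) d = 0 ∧ A.estMass (s + n) d = 0 := by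
  by_cases h1 : A.scale (s + n) d = 0
  · exact ⟨A.est_eq_zero_of_scale h1, by simp [estMass, h1]⟩
  · have h2 : weightTotal (s + n) d = 0 := by
      by_contra h2
      exact h ⟨h1, h2⟩
    exact ⟨A.est_eq_zero_of_weightTotal h2, by simp [estMass, h2]⟩

variable [MeasurableSingletonClass X]

/-- The mean and the variance of one simulated trajectory. -/
lemma backwardLaw_moments {N : ℕ} {d : Swarm N X} (h : weightTotal (s + n) d ≠ 0)
    {H : (Fin (n + 1) → X) → ℝ} (hH : Measurable H) {K : ℝ} (hK : ∀ z, |H z| ≤ K) :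
    (∫ j, ((A.estMass (s + n) d : ℝ) * H (fun k => (d (s + k) (j k)).1) -
        ∫ y, onSegment s n H y ∂(A.est (s + n) d)) ∂(backwardLaw M s n d) = 0) ∧
    ∫ j, ((A.estMass (s + n) d : ℝ) * H (fun k => (d (s + k) (j k)).1) -
        ∫ y, onSegment s n H y ∂(A.est (s + n) d)) ^ 2 ∂(backwardLaw M s n d) =
      A.simVar s n H d := by
  have h1 := A.integral_onSegment_est d s n hH hK
  have h2 := A.integral_onSegment_est d s n (hH.pow_const 2) (K := K ^ 2) fun z => by
    rw [abs_pow]; exact pow_le_pow_left₀ (abs_nonneg _) (hK z) 2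
  have h3 : ∑ j : Fin (n + 1) → Fin N, (M.backWeight d s n j : ℝ) = 1 := by
    exact_mod_cast sum_backWeight (M := M) h
  set m := ∫ y, onSegment s n H y ∂(A.est (s + n) d) with hm
  constructor
  · rw [integral_backwardLaw]
    simp_rw [mul_sub]
    rw [Finset.sum_sub_distrib, ← Finset.sum_mul, h3, one_mul, sub_eq_zero, h1, Finset.mul_sum]
    refine Finset.sum_congr rfl fun j _ => ?_
    ring
  · rw [integral_backwardLaw, simVar, h2, ← hm]
    have e : ∀ j : Fin (n + 1) → Fin N, (M.backWeight d s n j : ℝ) *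
        ((A.estMass (s + n) d : ℝ) * H (fun k => (d (s + k) (j k)).1) - m) ^ 2 =
        (A.estMass (s + n) d : ℝ) ^ 2 * ((M.backWeight d s n j : ℝ) *
          H (fun k => (d (s + k) (j k)).1) ^ 2) -
        2 * m * (A.estMass (s + n) d : ℝ) * ((M.backWeight d s n j : ℝ) *
          H (fun k => (d (s + k) (j k)).1)) + m ^ 2 * (M.backWeight d s n j : ℝ) := fun j => by
      ring
    simp_rw [e]
    rw [Finset.sum_add_distrib, Finset.sum_sub_distrib, ← Finset.mul_sum, ← Finset.mul_sum,
      ← Finset.mul_sum, h3, mul_assoc (2 * m), ← h1]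
    ring

lemma simVar_nonneg {N : ℕ} {H : (Fin (n + 1) → X) → ℝ} (hH : Measurable H) {K : ℝ}
    (hK : ∀ z, |H z| ≤ K) (d : Swarm N X) : 0 ≤ A.simVar s n H d := by
  by_cases h : A.scale (s + n) d ≠ 0 ∧ weightTotal (s + n) d ≠ 0
  · rw [← (backwardLaw_moments (A := A) h.2 hH hK).2]
    exact integral_nonneg fun _ => sq_nonneg _
  · obtain ⟨h1, h2⟩ := est_eq_zero_of_degenerate (A := A) h
    simp [simVar, h1, h2]

/-- The conditional characteristic function of the backward simulation step. -/
lemma norm_charFun_backwardKernel_sub_le {N : ℕ} (hC : A.BoundedBy (s + n) C) (hN : 0 < N)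
    {d : Swarm N X} (hd : ∀ u ≤ s + n, ∀ i, (d u i).2 ≤ C) (hw : weightTotal (s + n) d ≠ 0)
    {H : (Fin (n + 1) → X) → ℝ} (hH : Measurable H) {K : ℝ} (hK0 : 0 ≤ K) (hK : ∀ z, |H z| ≤ K)
    (u : ℝ) :
    ‖∫ j, Complex.exp ((u * (√(N : ℝ) * ((A.estMass (s + n) d : ℝ) * pathAverage s n H (d, j) -
      ∫ y, onSegment s n H y ∂(A.est (s + n) d))) : ℝ) * Complex.I) ∂(backwardKernel M s n d) -
      Complex.exp (-(u ^ 2 * A.simVar s n H d / 2 : ℝ))‖ ≤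
      iidConst |u * (2 * K * (((C : ℝ) * C) ^ (s + n) * C))| / √(N : ℝ) := by
  have := isProbabilityMeasure_backwardLaw (M := M) hw
  obtain ⟨h1, h2⟩ := backwardLaw_moments (A := A) hw hH hK
  have hmass : (A.estMass (s + n) d : ℝ) ≤ ((C : ℝ) * C) ^ (s + n) * C := by
    exact_mod_cast estMass_le hC le_rfl hd
  have hb : ∀ j : Fin (n + 1) → Fin N, |(A.estMass (s + n) d : ℝ) *
      H (fun k => (d (s + k) (j k)).1) - ∫ y, onSegment s n H y ∂(A.est (s + n) d)| ≤
      2 * K * (((C : ℝ) * C) ^ (s + n) * C) := fun j => by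
    refine (abs_sub _ _).trans ?_
    rw [abs_mul, NNReal.abs_eq]
    have h3 := abs_integral_est_le (A := A) (s + n) d (f := onSegment s n H) fun y => hK _
    have h4 : (A.estMass (s + n) d : ℝ) * |H (fun k => (d (s + k) (j k)).1)| ≤
        (A.estMass (s + n) d : ℝ) * K := by gcongr; exact hK _
    have h5 : K * (A.estMass (s + n) d : ℝ) ≤ K * (((C : ℝ) * C) ^ (s + n) * C) := by gcongr
    linarith
  have key := norm_charFun_pi_sub_exp_le hN (backwardLaw M s n d) Measurable.of_discrete
    (ae_of_all _ hb) h1 u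
  rw [h2] at key
  rw [backwardKernel_apply]
  convert key using 7 with j
  rw [← sqrt_mul_inv hN, pathAverage, Finset.sum_sub_distrib, ← Finset.mul_sum, Finset.sum_const,
    Finset.card_univ, Fintype.card_fin, nsmul_eq_mul]
  have hN' : (N : ℝ) ≠ 0 := by exact_mod_cast hN.ne'
  field_simp

variable {Ω : Type*} [MeasurableSpace Ω] {P : Measure Ω} [IsProbabilityMeasure P]

/-- The conditional variances of the backward simulation step converge in `L¹`. -/
lemma tendsto_lintegral_enorm_simVar_sub {D : (N : ℕ) → ℕ → Ω → Swarm N X}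
    {Z : (N : ℕ) → ℕ → Ω → Fin N → Fin N × X} (h : ∀ N, A.IsRun P (s + n) (D N) (Z N))
    (hC : A.BoundedBy (s + n) C) {H : (Fin (n + 1) → X) → ℝ} (hH : Measurable H) {K : ℝ}
    (hK0 : 0 ≤ K) (hK : ∀ z, |H z| ≤ K)
    (h0 : ∫ y, onSegment s n H y ∂(M.pathMeasure (s + n)) = 0) :
    Tendsto (fun N => ∫⁻ ω, ‖A.simVar s n H (D N (s + n) ω) - M.mass (s + n) *
      ∫ y, onSegment s n (fun z => H z ^ 2) y ∂(M.pathMeasure (s + n))‖ₑ ∂P) atTop (𝓝 0) := by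
  have hHm := measurable_onSegment s n hH
  have hH2 := measurable_onSegment s n (hH.pow_const 2)
  have hK2 : ∀ z, |H z ^ 2| ≤ K ^ 2 := fun z => by
    rw [abs_pow]; exact pow_le_pow_left₀ (abs_nonneg _) (hK z) 2
  have l₁ := tendsto_lintegral_enorm_est_sub h hC le_rfl hH2 (K := K ^ 2) (by positivity)
    fun y => hK2 _
  have l₂ := tendsto_lintegral_estMass h hC le_rfl
  have l₃ := tendsto_lintegral_enorm_est_sub h hC le_rfl hHm hK0 fun y => hK _
  set S := ∫ y, onSegment s n (fun z => H z ^ 2) y ∂(M.pathMeasure (s + n)) with hS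
  set B : ℝ := ((C : ℝ) * C) ^ (s + n) * C with hB
  have hB0 : 0 ≤ B := by positivity
  have hk : ∀ (k : ℝ) {r : ℕ → ℝ≥0∞}, Tendsto r atTop (𝓝 0) →
      Tendsto (fun N => ENNReal.ofReal k * r N) atTop (𝓝 0) := fun k r hr => by
    simpa using ENNReal.Tendsto.const_mul hr (Or.inr ENNReal.ofReal_ne_top)
  have hadd : ∀ {r r' : ℕ → ℝ≥0∞}, Tendsto r atTop (𝓝 0) → Tendsto r' atTop (𝓝 0) →
      Tendsto (fun N => r N + r' N) atTop (𝓝 0) := fun hr hr' => by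
    simpa using hr.add hr'
  have hsum := hadd (hadd (hk B l₁) (hk |S| l₂)) (hk (K * B) l₃)
  refine tendsto_of_tendsto_of_tendsto_of_le_of_le tendsto_const_nhds hsum
    (fun _ => zero_le) fun N => ?_
  refine (lintegral_mono_ae (((h N).ae_weight_le hC (t := s + n) le_rfl).mono fun ω hω => ?_)
    (g := fun ω => ENNReal.ofReal B * ‖∫ y, onSegment s n (fun z => H z ^ 2) y
        ∂(A.est (s + n) (D N (s + n) ω)) - S‖ₑ +
      ENNReal.ofReal |S| * ‖(A.estMass (s + n) (D N (s + n) ω) : ℝ) - M.mass (s + n)‖ₑ +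
      ENNReal.ofReal (K * B) * ‖∫ y, onSegment s n H y ∂(A.est (s + n) (D N (s + n) ω)) -
        ∫ y, onSegment s n H y ∂(M.pathMeasure (s + n))‖ₑ)).trans (le_of_eq ?_)
  · set d := D N (s + n) ω
    have hmass : (A.estMass (s + n) d : ℝ) ≤ B := by
      exact_mod_cast estMass_le hC le_rfl hω
    have e : A.simVar s n H d - M.mass (s + n) * S = (A.estMass (s + n) d : ℝ) *
        (∫ y, onSegment s n (fun z => H z ^ 2) y ∂(A.est (s + n) d) - S) +
        S * ((A.estMass (s + n) d : ℝ) - M.mass (s + n)) -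
        (∫ y, onSegment s n H y ∂(A.est (s + n) d)) *
          (∫ y, onSegment s n H y ∂(A.est (s + n) d) -
            ∫ y, onSegment s n H y ∂(M.pathMeasure (s + n))) := by
      rw [h0, simVar]
      ring
    rw [e]
    refine enorm_sub_le.trans (add_le_add ((enorm_add_le _ _).trans (add_le_add ?_ ?_)) ?_)
    · rw [enorm_mul]
      gcongr
      rw [Real.enorm_eq_ofReal_abs, NNReal.abs_eq]
      exact ENNReal.ofReal_le_ofReal hmass
    · rw [enorm_mul, Real.enorm_eq_ofReal_abs]
    · rw [enorm_mul]
      gcongr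
      rw [Real.enorm_eq_ofReal_abs]
      refine ENNReal.ofReal_le_ofReal ?_
      refine (abs_integral_est_le (A := A) (s + n) d (f := onSegment s n H) fun y => hK _).trans ?_
      gcongr
  · have m₁ : Measurable fun ω => ‖∫ y, onSegment s n (fun z => H z ^ 2) y
        ∂(A.est (s + n) (D N (s + n) ω)) - S‖ₑ :=
      (((A.measurable_integral_est _ hH2).comp ((h N).measurable_D _)).sub_const _).enorm
    have m₂ : Measurable fun ω => ‖(A.estMass (s + n) (D N (s + n) ω) : ℝ) - M.mass (s + n)‖ₑ :=
      ((((A.measurable_estMass _).comp ((h N).measurable_D _)).coe_nnreal_real).sub_const _).enorm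
    have m₁₂ := (m₁.const_mul (ENNReal.ofReal B)).add (m₂.const_mul (ENNReal.ofReal |S|))
    simp only [Pi.add_def] at m₁₂
    rw [lintegral_add_left m₁₂, lintegral_add_left (m₁.const_mul _), lintegral_const_mul _ m₁,
      lintegral_const_mul _ m₂, lintegral_const_mul' _ _ ENNReal.ofReal_ne_top]

/-- The central limit theorem for the backward simulation estimator, before normalization. -/
lemma tendstoInDistribution_pathAverage {D : (N : ℕ) → ℕ → Ω → Swarm N X}
    {Z : (N : ℕ) → ℕ → Ω → Fin N → Fin N × X} (h : ∀ N, A.IsRun P (s + n) (D N) (Z N))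
    (hC : A.BoundedBy (s + n) C) {H : (Fin (n + 1) → X) → ℝ} (hH : Measurable H) {K : ℝ}
    (hK0 : 0 ≤ K) (hK : ∀ z, |H z| ≤ K)
    (h0 : ∫ y, onSegment s n H y ∂(M.pathMeasure (s + n)) = 0)
    {J : (N : ℕ) → Ω → Fin N → Fin (n + 1) → Fin N} (hJm : ∀ N, Measurable (J N))
    (hJ : ∀ N, IsCondLawOn P (D N (s + n)) (J N) (backwardKernel M s n)
      {d | A.scale (s + n) d ≠ 0 ∧ weightTotal (s + n) d ≠ 0}) :
    TendstoInDistribution (fun (N : ℕ) ω => √(N : ℝ) * ((A.estMass (s + n) (D N (s + n) ω) : ℝ) *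
      pathAverage s n H (D N (s + n) ω, J N ω))) atTop id
      (fun _ => P) (gaussianReal 0 (A.pathVar (s + n) (onSegment s n H) (s + n) +
        M.mass (s + n) * ∫ y, onSegment s n (fun z => H z ^ 2) y
          ∂(M.pathMeasure (s + n))).toNNReal) := by
  have hHm := measurable_onSegment s n hH
  have hpm : ∀ N, Measurable fun p : Swarm N X × (Fin N → Fin (n + 1) → Fin N) =>
      (A.estMass (s + n) p.1 : ℝ) * pathAverage s n H p := fun N =>
    ((A.measurable_estMass _).comp measurable_fst).coe_nnreal_real.mul
      (measurable_pathAverage s n hH)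
  have hσ : 0 ≤ M.mass (s + n) * ∫ y, onSegment s n (fun z => H z ^ 2) y
      ∂(M.pathMeasure (s + n)) :=
    mul_nonneg measureReal_nonneg (integral_nonneg fun _ => sq_nonneg _)
  refine tendstoInDistribution_gaussian (fun N => ?_)
    (add_nonneg (A.pathVar_nonneg _ _ _) hσ) fun u => ?_
  · exact (((hpm N).comp (((h N).measurable_D _).prodMk (hJm N))).const_mul _).aemeasurable
  have h1 := tendsto_charFun_est h hC hHm hK0 (fun y => hK _) h0 u le_rfl
  simp only [StateSpaceModel.L, Nat.sub_self, StateSpaceModel.Laux] at h1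
  refine tendsto_charFun_of_enorm_le h1 (r := fun N =>
    ENNReal.ofReal (iidConst |u * (2 * K * (((C : ℝ) * C) ^ (s + n) * C))| / √(N : ℝ)) +
      ENNReal.ofReal (u ^ 2 / 2) * ∫⁻ ω, ‖A.simVar s n H (D N (s + n) ω) - M.mass (s + n) *
      ∫ y, onSegment s n (fun z => H z ^ 2) y ∂(M.pathMeasure (s + n))‖ₑ ∂P) ?_ ?_
  · filter_upwards [eventually_gt_atTop 0] with N hN
    have hue := A.measurable_integral_est (N := N) (s + n) hHm
    have hwm : Measurable fun d : Swarm N X => weightTotal (s + n) d := by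
      unfold weightTotal; fun_prop
    -- Backward simulation is treated as one more martingale step: `U` is the estimate before
    -- sampling, and `V` is the sampling error, which is conditionally a centred i.i.d. average with
    -- variance `simVar`.
    have key := IsCondLawOn.enorm_charFun_sub_le (hJ N) ((h N).measurable_D (s + n)) (hJm N)
      ((A.measurable_scale _ (measurableSet_singleton 0).compl).inter
        (hwm (measurableSet_singleton 0).compl))
      (U := fun d => √(N : ℝ) * ∫ y, onSegment s n H y ∂(A.est (s + n) d)) (hue.const_mul _)
      (V := fun p => √(N : ℝ) * ((A.estMass (s + n) p.1 : ℝ) * pathAverage s n H p -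
        ∫ y, onSegment s n H y ∂(A.est (s + n) p.1)))
      (((hpm N).sub (hue.comp measurable_fst)).const_mul _)
      (v := A.simVar s n H) (simVar_nonneg hH hK) hσ
      (ε := iidConst |u * (2 * K * (((C : ℝ) * C) ^ (s + n) * C))| / √(N : ℝ))
      (by unfold iidConst; positivity) (u := u) ?_ ?_ ?_
    · convert key using 6 with ω
      congr 3
      ring
    · filter_upwards [(h N).ae_weight_le hC (t := s + n) le_rfl] with ω hω hs
      exact norm_charFun_backwardKernel_sub_le hC hN hω hs.2 hH hK0 hK u
    · intro d hs
      have := isProbabilityMeasure_backwardLaw (M := M) hs.2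
      rw [backwardKernel_apply]
      exact measure_univ
    · intro ω hs
      obtain ⟨h2, h3⟩ := est_eq_zero_of_degenerate (A := A) hs
      simp [simVar, h2, h3]
  · have l1 := tendsto_ofReal_div_sqrt (iidConst |u * (2 * K * (((C : ℝ) * C) ^ (s + n) * C))|)
    have l2 := ENNReal.Tendsto.const_mul (a := ENNReal.ofReal (u ^ 2 / 2))
      (tendsto_lintegral_enorm_simVar_sub h hC hH hK0 hK h0) (Or.inr ENNReal.ofReal_ne_top)
    simpa using l1.add l2

end AuxiliaryProposal

end BackwardSimulation

/-! ### Normalization: central limit theorems for FFBSm and FFBSi. -/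

section SmoothingLimits

variable {X : Type*} [MeasurableSpace X]

lemma BoundedWeights.exists_boundedBy {M : StateSpaceModel X} {A : AuxiliaryProposal M} {T : ℕ}
    (hg : ∃ C : ℝ≥0, ∀ t ≤ T, ∀ x, M.g t x ≤ C) (hw : A.BoundedWeights T) :
    ∃ C : ℝ≥0, A.BoundedBy T C := by
  obtain ⟨C₁, h₁⟩ := hg
  obtain ⟨C₂, h₂, h₃, h₄⟩ := hw
  have hle : (C₂ : ℝ≥0∞) ≤ (max C₁ C₂ : ℝ≥0) := ENNReal.coe_le_coe.2 (le_max_right _ _)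
  exact ⟨max C₁ C₂, fun t ht x => (h₁ t ht x).trans (le_max_left _ _),
    fun t h1 ht x => (h₂ t h1 ht x).trans (le_max_right _ _), h₃.mono fun x hx => hx.trans hle,
    fun t h1 ht x x' => (h₄ t h1 ht x x').trans hle⟩

namespace AuxiliaryProposal

variable {M : StateSpaceModel X} {A : AuxiliaryProposal M} {s n : ℕ} {C : ℝ≥0}
  {Ω : Type*} [MeasurableSpace Ω] {P : Measure Ω} [IsProbabilityMeasure P]

lemma measurable_ffbsm {N : ℕ} {ξ : ℕ → Fin N → Ω → X} {I : ℕ → Fin N → Ω → Fin N}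
    (h : A.IsParticleFilter P (s + n) ξ I) {H : (Fin (n + 1) → X) → ℝ} (hH : Measurable H) :
    Measurable (A.ffbsm ξ I s n H) := by
  have e : A.ffbsm ξ I s n H = (fun d : Swarm N X => ∑ j : Fin (n + 1) → Fin N,
      (M.indexWeight d s n j : ℝ) * H (fun k => (d (s + k) (j k)).1)) ∘ A.cloud ξ I (s + n) :=
    funext fun ω => A.ffbsm_eq ξ I s n H ω
  rw [e]
  refine Measurable.comp (Finset.measurable_sum _ fun j _ => ?_) (h.isRun.measurable_D _)
  exact (M.measurable_indexWeight s n j).coe_nnreal_real.mul (hH.comp (by fun_prop))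

omit [MeasurableSpace Ω] in
lemma ffbsi_eq_pathAverage (A : AuxiliaryProposal M) {N : ℕ} (ξ : ℕ → Fin N → Ω → X)
    (I : ℕ → Fin N → Ω → Fin N) (J : Fin N → Ω → Fin (n + 1) → Fin N)
    (H : (Fin (n + 1) → X) → ℝ) (ω : Ω) :
    ffbsi ξ s n J H ω = pathAverage s n H (A.cloud ξ I (s + n) ω, fun ℓ => J ℓ ω) :=
  A.ffbsi_eq ξ I s n J H ω

omit [MeasurableSpace X] in
lemma pathAverage_sub_const {N : ℕ} (hN : N ≠ 0) (H : (Fin (n + 1) → X) → ℝ) (c : ℝ)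
    (p : Swarm N X × (Fin N → Fin (n + 1) → Fin N)) :
    pathAverage s n (fun z => H z - c) p = pathAverage s n H p - c := by
  have hN' : (N : ℝ) ≠ 0 := by exact_mod_cast hN
  rw [pathAverage, Finset.sum_sub_distrib, mul_sub, Finset.sum_const, Finset.card_univ,
    Fintype.card_fin, nsmul_eq_mul, inv_mul_cancel_left₀ hN']
  rfl

variable [MeasurableSingletonClass X]

/-- The central limit theorem for the FFBSm estimator. -/
theorem tendstoInDistribution_ffbsm {ξ : (N : ℕ) → ℕ → Fin N → Ω → X}
    {I : (N : ℕ) → ℕ → Fin N → Ω → Fin N} (hξ : ∀ N, A.IsParticleFilter P (s + n) (ξ N) (I N))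
    (hC : A.BoundedBy (s + n) C) (hmass : 0 < M.mass (s + n)) {H : (Fin (n + 1) → X) → ℝ}
    (hH : Measurable H) {c K : ℝ} (hK0 : 0 ≤ K) (hK : ∀ z, |H z - c| ≤ K)
    (h0 : ∫ y, onSegment s n (fun z => H z - c) y ∂(M.pathMeasure (s + n)) = 0) :
    TendstoInDistribution (fun (N : ℕ) ω => √(N : ℝ) * (A.ffbsm (ξ N) (I N) s n H ω - c)) atTop id
      (fun _ => P) (gaussianReal 0 (A.pathVar (s + n) (onSegment s n fun z => H z - c) (s + n) /
        M.mass (s + n) ^ 2).toNNReal) := by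
  have hrun := fun N => (hξ N).isRun
  have hHm := measurable_onSegment s n (hH.sub_const c)
  refine TendstoInDistribution.gaussian_of_mul (A.pathVar_nonneg _ _ _) hmass
    (tendstoInDistribution_est hrun hC hHm hK0 (fun y => hK _) h0)
    (tendstoInMeasure_estMass hrun hC le_rfl)
    (fun N => (((A.measurable_estMass _).comp ((hrun N).measurable_D _)).coe_nnreal_real).aemeasurable)
    (fun N => (((measurable_ffbsm (hξ N) hH).sub_const c).const_mul _).aemeasurable) ?_
  refine tendsto_const_nhds.congr fun N => Eq.symm ?_
  change P {ω | ¬ _ = _} = 0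
  refine ae_iff.1 ?_
  -- The ratio identity requires the index weights to agree with the backward law, which holds on
  -- this event of probability one.
  filter_upwards [IsRun.ae_isReachable A (hrun N) le_rfl] with ω hω
  rw [← estMass_mul_sub hω hH c hK, A.ffbsm_eq]
  ring

/-- The central limit theorem for the FFBSi estimator. -/
theorem tendstoInDistribution_ffbsi {ξ : (N : ℕ) → ℕ → Fin N → Ω → X}
    {I : (N : ℕ) → ℕ → Fin N → Ω → Fin N} (hξ : ∀ N, A.IsParticleFilter P (s + n) (ξ N) (I N))
    {J : (N : ℕ) → Fin N → Ω → Fin (n + 1) → Fin N}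
    (hJ : ∀ N, A.IsBackwardSample P (ξ N) (I N) s n (J N))
    (hC : A.BoundedBy (s + n) C) (hmass : 0 < M.mass (s + n)) {H : (Fin (n + 1) → X) → ℝ}
    (hH : Measurable H) {c K : ℝ} (hK0 : 0 ≤ K) (hK : ∀ z, |H z - c| ≤ K)
    (h0 : ∫ y, onSegment s n (fun z => H z - c) y ∂(M.pathMeasure (s + n)) = 0) :
    TendstoInDistribution (fun (N : ℕ) ω => √(N : ℝ) * (ffbsi (ξ N) s n (J N) H ω - c)) atTop id
      (fun _ => P) (gaussianReal 0 ((A.pathVar (s + n) (onSegment s n fun z => H z - c) (s + n) +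
        M.mass (s + n) * ∫ y, onSegment s n (fun z => (H z - c) ^ 2) y
          ∂(M.pathMeasure (s + n))) / M.mass (s + n) ^ 2).toNNReal) := by
  have hrun := fun N => (hξ N).isRun
  have hJm : ∀ N, Measurable fun ω ℓ => J N ℓ ω := fun N => measurable_pi_iff.2 (hJ N).measurable
  refine TendstoInDistribution.gaussian_of_mul (add_nonneg (A.pathVar_nonneg _ _ _)
      (mul_nonneg hmass.le (integral_nonneg fun _ => sq_nonneg _))) hmass
    (tendstoInDistribution_pathAverage hrun hC (hH.sub_const c) hK0 hK h0 hJm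
      fun N => (hJ N).isCondLawOn (hξ N))
    (tendstoInMeasure_estMass hrun hC le_rfl)
    (fun N => (((A.measurable_estMass _).comp ((hrun N).measurable_D _)).coe_nnreal_real).aemeasurable)
    (fun N => ?_) ?_
  · simp_rw [A.ffbsi_eq_pathAverage (ξ N) (I N) (J N) H]
    exact ((((measurable_pathAverage s n hH).comp
      (((hrun N).measurable_D _).prodMk (hJm N))).sub_const c).const_mul _).aemeasurable
  · refine tendsto_const_nhds.congr fun N => Eq.symm ?_
    change P {ω | ¬ _ = _} = 0
    refine ae_iff.1 (ae_of_all _ fun ω => ?_)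
    -- With no particles an average does not commute with subtracting a constant, but both sides
    -- carry the factor `√0`.
    rcases eq_or_ne N 0 with rfl | hN
    · simp
    rw [pathAverage_sub_const hN, A.ffbsi_eq_pathAverage (ξ N) (I N) (J N) H]
    ring

end AuxiliaryProposal

end SmoothingLimits

end ParticleSmoothing

end

/-! ### The main theorem. -/

theorem mainTheorem1 {X : Type*} [TopologicalSpace X] [PolishSpace X] [MeasurableSpace X]
    [BorelSpace X] (M : ParticleSmoothing.StateSpaceModel X)
    (A : ParticleSmoothing.AuxiliaryProposal M) (s n : ℕ)
    (hpos : 0 < M.unnormalized (s + n) (fun _ => 1))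
    (hg : ∃ C : ℝ≥0, ∀ t ≤ s + n, ∀ x, M.g t x ≤ C)
    (hw : A.BoundedWeights (s + n))
    (h : (Fin (n + 1) → X) → ℝ) (h_meas : Measurable h) (h_bdd : ∃ C : ℝ, ∀ x, |h x| ≤ C)
    {Ω : Type*} [MeasurableSpace Ω] (P : Measure Ω) [IsProbabilityMeasure P]
    (ξ : (N : ℕ) → ℕ → Fin N → Ω → X) (I : (N : ℕ) → ℕ → Fin N → Ω → Fin N)
    (hξ : ∀ N, A.IsParticleFilter P (s + n) (ξ N) (I N))
    (φh Γ : ℝ)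
    (hφ : φh = M.smoothing (s + n) (ParticleSmoothing.onSegment s n h))
    (hΓ : Γ = A.smoothingVariance s (s + n)
      (ParticleSmoothing.onSegment s n (fun x => h x - φh))) :
    TendstoInDistribution
      (fun (N : ℕ) ω => √(N : ℝ) * (A.ffbsm (ξ N) (I N) s n h ω - φh))
      atTop id (fun _ => P) (gaussianReal 0 Γ.toNNReal) ∧
    ∀ J : (N : ℕ) → Fin N → Ω → Fin (n + 1) → Fin N,
      (∀ N, A.IsBackwardSample P (ξ N) (I N) s n (J N)) →
      TendstoInDistribution
        (fun (N : ℕ) ω => √(N : ℝ) * (ParticleSmoothing.ffbsi (ξ N) s n (J N) h ω - φh))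
        atTop id (fun _ => P)
        (gaussianReal 0 (M.smoothing (s + n)
          (ParticleSmoothing.onSegment s n (fun x => (h x - φh) ^ 2)) + Γ).toNNReal) := by
  obtain ⟨C, hC⟩ := ParticleSmoothing.BoundedWeights.exists_boundedBy hg hw
  obtain ⟨K₀, hK₀⟩ := h_bdd
  have hfin := M.isFiniteMeasure_pathMeasure hC.g_le le_rfl
  have hmass : 0 < M.mass (s + n) := by
    rwa [M.unnormalized_one hC.g_le le_rfl] at hpos
  have hm : Measurable fun x => h x - φh := h_meas.sub_const φh
  have hK : ∀ x, |h x - φh| ≤ |K₀| + |φh| := fun x =>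
    (abs_sub _ _).trans (add_le_add_left ((hK₀ x).trans (le_abs_self _)) _)
  have hK0 : 0 ≤ |K₀| + |φh| := by positivity
  have hint : ∀ (H : (Fin (n + 1) → X) → ℝ) (K : ℝ), Measurable H → (∀ x, |H x| ≤ K) →
      Integrable (ParticleSmoothing.onSegment s n H) (M.pathMeasure (s + n)) := fun H K hH hK =>
    ParticleSmoothing.Integrable_of_abs_le
      (ParticleSmoothing.measurable_onSegment s n hH).aestronglyMeasurable
      (ae_of_all _ fun y => hK _)
  have h0 : ∫ y, ParticleSmoothing.onSegment s n (fun x => h x - φh) y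
      ∂(M.pathMeasure (s + n)) = 0 := by
    have h1 := M.smoothing_eq hC.g_le le_rfl (ParticleSmoothing.measurable_onSegment s n h_meas)
      (hint h K₀ h_meas hK₀)
    rw [← hφ, eq_div_iff hmass.ne'] at h1
    have h2 := integral_sub (hint h K₀ h_meas hK₀)
      (integrable_const (μ := M.pathMeasure (s + n)) φh)
    simp only [integral_const, smul_eq_mul] at h2
    refine h2.trans ?_
    rw [← h1, mul_comm]
    exact sub_self _
  have hdep : ∀ y y' : ℕ → X, (∀ u, s ≤ u → u ≤ s + n → y u = y' u) →
      ParticleSmoothing.onSegment s n (fun x => h x - φh) y =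
        ParticleSmoothing.onSegment s n (fun x => h x - φh) y' := fun y y' hy => by
    unfold ParticleSmoothing.onSegment
    congr 2
    funext k
    exact hy _ (by omega) (by omega)
  have hΓ' : Γ = A.pathVar (s + n) (ParticleSmoothing.onSegment s n fun x => h x - φh) (s + n) /
      M.mass (s + n) ^ 2 :=
    hΓ.trans (ParticleSmoothing.AuxiliaryProposal.smoothingVariance_eq hC (Nat.le_add_right s n)
      hmass.ne' (ParticleSmoothing.measurable_onSegment s n hm) hK0 (fun y => hK _) hdep)
  refine ⟨?_, fun J hJ => ?_⟩
  · rw [hΓ']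
    exact ParticleSmoothing.AuxiliaryProposal.tendstoInDistribution_ffbsm hξ hC hmass h_meas hK0
      hK h0
  · have h1 := M.smoothing_eq hC.g_le le_rfl
      (ParticleSmoothing.measurable_onSegment s n (hm.pow_const 2))
      (hint _ ((|K₀| + |φh|) ^ 2) (hm.pow_const 2) fun x => by
        rw [abs_pow]; exact pow_le_pow_left₀ (abs_nonneg _) (hK x) 2)
    have h2 := ParticleSmoothing.AuxiliaryProposal.tendstoInDistribution_ffbsi hξ hJ hC hmass
      h_meas hK0 hK h0
    rw [hΓ', h1]
    -- The two variances agree because the sampling term `mass · ∫ (h - φ(h))²`, divided by `mass²`,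
    -- is the normalized smoothing expectation of `(h - φ(h))²`.
    convert h2 using 3
    field_simp
    ring
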